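/- Let $(\mathsf X,\mathcal X)$ be a measurable space, $\nu$ a measure on it, $M_0$ a probability measure on $\mathsf X$ and $(M_t)_{t\ge 1}$ Markov kernels on $\mathsf X$ such that $M_0$ has a density $m_0$ and, for all $t\ge 1$ and $x\in\mathsf X$, $M_t(x,\cdot)$ has a density $m_t(x,\cdot)$ with respect to $\nu$ (with $m_t$ jointly measurable). Let $(g_t)_{t\ge 0}$ be measurable real functions on $\mathsf X$. Assume: (i) there is $G_\infty>0$ with $0<g_t(x)\le G_\infty$ for all $t\ge 0$, $x\in\mathsf X$; (ii) $m_t(x,x')>0$ for all $t\ge 1$ and $x,x'\in\mathsf X$; (iii) there is $\sigma_+>0$ with $m_t(x,x')\le\sigma_+$ for all $t\ge1$ and $x,x'\in\mathsf X$. Particle filter. For each number of particles $N$, let $\xi_0^1,\dots,\xi_0^N$ be i.i.d. with law $M_0$ and, for $t\ge0$, conditionally on $\mathcal F_t=\sigma(\xi^i_s, s\le t;\ A^i_s, s<t;\ 1\le i\le N)$, let the pairs $(A_t^i,\xi_{t+1}^i)$, $1\le i\le N$, be independent, with $A_t^i$ equal to $j$ with probability $W_t^j$ and $\xi_{t+1}^i\sim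 M_{t+1}(\xi_t^{A_t^i},\cdot)$ given $A_t^i$, where $W_t^j=g_t(\xi_t^j)/\Omega_t$ and $\Omega_t=\sum_{\ell=1}^N g_t(\xi_t^\ell)$. Put $\gamma_t^N(\mathbf 1)=\prod_{s=0}^{t-1}N^{-1}\Omega_s$. Estimator. For $t\ge0$, $b\in\{0,1\}^{t+1}$ and index paths $k^1,k^2\in\{1,\dots,N\}^{t+1}$, let $$\beta_s(k,\ell)=\frac{g_{s-1}(\xi_{s-1}^\ell)\,m_s(\xi_{s-1}^\ell,\xi_s^k)}{\sum_{j=1}^N g_{s-1}(\xi_{s-1}^j)\,m_s(\xi_{s-1}^j,\xi_s^k)},\qquad \Lambda_1(k^1)=\frac1N\prod_{s=1}^t\beta_s(k^1_s,k^1_{s-1}),$$ $$\Lambda_2(k^1;k^2)=\frac1N\prod_{s=1}^t\big\{\mathbf 1_{k^2_s=k^1_s}W_{s-1}^{k^2_{s-1}}+\mathbf 1_{k^2_s\ne k^1_s}\beta_s(k^2_s,k^2_{s-1})\big\},$$ let $I_b(k^1,k^2)=1$ if, for all $0\le s\le t$, $k^1_s=k^2_s$ exactly when $b_s=1$, and $I_b(k^1,k^2)=0$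 otherwise, and for measurable $h:\mathsf X^{t+1}\times\mathsf X^{t+1}\to\mathbb R$ let $$\hat\gamma^{\mathsf{BS}}_{b,t}(h)=\prod_{s=0}^t N^{b_s}\Big(\frac N{N-1}\Big)^{1-b_s}\ \gamma_t^N(\mathbf 1)^2\sum_{k^1,k^2}\Lambda_1(k^1)\Lambda_2(k^1;k^2)\,I_b(k^1,k^2)\,h\big((\xi_s^{k^1_s})_{0\le s\le t},(\xi_s^{k^2_s})_{0\le s\le t}\big).$$ Target. Let $\mathbf M_0^{b_0}(dx,dx')=M_0(dx)\{\mathbf 1_{b_0=0}M_0(dx')+\mathbf 1_{b_0=1}\delta_x(dx')\}$ and, for $s\ge1$, $\mathbf M_s^{b_s}(x,x';dz,dz')=M_s(x,dz)\{\mathbf 1_{b_s=0}M_s(x',dz')+\mathbf 1_{b_s=1}\delta_z(dz')\}$, and let $$\mu_{b,t}(dx_{0:t},dx'_{0:t})=\mathbf M_0^{b_0}(dx_0,dx_0')\prod_{s=0}^{t-1}g_s(x_s)g_s(x'_s)\prod_{s=1}^t\mathbf M_s^{b_s}(x_{s-1},x'_{s-1};dx_s,dx'_s).$$ Theorem. For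 every $t\ge0$, every $b\in\{0,1\}^{t+1}$ and every bounded measurable $h:\mathsf X^{t+1}\times\mathsf X^{t+1}\to\mathbb R$, $$\lim_{N\to\infty}\big\|\hat\gamma^{\mathsf{BS}}_{b,t}(h)-\mu_{b,t}(h)\big\|_2=0,$$ where $\|Y\|_2=\mathbb E[|Y|^2]^{1/2}$. If moreover there is $\sigma_->0$ with $m_t(x,x')\ge\sigma_-$ for all $t\ge1$ and $x,x'\in\mathsf X$, then the rate is $O(1/\sqrt N)$: there is a constant $C$, independent of $N$, such that $\|\hat\gamma^{\mathsf{BS}}_{b,t}(h)-\mu_{b,t}(h)\|_2\le C/\sqrt N$ for all $N\ge2$. -/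

import Mathlib

open MeasureTheory ProbabilityTheory Filter
open scoped ENNReal Topology

namespace BackwardSampling

noncomputable section

variable {X : Type*} [MeasurableSpace X]

/-! ### The model: kernels `M t`, densities `m t`, potentials `g t`

`M₀` is the initial law, and `M (t + 1)` is the transition kernel from time `t` to time `t + 1`
(the values `M 0` and `m 0` are never used). -/

/-- `M₀` has density `m₀`, and each `M (t + 1) x` has density `m (t + 1) x`, with respect to
the reference measure `ν`; densities are non-negative and (jointly) measurable. -/
structure HasDensities (ν : Measure X) (M₀ : Measure X) (M : ℕ → Kernel X X)
    (m₀ : X → ℝ) (m : ℕ → X → X → ℝ) : Prop where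
  measurable_init : Measurable m₀
  init_nonneg : ∀ x, 0 ≤ m₀ x
  init_eq : M₀ = ν.withDensity fun x => ENNReal.ofReal (m₀ x)
  measurable : ∀ t, Measurable (Function.uncurry (m (t + 1)))
  nonneg : ∀ t x x', 0 ≤ m (t + 1) x x'
  eq : ∀ t x, M (t + 1) x = ν.withDensity fun x' => ENNReal.ofReal (m (t + 1) x x')

/-- The potentials are measurable, positive and uniformly bounded. -/
def PotentialsBounded (g : ℕ → X → ℝ) : Prop :=
  (∀ t, Measurable (g t)) ∧ ∃ G : ℝ, 0 < G ∧ ∀ t x, 0 < g t x ∧ g t x ≤ G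

/-- The transition densities are positive everywhere. -/
def DensitiesPositive (m : ℕ → X → X → ℝ) : Prop :=
  ∀ t x x', 0 < m (t + 1) x x'

/-- The transition densities are bounded above, uniformly in time and space. -/
def DensitiesBoundedAbove (m : ℕ → X → X → ℝ) : Prop :=
  ∃ σ : ℝ, 0 < σ ∧ ∀ t x x', m (t + 1) x x' ≤ σ

/-- The transition densities are bounded below by a positive constant, uniformly in time and
space. -/
def DensitiesBoundedBelow (m : ℕ → X → X → ℝ) : Prop :=
  ∃ σ : ℝ, 0 < σ ∧ ∀ t x x', σ ≤ m (t + 1) x x'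

/-! ### The target measure -/

/-- The initial law of the bivariate chain: `M₀(dx) M₀(dx')` if `b = 0`, and
`M₀(dx) δ_x(dx')` if `b = 1`. -/
def biInit (M₀ : Measure X) (b : Fin 2) : Measure (X × X) :=
  if b = 0 then M₀.prod M₀ else M₀.map fun x => (x, x)

/-- The transition kernel of the bivariate chain from `(x, x')`: `K(x, dz) K(x', dz')` if
`b = 0`, and `K(x, dz) δ_z(dz')` if `b = 1`. -/
def biKernel (K : Kernel X X) (b : Fin 2) : Kernel (X × X) (X × X) :=
  if b = 0 then K ∥ₖ K else (K.comap Prod.fst measurable_fst).map fun z => (z, z)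

/-- The measure `μ_{b,t}` on pairs of paths `(x_{0:t}, x'_{0:t})`: the law of the bivariate chain
started from `biInit M₀ (b 0)` with kernels `biKernel (M s) (b s)`, weighted by
`∏_{s < t} g s (x_s) * g s (x'_s)`. -/
def pathMeasure (M₀ : Measure X) (M : ℕ → Kernel X X) (g : ℕ → X → ℝ) :
    (t : ℕ) → (Fin (t + 1) → Fin 2) → Measure ((Fin (t + 1) → X) × (Fin (t + 1) → X))
  | 0, b => (biInit M₀ (b 0)).map fun z => (fun _ => z.1, fun _ => z.2)
  | t + 1, b =>
    (((pathMeasure M₀ M g t fun s => b s.castSucc).withDensity fun p =>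
          ENNReal.ofReal (g t (p.1 (Fin.last t)) * g t (p.2 (Fin.last t)))) ⊗ₘ
        (biKernel (M (t + 1)) (b (Fin.last (t + 1)))).comap
          (fun p : (Fin (t + 1) → X) × (Fin (t + 1) → X) => (p.1 (Fin.last t), p.2 (Fin.last t)))
          (by fun_prop)).map
      fun q => (Fin.snoc (α := fun _ => X) q.1.1 q.2.1, Fin.snoc (α := fun _ => X) q.1.2 q.2.2)

/-! ### The estimator, as a function of an array `x s i` of particle positions -/

section Estimator

variable {N : ℕ}

/-- The total weight `Ω_s`. -/
def totalWeight (g : ℕ → X → ℝ) (x : ℕ → Fin N → X) (s : ℕ) : ℝ :=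
  ∑ i, g s (x s i)

/-- The normalized weight of the particle `i` at time `s`. -/
def normWeight (g : ℕ → X → ℝ) (x : ℕ → Fin N → X) (s : ℕ) (i : Fin N) : ℝ :=
  g s (x s i) / totalWeight g x s

/-- The backward weight `β_{s+1}(k, l)` from the particle `k` at time `s + 1` to the particle `l`
at time `s`. -/
def backwardWeight (g : ℕ → X → ℝ) (m : ℕ → X → X → ℝ) (x : ℕ → Fin N → X) (s : ℕ)
    (k l : Fin N) : ℝ :=
  g s (x s l) * m (s + 1) (x s l) (x (s + 1) k) /
    ∑ j, g s (x s j) * m (s + 1) (x s j) (x (s + 1) k)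

/-- The particle approximation `γ_t^N(1) = ∏_{s < t} Ω_s / N` of the normalizing constant. -/
def gammaOne (g : ℕ → X → ℝ) (x : ℕ → Fin N → X) (t : ℕ) : ℝ :=
  ∏ s ∈ Finset.range t, totalWeight g x s / N

/-- The conditional law `Λ_{1,t}` of the first index path. -/
def pathLaw₁ (g : ℕ → X → ℝ) (m : ℕ → X → X → ℝ) (x : ℕ → Fin N → X) (t : ℕ)
    (k : Fin (t + 1) → Fin N) : ℝ :=
  (N : ℝ)⁻¹ * ∏ s : Fin t, backwardWeight g m x s (k s.succ) (k s.castSucc)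

/-- The conditional law `Λ_{2,t}(k₁; ·)` of the second index path given the first. -/
def pathLaw₂ (g : ℕ → X → ℝ) (m : ℕ → X → X → ℝ) (x : ℕ → Fin N → X) (t : ℕ)
    (k₁ k₂ : Fin (t + 1) → Fin N) : ℝ :=
  (N : ℝ)⁻¹ * ∏ s : Fin t,
    if k₂ s.succ = k₁ s.succ then normWeight g x s (k₂ s.castSucc)
    else backwardWeight g m x s (k₂ s.succ) (k₂ s.castSucc)

/-- The coalescence function: `1` if the two index paths meet exactly at the times `s` with
`b s = 1`, and `0` otherwise. -/
def coalescence {t : ℕ} (b : Fin (t + 1) → Fin 2) (k₁ k₂ : Fin (t + 1) → Fin N) : ℝ :=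
  ∏ s, ((if k₁ s = k₂ s ∧ b s = 1 then 1 else 0) + (if k₁ s ≠ k₂ s ∧ b s = 0 then 1 else 0))

/-- The backward-sampling estimator of `∫ h dμ_{b,t}`. The double sum is the expectation, given
the particles, of `coalescence b K₁ K₂ * h (x^{K₁}_{0:t}, x^{K₂}_{0:t})` when the index paths
`(K₁, K₂)` have the law `Λ_{1,t} ⊗ Λ_{2,t}`. -/
def bsEstimator (g : ℕ → X → ℝ) (m : ℕ → X → X → ℝ) (t : ℕ) (b : Fin (t + 1) → Fin 2)
    (h : (Fin (t + 1) → X) × (Fin (t + 1) → X) → ℝ) (x : ℕ → Fin N → X) : ℝ :=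
  (∏ s, if b s = 1 then (N : ℝ) else (N : ℝ) / ((N : ℝ) - 1)) * gammaOne g x t ^ 2 *
    ∑ k₁ : Fin (t + 1) → Fin N, ∑ k₂ : Fin (t + 1) → Fin N,
      pathLaw₁ g m x t k₁ * pathLaw₂ g m x t k₁ k₂ *
        (coalescence b k₁ k₂ * h (fun s => x s (k₁ s), fun s => x s (k₂ s)))

end Estimator

/-! ### The bootstrap particle filter -/

section ParticleFilter

variable {Ω : Type*} {N : ℕ}

/-- The σ-field generated by the particles `ξ s i`, `s ≤ t`, and the ancestor indices `A s i`,
`s < t`. -/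
abbrev history (ξ : ℕ → Fin N → Ω → X) (A : ℕ → Fin N → Ω → Fin N) (t : ℕ) : MeasurableSpace Ω :=
  (⨆ (s : ℕ) (_ : s ≤ t) (i : Fin N), MeasurableSpace.comap (ξ s i) inferInstance) ⊔
    ⨆ (s : ℕ) (_ : s < t) (i : Fin N), MeasurableSpace.comap (A s i) inferInstance

/-- `(ξ, A)` is a bootstrap particle filter with `N` particles and multinomial resampling: the
particles at time `0` are i.i.d. with law `M₀` and, conditionally on the history up to time `t`,
the pairs `(A t i, ξ (t + 1) i)` are independent over `i`, with `A t i` categorical with the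
normalized weights at time `t` and `ξ (t + 1) i` drawn from `M (t + 1) (ξ t (A t i))`. -/
structure IsParticleFilter [MeasurableSpace Ω] (P : Measure Ω) (M₀ : Measure X)
    (M : ℕ → Kernel X X) (g : ℕ → X → ℝ)
    (ξ : ℕ → Fin N → Ω → X) (A : ℕ → Fin N → Ω → Fin N) : Prop where
  measurable_particle : ∀ t i, Measurable (ξ t i)
  measurable_ancestor : ∀ t i, Measurable (A t i)
  init : P.map (fun ω i => ξ 0 i ω) = Measure.pi fun _ => M₀
  step : ∀ (t : ℕ) (S : Set Ω), MeasurableSet[history ξ A t] S →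
    ∀ (a : Fin N → Fin N) (B : Fin N → Set X), (∀ i, MeasurableSet (B i)) →
      P (S ∩ {ω | ∀ i, A t i ω = a i ∧ ξ (t + 1) i ω ∈ B i}) =
        ∫⁻ ω in S, ∏ i, ENNReal.ofReal (normWeight g (fun s j => ξ s j ω) t (a i)) *
          M (t + 1) (ξ t (a i) ω) (B i) ∂P

end ParticleFilter

end

end BackwardSampling

open BackwardSampling

namespace BackwardSampling

/-! ### Bounded functions of independent samples -/

section ProductMeasure

variable {X : Type*} [MeasurableSpace X]

/-! Write Q_t(h) for the estimator. Given the particles up to time t, those at time t + 1 are i.i.d.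
with law the mixture π of the kernels started at the current particles, whose density is p(z) = ∑
W^j m(x^j, z). The denominator of a backward weight is Ω_t p, so Ω_t β is an importance weight g(u)
m(u, z) / p(z), the `tilt`, which turns π into g(u) M(u, ·). Hence, conditionally on the past,
Q_{t+1}(h) is a U-statistic of order two if the last entry of b is 0 and an empirical mean if it is
1. In both cases its conditional mean is Q_t(h'), where h' = `stepTarget` h is the function for
which the target satisfies μ_{t+1}(h) = μ_t(h'). The error at t + 1 is therefore a centred increment
plus the error at t for another bounded function, and induction on t reduces everything to showing
that the increments vanish in mean square.

Hoeffding's decomposition bounds the conditional variance by second moments of the kernel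
(`integral_sq_uStatistic_sub_le`). Without a lower bound on m the tilts are not uniformly bounded,
but at a particle they are at most N G σ r(z), where r = min(1, 1/(N p)). Bounding one of the two
copies of the kernel in each square in this way, and integrating the other exactly, gives a
conditional variance of at most a constant times Q_t(1) Q_t(`endMean` r)
(`RegularModel.integral_sq_step_le`). If m ≥ ρ > 0, then r ≤ 1/(N ρ) and the increment is O(1/N).

In general, let q(z) be the limit of the unnormalized predictive density q_N(z) of the next
particle. It is positive everywhere and ν-integrable. Split at B = {q ≥ 2ε}. Off B use r ≤ 1: by
induction Q_t(`endMean` 1_{Bᶜ}) converges in mean square to its target value, which tends to 0 with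
ε. On B, which has finite ν-measure, use M(u, ·) ≤ σ ν together with r ≤ G^{t+1}/(ε N) + (q_N -
q)²/ε² (`RegularModel.cappedInv_le`). The mean of (q_N(z) - q(z))² is O(1/N) uniformly in z, by the
standard bound for the forward particle measures
(`RegularModel.exists_lintegral_sq_gammaParticle_le`). Products of random factors are handled by
Young's inequality, so that only second moments of Q_t are ever needed
(`RegularModel.lintegral_increment_le`). -/

lemma integrable_of_abs_le {μ : Measure X} [IsFiniteMeasure μ] {f : X → ℝ} {c : ℝ}
    (hf : Measurable f) (hc : ∀ x, |f x| ≤ c) : Integrable f μ :=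
  Integrable.of_bound hf.aestronglyMeasurable c (Eventually.of_forall hc)

lemma abs_integral_le_of_abs_le {μ : Measure X} [IsProbabilityMeasure μ] {f : X → ℝ} {c : ℝ}
    (hc : ∀ x, |f x| ≤ c) : |∫ x, f x ∂μ| ≤ c := by
  simpa using norm_integral_le_of_norm_le_const (μ := μ) (f := f) (Eventually.of_forall hc)

lemma sq_integral_le_integral_sq {μ : Measure X} [IsProbabilityMeasure μ] {f : X → ℝ} {c : ℝ}
    (hf : Measurable f) (hc : ∀ x, |f x| ≤ c) : (∫ x, f x ∂μ) ^ 2 ≤ ∫ x, f x ^ 2 ∂μ := by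
  have h := variance_nonneg f μ
  rw [variance_eq_sub (MemLp.of_bound hf.aestronglyMeasurable c (Eventually.of_forall hc))] at h
  simpa using h

variable {ι : Type*} [Fintype ι] (μ : Measure X) [IsProbabilityMeasure μ]

/-- Resampling one coordinate independently leaves a product of copies of μ unchanged. This allows
any chosen coordinate to be integrated first. -/
lemma measurePreserving_update [DecidableEq ι] (k : ι) :
    MeasurePreserving (fun p : (ι → X) × X => Function.update p.1 k p.2)
      ((Measure.pi fun _ : ι => μ).prod μ) (Measure.pi fun _ : ι => μ) := by
  have hm : Measurable (fun p : (ι → X) × X => Function.update p.1 k p.2) := by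
    refine measurable_pi_lambda _ fun i => ?_
    by_cases h : i = k
    · subst h; simpa using measurable_snd
    · simp only [Function.update_of_ne h]; fun_prop
  refine ⟨hm, (Measure.pi_eq fun s hs => ?_).symm⟩
  rw [Measure.map_apply hm (MeasurableSet.univ_pi hs)]
  have : (fun p : (ι → X) × X => Function.update p.1 k p.2) ⁻¹' Set.univ.pi s =
      (Set.univ.pi (Function.update s k Set.univ)) ×ˢ s k := by
    ext p
    simp only [Set.mem_preimage, Set.mem_univ_pi, Set.mem_prod]
    constructor
    · intro h
      refine ⟨fun i => ?_, by simpa using h k⟩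
      by_cases hi : i = k
      · subst hi; simp
      · simpa [Function.update_of_ne hi] using h i
    · rintro ⟨h, hk⟩ i
      by_cases hi : i = k
      · subst hi; simpa using hk
      · simpa [Function.update_of_ne hi] using h i
  rw [this, Measure.prod_prod, Measure.pi_pi, ← Finset.mul_prod_erase _ _ (Finset.mem_univ k),
    ← Finset.mul_prod_erase _ (fun i => μ (s i)) (Finset.mem_univ k)]
  simp only [Function.update_self, measure_univ, one_mul]
  rw [mul_comm]
  congr 1
  refine Finset.prod_congr rfl fun i hi => ?_
  rw [Function.update_of_ne (Finset.ne_of_mem_erase hi)]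

lemma integral_pi_eq_zero [DecidableEq ι] {F : (ι → X) → ℝ} (hF : Integrable F (Measure.pi fun _ => μ)) (k : ι)
    (h : ∀ y, ∫ z, F (Function.update y k z) ∂μ = 0) : ∫ y, F y ∂(Measure.pi fun _ => μ) = 0 := by
  have hp := measurePreserving_update μ k
  rw [← hp.map_eq, integral_map hp.measurable.aemeasurable
    (by rw [hp.map_eq]; exact hF.aestronglyMeasurable), integral_prod]
  · simp [h]
  · exact hp.integrable_comp_of_integrable hF

lemma map_eval_pair {k l : ι} (hkl : k ≠ l) :
    (Measure.pi fun _ : ι => μ).map (fun y => (y k, y l)) = μ.prod μ := by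
  have hi : iIndepFun (fun (i : ι) (y : ι → X) => y i) (Measure.pi fun _ : ι => μ) :=
    iIndepFun_pi (X := fun (_ : ι) (x : X) => x) fun _ => aemeasurable_id
  have h := (indepFun_iff_map_prod_eq_prod_map_map (measurable_pi_apply k).aemeasurable
    (measurable_pi_apply l).aemeasurable).1 (hi.indepFun hkl)
  rw [h]
  congr 1
  · exact (measurePreserving_eval (fun _ : ι => μ) k).map_eq
  · exact (measurePreserving_eval (fun _ : ι => μ) l).map_eq

lemma integral_eval_pair {k l : ι} (hkl : k ≠ l) {φ : X × X → ℝ} (hφ : Measurable φ) :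
    ∫ y, φ (y k, y l) ∂(Measure.pi fun _ : ι => μ) = ∫ p, φ p ∂(μ.prod μ) := by
  rw [← map_eval_pair μ hkl, integral_map (by fun_prop) hφ.aestronglyMeasurable]

/-- The mean square error of an empirical mean. -/
lemma integral_sq_empirical_sub_le {φ : X → ℝ} {c : ℝ} (hφ : Measurable φ)
    (hc : ∀ z, |φ z| ≤ c) [Nonempty ι] :
    ∫ y, ((Fintype.card ι : ℝ)⁻¹ * ∑ k, φ (y k) - ∫ z, φ z ∂μ) ^ 2 ∂(Measure.pi fun _ : ι => μ) ≤
      (∫ z, φ z ^ 2 ∂μ) / Fintype.card ι := by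
  have hL : MemLp φ 2 μ := MemLp.of_bound hφ.aestronglyMeasurable c (Eventually.of_forall hc)
  have hv := variance_sum_pi (μ := fun _ : ι => μ) (X := fun _ : ι => φ) (fun _ => hL)
  have hmean : ∫ y, ∑ k, φ (y k) ∂(Measure.pi fun _ : ι => μ) = Fintype.card ι * ∫ z, φ z ∂μ := by
    rw [integral_finsetSum]
    · have : ∀ k, ∫ y, φ (y k) ∂(Measure.pi fun _ : ι => μ) = ∫ z, φ z ∂μ := fun k => by
        rw [integral_comp_eval hφ.aestronglyMeasurable]
      simp [this]
    · exact fun k _ => integrable_of_abs_le (by fun_prop) fun y => hc (y k)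
  have hcard : (0 : ℝ) < Fintype.card ι := by exact_mod_cast Fintype.card_pos
  rw [variance_eq_integral (by fun_prop)] at hv
  have hle : Var[φ; μ] ≤ ∫ z, φ z ^ 2 ∂μ := variance_le_expectation_sq hφ.aestronglyMeasurable
  have e1 : (∑ i : ι, fun y : ι → X => φ (y i)) = fun y => ∑ i, φ (y i) := by ext; simp
  rw [e1, hmean] at hv
  have : ∀ y : ι → X, ((Fintype.card ι : ℝ)⁻¹ * ∑ k, φ (y k) - ∫ z, φ z ∂μ) ^ 2 =
      ((Fintype.card ι : ℝ) ^ 2)⁻¹ * (∑ k, φ (y k) - Fintype.card ι * ∫ z, φ z ∂μ) ^ 2 := fun y => by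
    field_simp
  simp_rw [this]
  rw [integral_const_mul, hv]
  simp only [Finset.sum_const, Finset.card_univ, nsmul_eq_mul]
  calc _ = Var[φ; μ] / Fintype.card ι := by field_simp
    _ ≤ _ := by gcongr

/-- Distinct pairs of samples are orthogonal for degenerate kernels. -/
lemma integral_sq_sum_offDiag_le [DecidableEq ι] {φ : X × X → ℝ} {c : ℝ} (hφ : Measurable φ)
    (hc : ∀ p, |φ p| ≤ c) (h₁ : ∀ z, ∫ z', φ (z, z') ∂μ = 0) (h₂ : ∀ z', ∫ z, φ (z, z') ∂μ = 0) :
    ∫ y, (∑ a ∈ (Finset.univ : Finset ι).offDiag, φ (y a.1, y a.2)) ^ 2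
        ∂(Measure.pi fun _ : ι => μ) ≤
      2 * ((Finset.univ : Finset ι).offDiag.card * ∫ p, φ p ^ 2 ∂(μ.prod μ)) := by
  set s := (Finset.univ : Finset ι).offDiag
  set V := ∫ p, φ p ^ 2 ∂(μ.prod μ)
  have hV0 : 0 ≤ V := integral_nonneg fun p => sq_nonneg _
  have hme : ∀ a : ι × ι, Measurable fun y : ι → X => φ (y a.1, y a.2) := fun a => by fun_prop
  have hint : ∀ a b : ι × ι, Integrable (fun y : ι → X => φ (y a.1, y a.2) * φ (y b.1, y b.2))
      (Measure.pi fun _ : ι => μ) := fun a b =>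
    integrable_of_abs_le (c := c * c) ((hme a).mul (hme b)) fun y => by
      rw [abs_mul]; exact mul_le_mul (hc _) (hc _) (abs_nonneg _) ((abs_nonneg _).trans (hc (y a.1, y a.2)))
  have hsq : ∀ a ∈ s, ∫ y : ι → X, φ (y a.1, y a.2) * φ (y a.1, y a.2)
      ∂(Measure.pi fun _ : ι => μ) = V := fun a ha => by
    simpa [← sq] using integral_eval_pair μ (Finset.mem_offDiag.1 ha).2.2 (hφ.pow_const 2)
  -- An index of a that does not occur in b enters only one of the two factors; integrating it first
  -- gives zero because φ is degenerate in each argument.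
  have horth : ∀ a b : ι × ι, a ∈ s → b ∈ s → (a.1 ≠ b.1 ∧ a.1 ≠ b.2 ∨ a.2 ≠ b.1 ∧ a.2 ≠ b.2) →
      ∫ y : ι → X, φ (y a.1, y a.2) * φ (y b.1, y b.2) ∂(Measure.pi fun _ : ι => μ) = 0 := by
    intro a b ha hb hab
    have hane := (Finset.mem_offDiag.1 ha).2.2
    rcases hab with ⟨h1, h2⟩ | ⟨h1, h2⟩
    · refine integral_pi_eq_zero μ (hint a b) a.1 fun y => ?_
      simp only [Function.update_self, Function.update_of_ne h1.symm, Function.update_of_ne h2.symm,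
        Function.update_of_ne hane.symm]
      rw [integral_mul_const, h₂, zero_mul]
    · refine integral_pi_eq_zero μ (hint a b) a.2 fun y => ?_
      simp only [Function.update_self, Function.update_of_ne h1.symm, Function.update_of_ne h2.symm,
        Function.update_of_ne hane]
      rw [integral_mul_const, h₁, zero_mul]
  -- The only surviving cross terms have the same unordered pair of indices, so b is a or its swap.
  -- This is the origin of the factor 2.
  have hterm : ∀ a ∈ s, ∀ b ∈ s,
      ∫ y : ι → X, φ (y a.1, y a.2) * φ (y b.1, y b.2) ∂(Measure.pi fun _ : ι => μ) ≤
        (if b = a then V else 0) + (if b = a.swap then V else 0) := by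
    intro a ha b hb
    by_cases h : a.1 ≠ b.1 ∧ a.1 ≠ b.2 ∨ a.2 ≠ b.1 ∧ a.2 ≠ b.2
    · rw [horth a b ha hb h]
      split_ifs <;> linarith
    · have hle : ∫ y : ι → X, φ (y a.1, y a.2) * φ (y b.1, y b.2) ∂(Measure.pi fun _ : ι => μ) ≤
          V := by
        have h1 := integral_mono (hint a b) (((hint a a).add (hint b b)).const_mul (1 / 2))
          (fun y => by
            simp only [Pi.add_apply]
            nlinarith [sq_nonneg (φ (y a.1, y a.2) - φ (y b.1, y b.2))])
        refine h1.trans (le_of_eq ?_)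
        rw [integral_const_mul, integral_add' (hint a a) (hint b b), hsq a ha, hsq b hb]
        ring
      have hane := (Finset.mem_offDiag.1 ha).2.2
      have hbne := (Finset.mem_offDiag.1 hb).2.2
      have : b = a ∨ b = a.swap := by
        rw [Prod.ext_iff, Prod.ext_iff]
        simp only [Prod.fst_swap, Prod.snd_swap]
        grind
      rcases this with h | h <;> rw [if_pos h] <;> split_ifs <;> linarith
  simp_rw [sq, Finset.sum_mul_sum]
  rw [integral_finsetSum _ fun a _ => integrable_finsetSum _ fun b _ => hint a b]
  calc ∑ a ∈ s, ∫ y : ι → X, ∑ b ∈ s, φ (y a.1, y a.2) * φ (y b.1, y b.2)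
        ∂(Measure.pi fun _ : ι => μ)
      ≤ ∑ a ∈ s, 2 * V := by
        refine Finset.sum_le_sum fun a ha => ?_
        rw [integral_finsetSum _ fun b _ => hint a b]
        refine (Finset.sum_le_sum fun b hb => hterm a ha b hb).trans ?_
        rw [Finset.sum_add_distrib, Finset.sum_ite_eq', Finset.sum_ite_eq']
        split_ifs <;> linarith
    _ = _ := by rw [Finset.sum_const, nsmul_eq_mul]; ring

end ProductMeasure

/-! ### Variance of U-statistics of order two -/

section UStatistic

variable {X : Type*} [MeasurableSpace X]

lemma sum_offDiag_eq {ι : Type*} [Fintype ι] [DecidableEq ι] (f : ι × ι → ℝ) :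
    ∑ a ∈ (Finset.univ : Finset ι).offDiag, f a = ∑ k, ∑ l, f (k, l) - ∑ k, f (k, k) := by
  have h := Finset.sum_union (f := f) (Finset.disjoint_diag_offDiag (Finset.univ : Finset ι))
  rw [Finset.diag_union_offDiag, Finset.sum_product, Finset.sum_diag] at h
  linarith

variable {ι : Type*} [Fintype ι] [DecidableEq ι] (μ : Measure X) [IsProbabilityMeasure μ]

/-- The mean square error of a U-statistic of order two, by Hoeffding's decomposition. -/
lemma integral_sq_uStatistic_sub_le {Φ : X × X → ℝ} {c : ℝ} (hΦ : Measurable Φ)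
    (hc : ∀ p, |Φ p| ≤ c) (hcard : 2 ≤ Fintype.card ι) :
    ∫ y, (((Fintype.card ι : ℝ) * (Fintype.card ι - 1))⁻¹ *
        ∑ a ∈ (Finset.univ : Finset ι).offDiag, Φ (y a.1, y a.2) - ∫ p, Φ p ∂(μ.prod μ)) ^ 2
        ∂(Measure.pi fun _ : ι => μ) ≤
      51 * ((∫ z, (∫ z', Φ (z, z') ∂μ) ^ 2 ∂μ) / Fintype.card ι +
        (∫ z', (∫ z, Φ (z, z') ∂μ) ^ 2 ∂μ) / Fintype.card ι +
        (∫ p, Φ p ^ 2 ∂(μ.prod μ)) / (Fintype.card ι : ℝ) ^ 2) := by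
  have hn : (2 : ℝ) ≤ Fintype.card ι := by exact_mod_cast hcard
  have : Nonempty ι := Fintype.card_pos_iff.1 (by omega)
  obtain ⟨x₀⟩ : Nonempty X := nonempty_of_isProbabilityMeasure μ
  have hc0 : 0 ≤ c := (abs_nonneg _).trans (hc (x₀, x₀))
  set n : ℝ := (Fintype.card ι : ℝ) with hndef
  set A : X → ℝ := fun z => ∫ z', Φ (z, z') ∂μ with hA
  set B : X → ℝ := fun z' => ∫ z, Φ (z, z') ∂μ with hB
  set θ := ∫ p, Φ p ∂(μ.prod μ) with hθ
  have hAm : Measurable A := (hΦ.stronglyMeasurable.integral_prod_right').measurable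
  have hBm : Measurable B := (hΦ.stronglyMeasurable.integral_prod_left').measurable
  have hAc : ∀ z, |A z| ≤ c := fun z => abs_integral_le_of_abs_le fun _ => hc _
  have hBc : ∀ z, |B z| ≤ c := fun z => abs_integral_le_of_abs_le fun _ => hc _
  have hθc : |θ| ≤ c := abs_integral_le_of_abs_le hc
  have hΦi : Integrable Φ (μ.prod μ) := integrable_of_abs_le hΦ hc
  have hAθ : ∫ z, A z ∂μ = θ := (integral_prod Φ hΦi).symm
  have hBθ : ∫ z, B z ∂μ = θ := (integral_prod_symm Φ hΦi).symm
  -- The completely degenerate part of Φ: both of its one-variable means vanish.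
  set φ : X × X → ℝ := fun p => Φ p - A p.1 - B p.2 + θ with hφ
  have hφm : Measurable φ := by fun_prop
  have hφc : ∀ p, |φ p| ≤ 4 * c := fun p => by
    have h1 := abs_le.1 (hc p); have h2 := abs_le.1 (hAc p.1)
    have h3 := abs_le.1 (hBc p.2); have h4 := abs_le.1 hθc
    simp only [hφ]; rw [abs_le]; constructor <;> linarith
  have iA : Integrable A μ := integrable_of_abs_le hAm hAc
  have iB : Integrable B μ := integrable_of_abs_le hBm hBc
  have h₁ : ∀ z, ∫ z', φ (z, z') ∂μ = 0 := fun z => by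
    have i1 : Integrable (fun z' => Φ (z, z')) μ :=
      integrable_of_abs_le (by fun_prop) fun _ => hc _
    simp only [hφ]
    have j1 : Integrable (fun z' => Φ (z, z') - A z) μ := i1.sub (integrable_const _)
    have j2 : Integrable (fun z' => Φ (z, z') - A z - B z') μ := j1.sub iB
    rw [integral_add j2 (integrable_const _),
      integral_sub j1 iB, integral_sub i1 (integrable_const _), hBθ]
    simp [hA]
  have h₂ : ∀ z', ∫ z, φ (z, z') ∂μ = 0 := fun z' => by
    have i1 : Integrable (fun z => Φ (z, z')) μ :=
      integrable_of_abs_le (by fun_prop) fun _ => hc _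
    simp only [hφ]
    have j1 : Integrable (fun z => Φ (z, z') - A z) μ := i1.sub iA
    have j2 : Integrable (fun z => Φ (z, z') - A z - B z') μ := j1.sub (integrable_const _)
    rw [integral_add j2 (integrable_const _),
      integral_sub j1 (integrable_const _), integral_sub i1 iA, hAθ]
    simp [hB]
  have e1 := integral_sq_empirical_sub_le (ι := ι) μ hAm hAc
  have e2 := integral_sq_empirical_sub_le (ι := ι) μ hBm hBc
  have e3 := integral_sq_sum_offDiag_le (ι := ι) μ hφm hφc h₁ h₂
  rw [← hndef, hAθ] at e1
  rw [← hndef, hBθ] at e2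
  have hod : (((Finset.univ : Finset ι).offDiag.card : ℕ) : ℝ) = n * (n - 1) := by
    rw [Finset.offDiag_card, Nat.cast_sub (Nat.le_mul_self _)]
    simp [hndef]; ring
  rw [hod] at e3
  set V₁ := ∫ z, A z ^ 2 ∂μ with hV₁
  set V₂ := ∫ z, B z ^ 2 ∂μ with hV₂
  set V := ∫ p, Φ p ^ 2 ∂(μ.prod μ) with hV
  have hsqc : ∀ {Y : Type _} {f : Y → ℝ} (y : Y), (|f y| ≤ c) → |f y ^ 2| ≤ c ^ 2 :=
    fun y hy => by rw [abs_pow]; exact pow_le_pow_left₀ (abs_nonneg _) hy 2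
  have iA2 : Integrable (fun z => A z ^ 2) μ :=
    integrable_of_abs_le (by fun_prop) fun z => hsqc z (hAc z)
  have iB2 : Integrable (fun z => B z ^ 2) μ :=
    integrable_of_abs_le (by fun_prop) fun z => hsqc z (hBc z)
  have iΦ2 : Integrable (fun p => Φ p ^ 2) (μ.prod μ) :=
    integrable_of_abs_le (by fun_prop) fun z => hsqc z (hc z)
  have hθV : θ ^ 2 ≤ V₁ := by rw [← hAθ]; exact sq_integral_le_integral_sq hAm hAc
  -- A square of four terms is at most four times the sum of the squares; θ² is absorbed into V₁,
  -- whose coefficient becomes 8.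
  have hφV : ∫ p, φ p ^ 2 ∂(μ.prod μ) ≤ 4 * V + 8 * V₁ + 4 * V₂ := by
    have i1 : Integrable (fun p : X × X => A p.1 ^ 2) (μ.prod μ) := iA2.comp_fst μ
    have i2 : Integrable (fun p : X × X => B p.2 ^ 2) (μ.prod μ) := iB2.comp_snd μ
    have hle : ∫ p, φ p ^ 2 ∂(μ.prod μ) ≤
        ∫ p, (4 * Φ p ^ 2 + 4 * A p.1 ^ 2 + 4 * B p.2 ^ 2 + 4 * θ ^ 2) ∂(μ.prod μ) := by
      refine integral_mono (integrable_of_abs_le (c := (4 * c) ^ 2) (by fun_prop) fun p => ?_)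
        ((((iΦ2.const_mul 4).fun_add (i1.const_mul 4)).fun_add (i2.const_mul 4)).fun_add
          (integrable_const _)) fun p => ?_
      · rw [abs_pow]; exact pow_le_pow_left₀ (abs_nonneg _) (hφc p) 2
      · simp only [hφ]
        nlinarith [sq_nonneg (Φ p + A p.1), sq_nonneg (Φ p + B p.2), sq_nonneg (Φ p - θ),
          sq_nonneg (A p.1 - B p.2), sq_nonneg (A p.1 + θ), sq_nonneg (B p.2 + θ)]
    rw [integral_add (((iΦ2.const_mul 4).fun_add (i1.const_mul 4)).fun_add (i2.const_mul 4))
          (integrable_const _),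
      integral_add ((iΦ2.const_mul 4).fun_add (i1.const_mul 4)) (i2.const_mul 4),
      integral_add (iΦ2.const_mul 4) (i1.const_mul 4), integral_const_mul, integral_const_mul,
      integral_const_mul, integral_fun_fst (fun z => A z ^ 2),
      integral_fun_snd (fun z => B z ^ 2)] at hle
    simp only [probReal_univ, integral_const, smul_eq_mul, one_mul] at hle
    linarith
  -- Each index is the first entry of n - 1 ordered pairs and the second entry of n - 1 others, so
  -- the linear parts reduce to plain empirical means.
  have hdecomp : ∀ y : ι → X, (n * (n - 1))⁻¹ *
      ∑ a ∈ (Finset.univ : Finset ι).offDiag, Φ (y a.1, y a.2) - θ =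
      (n⁻¹ * ∑ k, A (y k) - θ) + (n⁻¹ * ∑ k, B (y k) - θ) +
        (n * (n - 1))⁻¹ * ∑ a ∈ (Finset.univ : Finset ι).offDiag, φ (y a.1, y a.2) := by
    intro y
    have s1 : ∑ a ∈ (Finset.univ : Finset ι).offDiag, φ (y a.1, y a.2) =
        ∑ a ∈ (Finset.univ : Finset ι).offDiag, Φ (y a.1, y a.2) - (n - 1) * ∑ k, A (y k) -
          (n - 1) * ∑ k, B (y k) + n * (n - 1) * θ := by
      simp only [hφ, Finset.sum_add_distrib, Finset.sum_sub_distrib]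
      rw [sum_offDiag_eq (fun a : ι × ι => A (y a.1)), sum_offDiag_eq (fun a : ι × ι => B (y a.2)),
        Finset.sum_const, nsmul_eq_mul, hod]
      simp only [Finset.sum_const, Finset.card_univ, nsmul_eq_mul, ← Finset.mul_sum, ← hndef]
      ring
    rw [s1]
    have : n - 1 ≠ 0 := by linarith
    have : n ≠ 0 := by linarith
    field_simp
    ring
  have hmΦ : ∀ Ψ : X × X → ℝ, Measurable Ψ →
      Measurable fun y : ι → X => ∑ a ∈ (Finset.univ : Finset ι).offDiag, Ψ (y a.1, y a.2) :=
    fun Ψ hΨ => Finset.measurable_sum _ fun a _ => by fun_prop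
  have hsumc : ∀ (s : Finset ι) (f : X → ℝ), (∀ z, |f z| ≤ c) →
      ∀ y : ι → X, |∑ k ∈ s, f (y k)| ≤ s.card * c := fun s f hf y => by
    refine (Finset.abs_sum_le_sum_abs _ _).trans ?_
    simpa using Finset.sum_le_card_nsmul s (fun k => |f (y k)|) c fun k _ => hf _
  have bsq : ∀ {f : (ι → X) → ℝ}, Measurable f → (∃ C, ∀ y, |f y| ≤ C) →
      Integrable (fun y => f y ^ 2) (Measure.pi fun _ : ι => μ) := by
    rintro f hf ⟨C, hC⟩
    refine integrable_of_abs_le (c := C ^ 2) (by fun_prop) fun y => ?_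
    rw [abs_pow]; exact pow_le_pow_left₀ (abs_nonneg _) (hC y) 2
  have bemp : ∀ {f : X → ℝ}, (∀ z, |f z| ≤ c) →
      ∃ C, ∀ y : ι → X, |n⁻¹ * ∑ k, f (y k) - θ| ≤ C := fun {f} hf => by
    refine ⟨n⁻¹ * ((Finset.univ : Finset ι).card * c) + c, fun y => ?_⟩
    refine (abs_sub _ _).trans (add_le_add ?_ hθc)
    rw [abs_mul, abs_of_nonneg (by positivity : 0 ≤ n⁻¹)]
    exact mul_le_mul_of_nonneg_left (hsumc _ f hf y) (by positivity)
  have hn1 : 0 < n * (n - 1) := mul_pos (by linarith) (by linarith)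
  have boff : ∃ C, ∀ y : ι → X, |(n * (n - 1))⁻¹ *
      ∑ a ∈ (Finset.univ : Finset ι).offDiag, φ (y a.1, y a.2)| ≤ C := by
    refine ⟨(n * (n - 1))⁻¹ * ((Finset.univ : Finset ι).offDiag.card * (4 * c)), fun y => ?_⟩
    rw [abs_mul, abs_of_pos (inv_pos.2 hn1)]
    refine mul_le_mul_of_nonneg_left ((Finset.abs_sum_le_sum_abs _ _).trans ?_)
      (inv_pos.2 hn1).le
    simpa using Finset.sum_le_card_nsmul (Finset.univ : Finset ι).offDiag
      (fun a => |φ (y a.1, y a.2)|) (4 * c) fun a _ => hφc _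
  have i1 := bsq (f := fun y => n⁻¹ * ∑ k, A (y k) - θ) (by fun_prop) (bemp hAc)
  have i2 := bsq (f := fun y => n⁻¹ * ∑ k, B (y k) - θ) (by fun_prop) (bemp hBc)
  have i3 := bsq ((hmΦ φ hφm).const_mul (n * (n - 1))⁻¹) boff
  have hmain : ∫ y, ((n * (n - 1))⁻¹ *
      ∑ a ∈ (Finset.univ : Finset ι).offDiag, Φ (y a.1, y a.2) - θ) ^ 2
      ∂(Measure.pi fun _ : ι => μ) ≤ 3 * (V₁ / n) + 3 * (V₂ / n) +
        3 * (((n * (n - 1))⁻¹) ^ 2 * (2 * (n * (n - 1) * ∫ p, φ p ^ 2 ∂(μ.prod μ)))) := by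
    simp_rw [hdecomp]
    refine (integral_mono_of_nonneg (Eventually.of_forall fun y => sq_nonneg _)
      (((i1.const_mul 3).fun_add (i2.const_mul 3)).fun_add (i3.const_mul 3))
      (Eventually.of_forall fun y => ?_)).trans ?_
    · simp only
      generalize n⁻¹ * ∑ k, A (y k) - θ = u
      generalize n⁻¹ * ∑ k, B (y k) - θ = v
      generalize (n * (n - 1))⁻¹ * ∑ a ∈ (Finset.univ : Finset ι).offDiag, φ (y a.1, y a.2) = w
      nlinarith [sq_nonneg (u - v), sq_nonneg (u - w), sq_nonneg (v - w)]
    · rw [integral_add ((i1.const_mul 3).fun_add (i2.const_mul 3)) (i3.const_mul 3),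
        integral_add (i1.const_mul 3) (i2.const_mul 3), integral_const_mul, integral_const_mul,
        integral_const_mul]
      simp_rw [mul_pow]
      rw [integral_const_mul]
      gcongr
  refine hmain.trans ?_
  have hV0 : 0 ≤ V := integral_nonneg fun _ => sq_nonneg _
  have hV10 : 0 ≤ V₁ := integral_nonneg fun _ => sq_nonneg _
  have hV20 : 0 ≤ V₂ := integral_nonneg fun _ => sq_nonneg _
  have ha : ((n * (n - 1))⁻¹) ^ 2 * (2 * (n * (n - 1) * ∫ p, φ p ^ 2 ∂(μ.prod μ))) =
      2 * (n * (n - 1))⁻¹ * ∫ p, φ p ^ 2 ∂(μ.prod μ) := by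
    field_simp
  have hb : (n * (n - 1))⁻¹ ≤ 2 / n ^ 2 := by
    rw [inv_eq_one_div, div_le_div_iff₀ hn1 (by positivity)]
    nlinarith
  have hb' : 2 / n ^ 2 ≤ 1 / n := by
    rw [div_le_div_iff₀ (by positivity) (by positivity)]
    nlinarith
  -- Only V needs the full order 1/n²; for V₁ and V₂ the order 1/n suffices. After the factor 3 of
  -- the three-term split, the coefficients of V₁/n, V₂/n and V/n² are 3 + 48, 3 + 24 and 48, all at
  -- most 51.
  have hc1 : 2 * (n * (n - 1))⁻¹ * ∫ p, φ p ^ 2 ∂(μ.prod μ) ≤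
      16 * (V / n ^ 2) + 16 * (V₁ / n) + 8 * (V₂ / n) := by
    calc 2 * (n * (n - 1))⁻¹ * ∫ p, φ p ^ 2 ∂(μ.prod μ)
        ≤ 2 * (n * (n - 1))⁻¹ * (4 * V + 8 * V₁ + 4 * V₂) := by
          refine mul_le_mul_of_nonneg_left hφV (mul_nonneg zero_le_two (inv_pos.2 hn1).le)
      _ = (n * (n - 1))⁻¹ * (8 * V) + (n * (n - 1))⁻¹ * (16 * V₁ + 8 * V₂) := by ring
      _ ≤ 2 / n ^ 2 * (8 * V) + 1 / n * (16 * V₁ + 8 * V₂) := by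
          refine add_le_add (mul_le_mul_of_nonneg_right hb (by positivity))
            (mul_le_mul_of_nonneg_right (hb.trans hb') (by positivity))
      _ = _ := by ring
  rw [ha]
  have : 0 ≤ V / n ^ 2 := by positivity
  have : 0 ≤ V₁ / n := by positivity
  have : 0 ≤ V₂ / n := by positivity
  linarith

end UStatistic

/-! ### Second moments of kernels reweighted by unbounded tilts -/

section WeightedKernels

variable {X : Type*} [MeasurableSpace X] {μ : Measure X} [IsProbabilityMeasure μ]
  {J : Type*} [Fintype J] {w : J → ℝ} {τ τ' : J → X → ℝ} {r : X → ℝ} {n K c : ℝ}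

lemma sum_mul_abs_le {J : Type*} [Fintype J] {w u v : J → ℝ} (hw : ∀ a, 0 ≤ w a)
    (huv : ∀ a, |u a| ≤ v a) : |∑ a, w a * u a| ≤ ∑ a, w a * v a :=
  (Finset.abs_sum_le_sum_abs _ _).trans <| Finset.sum_le_sum fun a _ => by
    rw [abs_mul, abs_of_nonneg (hw a)]; exact mul_le_mul_of_nonneg_left (huv a) (hw a)

/-- In the square, one copy of the sum is bounded uniformly through τ ≤ n K r and the other is kept.
The result is linear in τ, so later its integral can be computed exactly, and the factor n is the
one cancelled by averaging n samples. -/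
lemma integral_sq_weighted_le {f : J → X → ℝ} {s : J → ℝ} (hw : ∀ a, 0 ≤ w a)
    (hτm : ∀ a, Measurable (τ a)) (hτ0 : ∀ a z, 0 ≤ τ a z) (hn : 0 ≤ n) (hK : 0 ≤ K) (hc : 0 ≤ c)
    (hτ : ∀ a z, τ a z ≤ n * K * r z) (hrm : Measurable r) (hr0 : ∀ z, 0 ≤ r z)
    (hr1 : ∀ z, r z ≤ 1) (hs0 : ∀ a, 0 ≤ s a) (hs : ∀ a, s a ≤ K)
    (hf : ∀ a z, |f a z| ≤ s a * c) :
    ∫ z, (∑ a, w a * (τ a z * f a z)) ^ 2 ∂μ ≤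
      n * (c ^ 2 * K ^ 2 * (∑ a, w a) * ∑ a, w a * (s a * ∫ z, τ a z * r z ∂μ)) := by
  have hD : 0 ≤ ∑ a, w a := Finset.sum_nonneg fun a _ => hw a
  have hτb : ∀ a z, τ a z ≤ n * K := fun a z =>
    (hτ a z).trans (mul_le_of_le_one_right (mul_nonneg hn hK) (hr1 z))
  have hi : ∀ a, Integrable (fun z => τ a z * r z) μ := fun a =>
    integrable_of_abs_le (c := n * K) ((hτm a).mul hrm) fun z => by
      rw [abs_of_nonneg (mul_nonneg (hτ0 a z) (hr0 z))]
      exact (mul_le_of_le_one_right (hτ0 a z) (hr1 z)).trans (hτb a z)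
  have hpt : ∀ z, (∑ a, w a * (τ a z * f a z)) ^ 2 ≤
      n * (c ^ 2 * K ^ 2 * (∑ a, w a) * ∑ a, w a * (s a * (τ a z * r z))) := fun z => by
    have h1 : |∑ a, w a * (τ a z * f a z)| ≤ ∑ a, w a * (τ a z * (s a * c)) :=
      sum_mul_abs_le hw fun a => by
        rw [abs_mul, abs_of_nonneg (hτ0 a z)]
        exact mul_le_mul_of_nonneg_left (hf a z) (hτ0 a z)
    have h2 : ∑ a, w a * (τ a z * (s a * c)) ≤ ∑ a, w a * (n * K * r z * (K * c)) :=
      Finset.sum_le_sum fun a _ => mul_le_mul_of_nonneg_left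
        (mul_le_mul (hτ a z) (mul_le_mul_of_nonneg_right (hs a) hc) (mul_nonneg (hs0 a) hc)
          (by have := hr0 z; positivity)) (hw a)
    have h0 : 0 ≤ ∑ a, w a * (τ a z * (s a * c)) := (abs_nonneg _).trans h1
    calc (∑ a, w a * (τ a z * f a z)) ^ 2 = |∑ a, w a * (τ a z * f a z)| ^ 2 := (sq_abs _).symm
      _ ≤ (∑ a, w a * (τ a z * (s a * c))) ^ 2 := pow_le_pow_left₀ (abs_nonneg _) h1 2
      _ = (∑ a, w a * (τ a z * (s a * c))) * (∑ a, w a * (τ a z * (s a * c))) := sq _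
      _ ≤ (∑ a, w a * (τ a z * (s a * c))) * ∑ a, w a * (n * K * r z * (K * c)) :=
        mul_le_mul_of_nonneg_left h2 h0
      _ = _ := by
        rw [← Finset.sum_mul]
        simp only [Finset.mul_sum, Finset.sum_mul]
        rw [Finset.sum_comm]
        exact Finset.sum_congr rfl fun a _ => Finset.sum_congr rfl fun b _ => by ring
  refine (integral_mono_of_nonneg (Eventually.of_forall fun z => sq_nonneg _)
    (((integrable_finsetSum _ fun a _ => ((hi a).const_mul (s a)).const_mul (w a)).const_mul
      _).const_mul _) (Eventually.of_forall hpt)).trans (le_of_eq ?_)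
  rw [integral_const_mul, integral_const_mul,
    integral_finsetSum _ fun a _ => ((hi a).const_mul (s a)).const_mul (w a)]
  simp_rw [integral_const_mul]

variable {f : J → X × X → ℝ}

/-- Integrating out the second variable turns τ' f into a function bounded by c ∫ τ', so this is
`integral_sq_weighted_le` with s = ∫ τ'. -/
lemma integral_sq_marginal_le (hw : ∀ a, 0 ≤ w a)
    (hτm : ∀ a, Measurable (τ a)) (hτ0 : ∀ a z, 0 ≤ τ a z)
    (hτm' : ∀ a, Measurable (τ' a)) (hτ0' : ∀ a z, 0 ≤ τ' a z) (hn : 0 ≤ n) (hK : 0 ≤ K)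
    (hc : 0 ≤ c) (hτ : ∀ a z, τ a z ≤ n * K * r z) (hτ' : ∀ a z, τ' a z ≤ n * K * r z)
    (hrm : Measurable r) (hr0 : ∀ z, 0 ≤ r z) (hr1 : ∀ z, r z ≤ 1)
    (hτK' : ∀ a, ∫ z, τ' a z ∂μ ≤ K) (hfm : ∀ a, Measurable (f a)) (hf : ∀ a p, |f a p| ≤ c) :
    ∫ z, (∫ z', ∑ a, w a * (τ a z * τ' a z' * f a (z, z')) ∂μ) ^ 2 ∂μ ≤
      n * (c ^ 2 * K ^ 2 * (∑ a, w a) *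
        ∑ a, w a * ((∫ z, τ' a z ∂μ) * ∫ z, τ a z * r z ∂μ)) := by
  have hτb' : ∀ a z, |τ' a z| ≤ n * K := fun a z => by
    rw [abs_of_nonneg (hτ0' a z)]
    exact (hτ' a z).trans (mul_le_of_le_one_right (mul_nonneg hn hK) (hr1 z))
  have hi : ∀ a z, Integrable (fun z' => τ' a z' * f a (z, z')) μ := fun a z =>
    integrable_of_abs_le (c := n * K * c) (by fun_prop) fun z' => by
      rw [abs_mul]
      exact mul_le_mul (hτb' a z') (hf a _) (abs_nonneg _) (mul_nonneg hn hK)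
  have e : ∀ z, ∫ z', ∑ a, w a * (τ a z * τ' a z' * f a (z, z')) ∂μ =
      ∑ a, w a * (τ a z * ∫ z', τ' a z' * f a (z, z') ∂μ) := fun z => by
    simp_rw [mul_assoc (τ _ z)]
    rw [integral_finsetSum _ fun a _ => ((hi a z).const_mul _).const_mul _]
    simp_rw [integral_const_mul]
  simp_rw [e]
  refine integral_sq_weighted_le hw hτm hτ0 hn hK hc hτ hrm hr0 hr1
    (fun a => integral_nonneg (hτ0' a)) hτK' fun a z => ?_
  calc |∫ z', τ' a z' * f a (z, z') ∂μ| ≤ ∫ z', τ' a z' * c ∂μ := by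
        refine (abs_integral_le_integral_abs).trans (integral_mono (hi a z).abs
          ((integrable_of_abs_le (hτm' a) (hτb' a)).mul_const c) fun z' => ?_)
        simp only [abs_mul, abs_of_nonneg (hτ0' a z')]
        exact mul_le_mul_of_nonneg_left (hf a _) (hτ0' a z')
    _ = _ := integral_mul_const _ _

/-- The mean square error of a U-statistic whose kernel is a positive combination of bounded
functions reweighted by `τ` and `τ'`. -/
lemma integral_sq_weighted_uStatistic_sub_le {ι : Type*} [Fintype ι] [DecidableEq ι]
    (hcard : 2 ≤ Fintype.card ι) (hw : ∀ a, 0 ≤ w a)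
    (hτm : ∀ a, Measurable (τ a)) (hτ0 : ∀ a z, 0 ≤ τ a z)
    (hτm' : ∀ a, Measurable (τ' a)) (hτ0' : ∀ a z, 0 ≤ τ' a z) (hK : 0 ≤ K)
    (hc : 0 ≤ c) (hτ : ∀ a z, τ a z ≤ Fintype.card ι * K * r z)
    (hτ' : ∀ a z, τ' a z ≤ Fintype.card ι * K * r z)
    (hrm : Measurable r) (hr0 : ∀ z, 0 ≤ r z) (hr1 : ∀ z, r z ≤ 1)
    (hτK : ∀ a, ∫ z, τ a z ∂μ ≤ K) (hτK' : ∀ a, ∫ z, τ' a z ∂μ ≤ K)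
    (hfm : ∀ a, Measurable (f a)) (hf : ∀ a p, |f a p| ≤ c) :
    ∫ y, (((Fintype.card ι : ℝ) * (Fintype.card ι - 1))⁻¹ *
        ∑ k ∈ (Finset.univ : Finset ι).offDiag,
          ∑ a, w a * (τ a (y k.1) * τ' a (y k.2) * f a (y k.1, y k.2)) -
        ∫ p, ∑ a, w a * (τ a p.1 * τ' a p.2 * f a p) ∂(μ.prod μ)) ^ 2
        ∂(Measure.pi fun _ : ι => μ) ≤
      102 * (c ^ 2 * K ^ 2) * ((∑ a, w a) *
        ∑ a, w a * ((∫ z, τ' a z ∂μ) * ∫ z, τ a z * r z ∂μ +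
          (∫ z, τ a z ∂μ) * ∫ z, τ' a z * r z ∂μ)) := by
  have hn2 : (2 : ℝ) ≤ (Fintype.card ι : ℝ) := by exact_mod_cast hcard
  set n : ℝ := (Fintype.card ι : ℝ)
  have hn : 0 < n := by linarith
  have hD : 0 ≤ ∑ a, w a := Finset.sum_nonneg fun a _ => hw a
  have hτb : ∀ a z, |τ a z| ≤ n * K := fun a z => by
    rw [abs_of_nonneg (hτ0 a z)]
    exact (hτ a z).trans (mul_le_of_le_one_right (mul_nonneg hn.le hK) (hr1 z))
  have hτb' : ∀ a z, |τ' a z| ≤ n * K := fun a z => by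
    rw [abs_of_nonneg (hτ0' a z)]
    exact (hτ' a z).trans (mul_le_of_le_one_right (mul_nonneg hn.le hK) (hr1 z))
  have hnK := mul_nonneg hn.le hK
  set Φ : X × X → ℝ := fun p => ∑ a, w a * (τ a p.1 * τ' a p.2 * f a p) with hΦ
  have hΦm : Measurable Φ := Finset.measurable_sum _ fun a _ => by fun_prop
  have hΦc : ∀ p, |Φ p| ≤ ∑ a, w a * (n * K * (n * K) * c) := fun p =>
    sum_mul_abs_le hw fun a => by
      rw [abs_mul, abs_mul]
      exact mul_le_mul (mul_le_mul (hτb a _) (hτb' a _) (abs_nonneg _) hnK) (hf a p)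
        (abs_nonneg _) (mul_nonneg hnK hnK)
  have hi : ∀ a, Integrable (fun z => τ a z * r z) μ := fun a =>
    integrable_of_abs_le (c := n * K) ((hτm a).mul hrm) fun z => by
      rw [abs_mul, abs_of_nonneg (hr0 z)]
      exact (mul_le_of_le_one_right (abs_nonneg _) (hr1 z)).trans (hτb a z)
  have hi' : ∀ a, Integrable (τ' a) μ := fun a => integrable_of_abs_le (hτm' a) (hτb' a)
  have hU := integral_sq_uStatistic_sub_le (ι := ι) μ hΦm hΦc hcard
  have hV1 := integral_sq_marginal_le (μ := μ) hw hτm hτ0 hτm' hτ0' hn.le hK hc hτ hτ' hrm hr0 hr1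
    hτK' hfm hf
  have hV2 := integral_sq_marginal_le (μ := μ) (f := fun a p => f a p.swap) hw hτm' hτ0' hτm hτ0
    hn.le hK hc hτ' hτ hrm hr0 hr1 hτK (fun a => (hfm a).comp measurable_swap) fun a p => hf a _
  simp only [Prod.swap_prod_mk, mul_comm (τ' _ _) (τ _ _)] at hV2
  -- Here the bounded copy costs n K r in one variable and n K in the other; the loss n² is matched
  -- by the 1/n² in front of this term of Hoeffding's bound.
  have hV12 : ∫ p, Φ p ^ 2 ∂(μ.prod μ) ≤ n ^ 2 * (c ^ 2 * K ^ 2 * (∑ a, w a) *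
        ∑ a, w a * ((∫ z, τ' a z ∂μ) * ∫ z, τ a z * r z ∂μ)) := by
    have hpt : ∀ p, Φ p ^ 2 ≤ n ^ 2 * (c ^ 2 * K ^ 2 * (∑ a, w a) *
        ∑ a, w a * (τ a p.1 * r p.1 * τ' a p.2)) := fun p => by
      have h1 : |Φ p| ≤ ∑ a, w a * (τ a p.1 * τ' a p.2 * c) :=
        sum_mul_abs_le hw fun a => by
          rw [abs_mul, abs_of_nonneg (mul_nonneg (hτ0 a _) (hτ0' a _))]
          exact mul_le_mul_of_nonneg_left (hf a p) (mul_nonneg (hτ0 a _) (hτ0' a _))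
      have h2 : ∑ a, w a * (τ a p.1 * τ' a p.2 * c) ≤
          ∑ a, w a * (n * K * r p.1 * (n * K) * c) :=
        Finset.sum_le_sum fun a _ => mul_le_mul_of_nonneg_left (mul_le_mul_of_nonneg_right
          (mul_le_mul (hτ a _) ((le_abs_self _).trans (hτb' a _)) (hτ0' a _)
            (mul_nonneg hnK (hr0 _))) hc) (hw a)
      have h0 : 0 ≤ ∑ a, w a * (τ a p.1 * τ' a p.2 * c) := (abs_nonneg _).trans h1
      calc Φ p ^ 2 = |Φ p| ^ 2 := (sq_abs _).symm
        _ ≤ (∑ a, w a * (τ a p.1 * τ' a p.2 * c)) ^ 2 := pow_le_pow_left₀ (abs_nonneg _) h1 2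
        _ = (∑ a, w a * (τ a p.1 * τ' a p.2 * c)) * (∑ a, w a * (τ a p.1 * τ' a p.2 * c)) := sq _
        _ ≤ (∑ a, w a * (τ a p.1 * τ' a p.2 * c)) *
              ∑ a, w a * (n * K * r p.1 * (n * K) * c) := mul_le_mul_of_nonneg_left h2 h0
        _ = _ := by
          rw [← Finset.sum_mul]
          simp only [Finset.mul_sum, Finset.sum_mul]
          rw [Finset.sum_comm]
          exact Finset.sum_congr rfl fun a _ => Finset.sum_congr rfl fun b _ => by ring
    have hj : ∀ a, Integrable (fun p : X × X => τ a p.1 * r p.1 * τ' a p.2) (μ.prod μ) :=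
      fun a => (hi a).mul_prod (hi' a)
    refine (integral_mono_of_nonneg (Eventually.of_forall fun z => sq_nonneg _)
      (((integrable_finsetSum _ fun a _ => (hj a).const_mul (w a)).const_mul _).const_mul _)
      (Eventually.of_forall hpt)).trans (le_of_eq ?_)
    rw [integral_const_mul, integral_const_mul,
      integral_finsetSum _ fun a _ => (hj a).const_mul (w a)]
    congr 2
    refine Finset.sum_congr rfl fun a _ => ?_
    rw [integral_const_mul, integral_prod_mul (fun z => τ a z * r z) (τ' a)]
    ring
  refine hU.trans ?_
  simp only [mul_add, Finset.sum_add_distrib]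
  set S₁ := ∑ a, w a * ((∫ z, τ' a z ∂μ) * ∫ z, τ a z * r z ∂μ)
  set S₂ := ∑ a, w a * ((∫ z, τ a z ∂μ) * ∫ z, τ' a z * r z ∂μ) with hS₂
  have hS20 : 0 ≤ S₂ := Finset.sum_nonneg fun a _ => mul_nonneg (hw a) <| mul_nonneg
    (integral_nonneg (hτ0 a)) (integral_nonneg fun z => mul_nonneg (hτ0' a z) (hr0 z))
  have d1 := (div_le_iff₀' hn).2 hV1
  have d2 := (div_le_iff₀' hn).2 hV2
  have d3 := (div_le_iff₀' (by positivity : 0 < n ^ 2)).2 hV12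
  have : 0 ≤ c ^ 2 * K ^ 2 * (∑ a, w a) * S₂ := by positivity
  simp only [hΦ] at d3 ⊢
  -- The three terms contribute S₁, S₂ and S₁, and 51 (2 S₁ + S₂) ≤ 102 (S₁ + S₂).
  nlinarith [d1, d2, d3]

end WeightedKernels

noncomputable section

/-! ### The estimator as a weighted sum over pairs of index paths -/

section EstimatorAlgebra

variable {X : Type*} {N : ℕ}

/-- The weight of a pair of index paths in the backward-sampling estimator. -/
def estWeight (g : ℕ → X → ℝ) (m : ℕ → X → X → ℝ) (t : ℕ) (b : Fin (t + 1) → Fin 2)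
    (x : ℕ → Fin N → X) (k : (Fin (t + 1) → Fin N) × (Fin (t + 1) → Fin N)) : ℝ :=
  (∏ s, if b s = 1 then (N : ℝ) else (N : ℝ) / ((N : ℝ) - 1)) * gammaOne g x t ^ 2 *
    (pathLaw₁ g m x t k.1 * pathLaw₂ g m x t k.1 k.2 * coalescence b k.1 k.2)

/-- The pair of particle paths selected by a pair of index paths. -/
def pathPair {t : ℕ} (x : ℕ → Fin N → X) (k : (Fin (t + 1) → Fin N) × (Fin (t + 1) → Fin N)) :
    (Fin (t + 1) → X) × (Fin (t + 1) → X) :=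
  (fun s => x s (k.1 s), fun s => x s (k.2 s))

/-- Appending a point to each of two paths. -/
def snocPair {t : ℕ} (p : (Fin (t + 1) → X) × (Fin (t + 1) → X)) (q : X × X) :
    (Fin (t + 2) → X) × (Fin (t + 2) → X) :=
  (Fin.snoc (α := fun _ => X) p.1 q.1, Fin.snoc (α := fun _ => X) p.2 q.2)

/-- The density at `z` of the conditional law of a particle at time `t + 1`. -/
def mixtureDensity (g : ℕ → X → ℝ) (m : ℕ → X → X → ℝ) (t : ℕ) (x : ℕ → Fin N → X) (z : X) : ℝ :=
  ∑ j, normWeight g x t j * m (t + 1) (x t j) z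

/-- The potential at `u` times the density of `M (t + 1) u` relative to the mixture. -/
def tilt (g : ℕ → X → ℝ) (m : ℕ → X → X → ℝ) (t : ℕ) (x : ℕ → Fin N → X) (u z : X) : ℝ :=
  g t u * m (t + 1) u z / mixtureDensity g m t x z

variable {g : ℕ → X → ℝ} {m : ℕ → X → X → ℝ} {t : ℕ}

lemma bsEstimator_eq_sum (b : Fin (t + 1) → Fin 2)
    (h : (Fin (t + 1) → X) × (Fin (t + 1) → X) → ℝ) (x : ℕ → Fin N → X) :
    bsEstimator g m t b h x = ∑ k, estWeight g m t b x k * h (pathPair x k) := by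
  rw [bsEstimator, Fintype.sum_prod_type, Finset.mul_sum]
  refine Finset.sum_congr rfl fun k₁ _ => ?_
  rw [Finset.mul_sum]
  refine Finset.sum_congr rfl fun k₂ _ => ?_
  simp only [estWeight, pathPair]
  ring

lemma totalWeight_nonneg (hg : ∀ t x, 0 < g t x) (x : ℕ → Fin N → X) (s : ℕ) :
    0 ≤ totalWeight g x s := Finset.sum_nonneg fun _ _ => (hg s _).le

lemma totalWeight_pos (hg : ∀ t x, 0 < g t x) (hN : 0 < N) (x : ℕ → Fin N → X) (s : ℕ) :
    0 < totalWeight g x s :=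
  Finset.sum_pos (fun _ _ => hg s _) ⟨⟨0, hN⟩, Finset.mem_univ _⟩

lemma totalWeight_le {G : ℝ} (hG : ∀ t x, g t x ≤ G) (x : ℕ → Fin N → X) (s : ℕ) :
    totalWeight g x s ≤ N * G := by
  simpa [totalWeight] using Finset.sum_le_card_nsmul Finset.univ (fun i => g s (x s i)) G
    fun i _ => hG _ _

lemma normWeight_nonneg (hg : ∀ t x, 0 < g t x) (x : ℕ → Fin N → X) (s : ℕ) (i : Fin N) :
    0 ≤ normWeight g x s i := div_nonneg (hg _ _).le (totalWeight_nonneg hg x s)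

lemma sum_normWeight (hg : ∀ t x, 0 < g t x) (hN : 0 < N) (x : ℕ → Fin N → X) (s : ℕ) :
    ∑ i, normWeight g x s i = 1 := by
  simp only [normWeight, ← Finset.sum_div]
  exact div_self (totalWeight_pos hg hN x s).ne'

lemma backwardWeight_nonneg (hg : ∀ t x, 0 < g t x) (hm : ∀ t x x', 0 < m (t + 1) x x')
    (x : ℕ → Fin N → X) (s : ℕ) (k l : Fin N) : 0 ≤ backwardWeight g m x s k l :=
  div_nonneg (mul_nonneg (hg _ _).le (hm _ _ _).le)
    (Finset.sum_nonneg fun _ _ => mul_nonneg (hg _ _).le (hm _ _ _).le)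

lemma gammaOne_nonneg (hg : ∀ t x, 0 < g t x) (x : ℕ → Fin N → X) (t : ℕ) :
    0 ≤ gammaOne g x t :=
  Finset.prod_nonneg fun s _ => div_nonneg (totalWeight_nonneg hg x s) (Nat.cast_nonneg _)

lemma gammaOne_le {G : ℝ} (hG0 : 0 < G) (hg : ∀ t x, 0 < g t x) (hG : ∀ t x, g t x ≤ G)
    (x : ℕ → Fin N → X) (t : ℕ) : gammaOne g x t ≤ G ^ t := by
  have : ∀ s ∈ Finset.range t, totalWeight g x s / N ≤ G := fun s _ => by
    rcases Nat.eq_zero_or_pos N with rfl | hN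
    · simpa using hG0.le
    · rw [div_le_iff₀ (by exact_mod_cast hN), mul_comm]
      exact totalWeight_le hG x s
  simpa [gammaOne] using Finset.prod_le_prod
    (fun s _ => div_nonneg (totalWeight_nonneg hg x s) (Nat.cast_nonneg _)) this

lemma estWeight_nonneg (hg : ∀ t x, 0 < g t x) (hm : ∀ t x x', 0 < m (t + 1) x x') (hN : 0 < N)
    (b : Fin (t + 1) → Fin 2) (x : ℕ → Fin N → X)
    (k : (Fin (t + 1) → Fin N) × (Fin (t + 1) → Fin N)) : 0 ≤ estWeight g m t b x k := by
  have hN1 : (0 : ℝ) ≤ (N : ℝ) - 1 := by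
    have : (1 : ℝ) ≤ N := by exact_mod_cast hN
    linarith
  refine mul_nonneg (mul_nonneg (Finset.prod_nonneg fun s _ => ?_) (sq_nonneg _))
    (mul_nonneg (mul_nonneg ?_ ?_) ?_)
  · split_ifs
    · exact Nat.cast_nonneg _
    · exact div_nonneg (Nat.cast_nonneg _) hN1
  · exact mul_nonneg (by positivity) (Finset.prod_nonneg fun s _ => backwardWeight_nonneg hg hm ..)
  · refine mul_nonneg (by positivity) (Finset.prod_nonneg fun s _ => ?_)
    split_ifs
    · exact normWeight_nonneg hg ..
    · exact backwardWeight_nonneg hg hm ..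
  · exact Finset.prod_nonneg fun s _ => add_nonneg (by split_ifs <;> norm_num)
      (by split_ifs <;> norm_num)

/-- All the factors are products over time, so appending the last pair of indices multiplies the
weight by a factor that depends on the old paths only through their end points. -/
lemma estWeight_succ (b : Fin (t + 2) → Fin 2) (x : ℕ → Fin N → X)
    (k : (Fin (t + 1) → Fin N) × (Fin (t + 1) → Fin N)) (a : Fin N × Fin N) :
    estWeight g m (t + 1) b x (snocPair k a) =
      estWeight g m t (fun s => b s.castSucc) x k *
        ((if b (Fin.last _) = 1 then (N : ℝ) else (N : ℝ) / ((N : ℝ) - 1)) *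
          (totalWeight g x t / N) ^ 2 *
          (backwardWeight g m x t a.1 (k.1 (Fin.last t)) *
            if a.2 = a.1 then normWeight g x t (k.2 (Fin.last t))
            else backwardWeight g m x t a.2 (k.2 (Fin.last t))) *
          ((if a.1 = a.2 ∧ b (Fin.last _) = 1 then 1 else 0) +
            (if a.1 ≠ a.2 ∧ b (Fin.last _) = 0 then 1 else 0))) := by
  simp only [estWeight, snocPair, gammaOne, pathLaw₁, pathLaw₂, coalescence,
    Fin.prod_univ_castSucc, Finset.prod_range_succ, Fin.succ_castSucc, Fin.succ_last,
    Fin.snoc_castSucc, Fin.snoc_last, Fin.val_castSucc, Fin.val_last]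
  ring

lemma sum_snocPair {ι : Type*} [Fintype ι] [DecidableEq ι]
    (F : (Fin (t + 2) → ι) × (Fin (t + 2) → ι) → ℝ) :
    ∑ k, F k = ∑ a : ι × ι, ∑ k : (Fin (t + 1) → ι) × (Fin (t + 1) → ι), F (snocPair k a) := by
  simp only [Fintype.sum_prod_type]
  have e : ∀ f : (Fin (t + 2) → ι) → ℝ, ∑ k, f k =
      ∑ i, ∑ l : Fin (t + 1) → ι, f (Fin.snoc (α := fun _ => ι) l i) := fun f => by
    rw [← Equiv.sum_comp (Fin.snocEquiv fun _ => ι) f, Fintype.sum_prod_type]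
    rfl
  simp only [e]
  refine Finset.sum_congr rfl fun i _ => ?_
  rw [Finset.sum_comm]
  rfl

lemma pathPair_snocPair (x : ℕ → Fin N → X)
    (k : (Fin (t + 1) → Fin N) × (Fin (t + 1) → Fin N)) (a : Fin N × Fin N) :
    pathPair x (snocPair k a) = snocPair (pathPair x k) (x (t + 1) a.1, x (t + 1) a.2) := by
  refine Prod.ext ?_ ?_ <;> funext s <;> refine Fin.lastCases ?_ (fun s => ?_) s <;>
    simp [pathPair, snocPair]

/-- The denominator of the backward weight is Ω_t times the mixture density at the new particle, so
Ω_t cancels and an importance weight remains. -/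
lemma totalWeight_mul_backwardWeight (hg : ∀ t x, 0 < g t x) (hN : 0 < N) (x : ℕ → Fin N → X)
    (k l : Fin N) : totalWeight g x t * backwardWeight g m x t k l =
      tilt g m t x (x t l) (x (t + 1) k) := by
  have h := (totalWeight_pos hg hN x t).ne'
  have e : mixtureDensity g m t x (x (t + 1) k) =
      (∑ j, g t (x t j) * m (t + 1) (x t j) (x (t + 1) k)) / totalWeight g x t := by
    simp only [mixtureDensity, normWeight, Finset.sum_div]
    exact Finset.sum_congr rfl fun j _ => by ring
  rw [tilt, e, backwardWeight, div_div_eq_mul_div]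
  ring

/-- The factor N/(N - 1) and the two factors Ω_t/N combine with the two backward weights into 1/(N
(N - 1)) times two tilts: a U-statistic in the new particles. -/
lemma bsEstimator_succ_of_eq_zero (hg : ∀ t x, 0 < g t x) (hN : 0 < N) {b : Fin (t + 2) → Fin 2}
    (hb : b (Fin.last _) = 0) (h : (Fin (t + 2) → X) × (Fin (t + 2) → X) → ℝ)
    (x : ℕ → Fin N → X) :
    bsEstimator g m (t + 1) b h x = ((N : ℝ) * (N - 1))⁻¹ *
      ∑ a ∈ (Finset.univ : Finset (Fin N)).offDiag,
        ∑ k, estWeight g m t (fun s => b s.castSucc) x k *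
          (tilt g m t x (x t (k.1 (Fin.last t))) (x (t + 1) a.1) *
            tilt g m t x (x t (k.2 (Fin.last t))) (x (t + 1) a.2) *
            h (snocPair (pathPair x k) (x (t + 1) a.1, x (t + 1) a.2))) := by
  have hN0 : (N : ℝ) ≠ 0 := by exact_mod_cast hN.ne'
  have ho : (Finset.univ : Finset (Fin N)).offDiag =
      Finset.univ.filter fun a : Fin N × Fin N => a.1 ≠ a.2 := by ext; simp
  rw [bsEstimator_eq_sum, sum_snocPair, ho, Finset.sum_filter, Finset.mul_sum]
  refine Finset.sum_congr rfl fun a _ => ?_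
  split_ifs with ha
  · rw [Finset.mul_sum]
    refine Finset.sum_congr rfl fun k _ => ?_
    rw [estWeight_succ, pathPair_snocPair, ← totalWeight_mul_backwardWeight hg hN,
      ← totalWeight_mul_backwardWeight hg hN]
    simp only [hb, ha, Ne.symm ha, if_false, Fin.isValue, zero_ne_one, ne_eq,
      not_false_eq_true, and_self, if_true]
    rw [mul_inv, div_eq_mul_inv, div_pow]
    field_simp
    ring
  · rw [mul_zero]
    refine Finset.sum_eq_zero fun k _ => ?_
    rw [estWeight_succ]
    simp [hb, ha]

/-- When the paths meet, the second one picks its ancestor with the normalized weight, and Ω_t W =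
g. Together with the factor N this leaves an empirical mean with a single tilt. -/
lemma bsEstimator_succ_of_eq_one (hg : ∀ t x, 0 < g t x) (hN : 0 < N) {b : Fin (t + 2) → Fin 2}
    (hb : b (Fin.last _) = 1) (h : (Fin (t + 2) → X) × (Fin (t + 2) → X) → ℝ)
    (x : ℕ → Fin N → X) :
    bsEstimator g m (t + 1) b h x = (N : ℝ)⁻¹ *
      ∑ i, ∑ k, estWeight g m t (fun s => b s.castSucc) x k *
          (tilt g m t x (x t (k.1 (Fin.last t))) (x (t + 1) i) *
            (g t (x t (k.2 (Fin.last t))) *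
            h (snocPair (pathPair x k) (x (t + 1) i, x (t + 1) i)))) := by
  have hN0 : (N : ℝ) ≠ 0 := by exact_mod_cast hN.ne'
  have hT := (totalWeight_pos hg hN x t).ne'
  rw [bsEstimator_eq_sum, sum_snocPair, Fintype.sum_prod_type, Finset.mul_sum]
  refine Finset.sum_congr rfl fun i _ => ?_
  rw [Finset.sum_eq_single i]
  · rw [Finset.mul_sum]
    refine Finset.sum_congr rfl fun k _ => ?_
    rw [estWeight_succ, pathPair_snocPair, ← totalWeight_mul_backwardWeight hg hN]
    simp only [hb, if_true, and_self, Fin.isValue, ne_eq, not_true_eq_false, false_and, if_false,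
      add_zero, normWeight]
    field_simp
  · intro j _ hj
    refine Finset.sum_eq_zero fun k _ => ?_
    rw [estWeight_succ]
    simp [hb, hj.symm]
  · simp

end EstimatorAlgebra

/-! ### One step of the particle filter -/

section Step

variable {X : Type*} {N : ℕ}

/-- The array frozen after time `t`. -/
def truncate (t : ℕ) (x : ℕ → Fin N → X) : ℕ → Fin N → X := fun s => x (min s t)

variable {g : ℕ → X → ℝ} {m : ℕ → X → X → ℝ} {t : ℕ}

lemma truncate_of_le {s : ℕ} (hs : s ≤ t) (x : ℕ → Fin N → X) : truncate t x s = x s := by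
  simp [truncate, min_eq_left hs]

lemma totalWeight_truncate {s : ℕ} (hs : s ≤ t) (x : ℕ → Fin N → X) :
    totalWeight g (truncate t x) s = totalWeight g x s := by
  simp [totalWeight, truncate_of_le hs]

lemma normWeight_truncate {s : ℕ} (hs : s ≤ t) (x : ℕ → Fin N → X) (i : Fin N) :
    normWeight g (truncate t x) s i = normWeight g x s i := by
  simp [normWeight, totalWeight_truncate hs, truncate_of_le hs]

lemma backwardWeight_truncate {s : ℕ} (hs : s + 1 ≤ t) (x : ℕ → Fin N → X) (k l : Fin N) :
    backwardWeight g m (truncate t x) s k l = backwardWeight g m x s k l := by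
  simp [backwardWeight, truncate_of_le hs, truncate_of_le (by omega : s ≤ t)]

lemma gammaOne_truncate (x : ℕ → Fin N → X) :
    gammaOne g (truncate t x) t = gammaOne g x t :=
  Finset.prod_congr rfl fun s hs => by rw [totalWeight_truncate (Finset.mem_range.1 hs).le]

lemma gammaOne_succ_truncate (x : ℕ → Fin N → X) :
    gammaOne g (truncate t x) (t + 1) = gammaOne g x (t + 1) :=
  Finset.prod_congr rfl fun s hs => by
    rw [totalWeight_truncate (Nat.lt_succ_iff.1 (Finset.mem_range.1 hs))]

lemma estWeight_truncate (b : Fin (t + 1) → Fin 2) (x : ℕ → Fin N → X)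
    (k : (Fin (t + 1) → Fin N) × (Fin (t + 1) → Fin N)) :
    estWeight g m t b (truncate t x) k = estWeight g m t b x k := by
  have h1 : ∀ (s : Fin t) (k l : Fin N), backwardWeight g m (truncate t x) s k l =
      backwardWeight g m x s k l := fun s k l => backwardWeight_truncate (by omega) x k l
  have h2 : ∀ (s : Fin t) (i : Fin N), normWeight g (truncate t x) s i = normWeight g x s i :=
    fun s i => normWeight_truncate s.2.le x i
  simp only [estWeight, gammaOne_truncate, pathLaw₁, pathLaw₂, h1, h2]

lemma pathPair_truncate (x : ℕ → Fin N → X)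
    (k : (Fin (t + 1) → Fin N) × (Fin (t + 1) → Fin N)) :
    pathPair (truncate t x) k = pathPair x k := by
  have : ∀ s : Fin (t + 1), truncate t x s = x s := fun s => truncate_of_le (by omega) x
  simp [pathPair, this]

lemma bsEstimator_truncate (b : Fin (t + 1) → Fin 2)
    (h : (Fin (t + 1) → X) × (Fin (t + 1) → X) → ℝ) (x : ℕ → Fin N → X) :
    bsEstimator g m t b h (truncate t x) = bsEstimator g m t b h x := by
  simp [bsEstimator_eq_sum, estWeight_truncate, pathPair_truncate]

lemma mixtureDensity_truncate (x : ℕ → Fin N → X) (z : X) :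
    mixtureDensity g m t (truncate t x) z = mixtureDensity g m t x z := by
  simp [mixtureDensity, normWeight_truncate le_rfl, truncate_of_le le_rfl]

lemma tilt_truncate (x : ℕ → Fin N → X) (u z : X) :
    tilt g m t (truncate t x) u z = tilt g m t x u z := by
  simp [tilt, mixtureDensity_truncate]

variable [MeasurableSpace X]

lemma measurable_totalWeight (hg : ∀ t, Measurable (g t)) (s : ℕ) :
    Measurable fun x : ℕ → Fin N → X => totalWeight g x s :=
  Finset.measurable_sum _ fun i _ => (hg s).comp (by fun_prop)

lemma measurable_normWeight (hg : ∀ t, Measurable (g t)) (s : ℕ) (i : Fin N) :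
    Measurable fun x : ℕ → Fin N → X => normWeight g x s i :=
  ((hg s).comp (by fun_prop)).div (measurable_totalWeight hg s)

lemma measurable_gammaOne (hg : ∀ t, Measurable (g t)) (t : ℕ) :
    Measurable fun x : ℕ → Fin N → X => gammaOne g x t :=
  Finset.measurable_prod _ fun s _ => (measurable_totalWeight hg s).div_const _

lemma measurable_backwardWeight (hg : ∀ t, Measurable (g t))
    (hm : ∀ t, Measurable (Function.uncurry (m (t + 1)))) (s : ℕ) (k l : Fin N) :
    Measurable fun x : ℕ → Fin N → X => backwardWeight g m x s k l := by
  have h : ∀ l, Measurable fun x : ℕ → Fin N → X =>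
      g s (x s l) * m (s + 1) (x s l) (x (s + 1) k) := fun l =>
    ((hg s).comp (by fun_prop)).mul
      ((hm s).comp (f := fun x : ℕ → Fin N → X => (x s l, x (s + 1) k)) (by fun_prop))
  exact (h l).div (Finset.measurable_sum _ fun j _ => h j)

lemma measurable_estWeight (hg : ∀ t, Measurable (g t))
    (hm : ∀ t, Measurable (Function.uncurry (m (t + 1)))) (b : Fin (t + 1) → Fin 2)
    (k : (Fin (t + 1) → Fin N) × (Fin (t + 1) → Fin N)) :
    Measurable fun x : ℕ → Fin N → X => estWeight g m t b x k := by
  refine (((measurable_gammaOne hg t).pow_const 2).const_mul _).mul (Measurable.mul_const ?_ _)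
  refine ((Finset.measurable_prod _ fun s _ =>
    measurable_backwardWeight hg hm _ _ _).const_mul _).mul
    ((Finset.measurable_prod _ fun s _ => ?_).const_mul _)
  split_ifs
  · exact measurable_normWeight hg _ _
  · exact measurable_backwardWeight hg hm _ _ _

lemma measurable_pathPair (k : (Fin (t + 1) → Fin N) × (Fin (t + 1) → Fin N)) :
    Measurable fun x : ℕ → Fin N → X => pathPair x k := by
  unfold pathPair; fun_prop

lemma measurable_snocPair : Measurable
    fun q : ((Fin (t + 1) → X) × (Fin (t + 1) → X)) × (X × X) => snocPair q.1 q.2 := by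
  have h : Measurable fun q : (Fin (t + 1) → X) × X =>
      (Fin.snoc (α := fun _ => X) q.1 q.2 : Fin (t + 2) → X) := by
    refine measurable_pi_lambda _ fun s => Fin.lastCases ?_ (fun s => ?_) s
    · simpa using measurable_snd
    · simp only [Fin.snoc_castSucc]; fun_prop
  exact (h.comp (f := fun q : ((Fin (t + 1) → X) × (Fin (t + 1) → X)) × (X × X) =>
    (q.1.1, q.2.1)) (by fun_prop)).prodMk
    (h.comp (f := fun q : ((Fin (t + 1) → X) × (Fin (t + 1) → X)) × (X × X) =>
    (q.1.2, q.2.2)) (by fun_prop))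

lemma measurable_mixtureDensity (hg : ∀ t, Measurable (g t))
    (hm : ∀ t, Measurable (Function.uncurry (m (t + 1)))) (t : ℕ) :
    Measurable fun q : (ℕ → Fin N → X) × X => mixtureDensity g m t q.1 q.2 :=
  Finset.measurable_sum _ fun j _ => ((measurable_normWeight hg t j).comp measurable_fst).mul
    ((hm t).comp (f := fun q : (ℕ → Fin N → X) × X => (q.1 t j, q.2)) (by fun_prop))

lemma measurable_tilt (hg : ∀ t, Measurable (g t))
    (hm : ∀ t, Measurable (Function.uncurry (m (t + 1)))) (t : ℕ) :
    Measurable fun q : (ℕ → Fin N → X) × X × X => tilt g m t q.1 q.2.1 q.2.2 :=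
  (((hg t).comp (by fun_prop)).mul ((hm t).comp
    (f := fun q : (ℕ → Fin N → X) × X × X => (q.2.1, q.2.2)) (by fun_prop))).div
    ((measurable_mixtureDensity hg hm t).comp
      (f := fun q : (ℕ → Fin N → X) × X × X => (q.1, q.2.2)) (by fun_prop))

lemma measurable_bsEstimator (hg : ∀ t, Measurable (g t))
    (hm : ∀ t, Measurable (Function.uncurry (m (t + 1)))) (b : Fin (t + 1) → Fin 2)
    {h : (Fin (t + 1) → X) × (Fin (t + 1) → X) → ℝ} (hh : Measurable h) :
    Measurable fun x : ℕ → Fin N → X => bsEstimator g m t b h x := by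
  simp only [bsEstimator_eq_sum]
  exact Finset.measurable_sum _ fun k _ =>
    (measurable_estWeight hg hm b k).mul (hh.comp (measurable_pathPair k))

lemma measurable_truncate : Measurable (truncate t : (ℕ → Fin N → X) → ℕ → Fin N → X) := by
  unfold truncate; fun_prop

/-- The conditional law of a particle at time `t + 1`. -/
def mixture (M : ℕ → Kernel X X) (g : ℕ → X → ℝ) (t : ℕ) (x : ℕ → Fin N → X) : Measure X :=
  ∑ j, ENNReal.ofReal (normWeight g x t j) • M (t + 1) (x t j)

variable {M : ℕ → Kernel X X}

lemma mixture_apply (x : ℕ → Fin N → X) (B : Set X) :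
    mixture M g t x B = ∑ j, ENNReal.ofReal (normWeight g x t j) * M (t + 1) (x t j) B := by
  simp [mixture]

lemma mixture_truncate (x : ℕ → Fin N → X) : mixture M g t (truncate t x) = mixture M g t x := by
  simp [mixture, normWeight_truncate le_rfl, truncate_of_le le_rfl]

lemma isProbabilityMeasure_mixture [∀ t, IsMarkovKernel (M t)] (hg : ∀ t x, 0 < g t x)
    (hN : 0 < N) (x : ℕ → Fin N → X) : IsProbabilityMeasure (mixture M g t x) := ⟨by
  simp only [mixture_apply, measure_univ, mul_one]
  rw [← ENNReal.ofReal_sum_of_nonneg fun j _ => normWeight_nonneg hg x t j,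
    sum_normWeight hg hN, ENNReal.ofReal_one]⟩

lemma measurable_mixture_apply (hgm : ∀ t, Measurable (g t)) {B : Set X} (hB : MeasurableSet B) :
    Measurable fun x : ℕ → Fin N → X => mixture M g t x B := by
  simp only [mixture_apply]
  exact Finset.measurable_sum _ fun j _ => (measurable_normWeight hgm t j).ennreal_ofReal.mul
    (((M (t + 1)).measurable_coe hB).comp (by fun_prop))

/-- The conditional law of the particles at time `t + 1`. -/
def mixturePi (M : ℕ → Kernel X X) [∀ t, IsMarkovKernel (M t)] (hg : ∀ t x, 0 < g t x)
    (hgm : ∀ t, Measurable (g t)) (hN : 0 < N) (t : ℕ) :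
    Kernel (ℕ → Fin N → X) (Fin N → X) where
  toFun x := Measure.pi fun _ => mixture M g t x
  measurable' := by
    have := fun x : ℕ → Fin N → X => isProbabilityMeasure_mixture (M := M) (t := t) hg hN x
    refine Measurable.measure_of_isPiSystem_of_isProbabilityMeasure generateFrom_pi.symm
      isPiSystem_pi ?_
    rintro _ ⟨B, hB, rfl⟩
    simp only [Measure.pi_pi]
    exact Finset.measurable_prod _ fun i _ => measurable_mixture_apply hgm (hB i (Set.mem_univ i))

variable {Ω : Type*} [MeasurableSpace Ω] {P : Measure Ω} {M₀ : Measure X}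
  {ξ : ℕ → Fin N → Ω → X} {A : ℕ → Fin N → Ω → Fin N}

lemma IsParticleFilter.measurable_array (hPF : IsParticleFilter P M₀ M g ξ A) :
    Measurable fun ω s i => ξ s i ω :=
  measurable_pi_lambda _ fun s => measurable_pi_lambda _ fun i => hPF.measurable_particle s i

omit [MeasurableSpace Ω] in
-- The frozen array reads only particles at times up to t, so its events belong to the history and
-- the one-step law of the filter applies to them.
lemma measurable_truncate_history (t : ℕ) :
    Measurable[history ξ A t] fun ω => truncate t fun s i => ξ s i ω := by
  refine @measurable_pi_lambda _ _ _ (history ξ A t) _ _ fun s =>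
    @measurable_pi_lambda _ _ _ (history ξ A t) _ _ fun i => ?_
  refine Measurable.mono (comap_measurable (ξ (min s t) i)) ?_ le_rfl
  refine le_sup_of_le_left ?_
  exact le_iSup₂_of_le (min s t) (min_le_right s t) (le_iSup
    (fun i => MeasurableSpace.comap (ξ (min s t) i) inferInstance) i)

/-- Summing over the vector of ancestors turns a sum of products into a product of sums: forgetting
the ancestors makes the new particles conditionally i.i.d. from the mixture. -/
lemma IsParticleFilter.measure_inter (hPF : IsParticleFilter P M₀ M g ξ A)
    (hgm : ∀ t, Measurable (g t)) (t : ℕ) {S : Set Ω}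
    (hS : MeasurableSet[history ξ A t] S) (hS' : MeasurableSet S) {B : Fin N → Set X}
    (hB : ∀ i, MeasurableSet (B i)) :
    P (S ∩ {ω | ∀ i, ξ (t + 1) i ω ∈ B i}) =
      ∫⁻ ω in S, ∏ i, mixture M g t (fun s j => ξ s j ω) (B i) ∂P := by
  have hset : S ∩ {ω | ∀ i, ξ (t + 1) i ω ∈ B i} =
      ⋃ a : Fin N → Fin N, S ∩ {ω | ∀ i, A t i ω = a i ∧ ξ (t + 1) i ω ∈ B i} := by
    ext ω
    simp only [Set.mem_inter_iff, Set.mem_ofPred_eq, Set.mem_iUnion]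
    constructor
    · rintro ⟨h1, h2⟩
      exact ⟨fun i => A t i ω, h1, fun i => ⟨rfl, h2 i⟩⟩
    · rintro ⟨a, h1, h2⟩
      exact ⟨h1, fun i => (h2 i).2⟩
  rw [hset, measure_iUnion]
  · rw [tsum_fintype]
    simp_rw [hPF.step t S hS _ B hB, mixture_apply, Finset.prod_univ_sum, Fintype.piFinset_univ]
    rw [lintegral_finsetSum]
    exact fun a _ => Finset.measurable_prod _ fun i _ =>
      ((measurable_normWeight hgm t (a i)).comp hPF.measurable_array).ennreal_ofReal.mul
        (((M (t + 1)).measurable_coe (hB i)).comp (hPF.measurable_particle t (a i)))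
  · intro a a' haa'
    refine Set.disjoint_left.2 fun ω h1 h2 => haa' ?_
    funext i
    rw [← (h1.2 i).1, (h2.2 i).1]
  · intro a
    refine hS'.inter ?_
    have : {ω | ∀ i, A t i ω = a i ∧ ξ (t + 1) i ω ∈ B i} =
        ⋂ i, (A t i ⁻¹' {a i}) ∩ (ξ (t + 1) i ⁻¹' B i) := by ext; simp
    rw [this]
    exact MeasurableSet.iInter fun i =>
      (hPF.measurable_ancestor t i (measurableSet_singleton _)).inter
        (hPF.measurable_particle (t + 1) i (hB i))

/-- Conditionally on the past, the particles at time `t + 1` are independent with law the mixture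
of the kernels `M (t + 1) (x t j)`. -/
theorem IsParticleFilter.lintegral_step [IsProbabilityMeasure P] [∀ t, IsMarkovKernel (M t)]
    (hPF : IsParticleFilter P M₀ M g ξ A)
    (hg : ∀ t x, 0 < g t x) (hgm : ∀ t, Measurable (g t)) (hN : 0 < N) (t : ℕ)
    {F : (ℕ → Fin N → X) → (Fin N → X) → ℝ≥0∞} (hF : Measurable (Function.uncurry F)) :
    ∫⁻ ω, F (truncate t fun s i => ξ s i ω) (fun i => ξ (t + 1) i ω) ∂P =
      ∫⁻ ω, ∫⁻ y, F (truncate t fun s i => ξ s i ω) y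
        ∂(Measure.pi fun _ => mixture M g t fun s i => ξ s i ω) ∂P := by
  set κ := mixturePi M hg hgm hN t
  have hκx : ∀ x, κ x = Measure.pi fun _ => mixture M g t x := fun x => rfl
  have hmk : IsMarkovKernel κ := ⟨fun x => by
    have := isProbabilityMeasure_mixture (M := M) (t := t) hg hN x
    rw [hκx]; infer_instance⟩
  have hT : Measurable fun ω => truncate t fun s i => ξ s i ω :=
    measurable_truncate.comp hPF.measurable_array
  have hY : Measurable fun ω i => ξ (t + 1) i ω :=
    measurable_pi_lambda _ fun i => hPF.measurable_particle (t + 1) i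
  -- The filter is specified on past events times boxes; these form a π-system generating the
  -- product σ-field, so they determine the joint law of the past and the new particles.
  have key : P.map (fun ω => (truncate t fun s i => ξ s i ω, fun i => ξ (t + 1) i ω)) =
      (P.map fun ω => truncate t fun s i => ξ s i ω) ⊗ₘ κ := by
    have : IsProbabilityMeasure (P.map fun ω => truncate t fun s i => ξ s i ω) :=
      Measure.isProbabilityMeasure_map hT.aemeasurable
    have : IsProbabilityMeasure
        (P.map (fun ω => (truncate t fun s i => ξ s i ω, fun i => ξ (t + 1) i ω))) :=
      Measure.isProbabilityMeasure_map (hT.prodMk hY).aemeasurable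
    refine ext_of_generate_finite _ (generateFrom_eq_prod
      (@MeasurableSpace.generateFrom_measurableSet (ℕ → Fin N → X) _)
      (@generateFrom_pi (Fin N) (fun _ => X) _ _) isCountablySpanning_measurableSet
      (IsCountablySpanning.pi fun _ => isCountablySpanning_measurableSet)).symm
      (MeasurableSpace.isPiSystem_measurableSet.prod isPiSystem_pi) ?_ (by simp)
    rintro _ ⟨S, hS, _, ⟨B, hB, rfl⟩, rfl⟩
    replace hS : MeasurableSet S := hS
    have hB' : ∀ i, MeasurableSet (B i) := fun i => hB i (Set.mem_univ i)
    rw [Measure.map_apply (hT.prodMk hY) (hS.prod (MeasurableSet.univ_pi hB')),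
      Measure.compProd_apply_prod hS (MeasurableSet.univ_pi hB'),
      setLIntegral_map hS (κ.measurable_coe (MeasurableSet.univ_pi hB')) hT]
    have h1 := hPF.measure_inter hgm t (S := (fun ω => truncate t fun s i => ξ s i ω) ⁻¹' S)
      (measurable_truncate_history t hS) (hT hS) hB'
    have h2 : (fun ω => (truncate t fun s i => ξ s i ω, fun i => ξ (t + 1) i ω)) ⁻¹'
        S ×ˢ Set.univ.pi B = (fun ω => truncate t fun s i => ξ s i ω) ⁻¹' S ∩
          {ω | ∀ i, ξ (t + 1) i ω ∈ B i} := by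
      ext ω; simp [Set.mem_pi]
    rw [h2, h1]
    refine lintegral_congr fun ω => ?_
    have := isProbabilityMeasure_mixture (M := M) (t := t) hg hN fun s i => ξ s i ω
    rw [hκx, mixture_truncate, Measure.pi_pi]
  have h1 := lintegral_map (μ := P) hF (hT.prodMk hY)
  rw [key, Measure.lintegral_compProd hF] at h1
  rw [lintegral_map (by exact hF.lintegral_kernel_prod_right') hT] at h1
  simp only [Function.uncurry_apply_pair, hκx, mixture_truncate] at h1
  exact h1.symm

end Step

/-! ### The conditional variance of one step of the estimator -/

section ConditionalVariance

variable {X : Type*} [MeasurableSpace X] {N : ℕ}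

/-- Measurable positive potentials bounded by `G`, and kernels with measurable positive densities
bounded by `σ`. -/
structure RegularModel (ν : Measure X) (M : ℕ → Kernel X X) (m : ℕ → X → X → ℝ) (g : ℕ → X → ℝ)
    (G σ : ℝ) : Prop where
  measurable_potential : ∀ t, Measurable (g t)
  potential_pos : ∀ t x, 0 < g t x
  potential_le : ∀ t x, g t x ≤ G
  bound_pos : 0 < G
  measurable_density : ∀ t, Measurable (Function.uncurry (m (t + 1)))
  density_pos : ∀ t x x', 0 < m (t + 1) x x'
  density_le : ∀ t x x', m (t + 1) x x' ≤ σ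
  one_le : 1 ≤ σ
  kernel_eq : ∀ t x, M (t + 1) x = ν.withDensity fun y => ENNReal.ofReal (m (t + 1) x y)

/-- The inverse of `N` times the mixture density, capped at `1`. -/
def cappedInv (g : ℕ → X → ℝ) (m : ℕ → X → X → ℝ) (t : ℕ) (x : ℕ → Fin N → X) (z : X) : ℝ :=
  min 1 (N * mixtureDensity g m t x z)⁻¹

/-- The one-step conditional mean of a function of two paths, weighted by the potentials. -/
def stepTarget (M : ℕ → Kernel X X) (g : ℕ → X → ℝ) (t : ℕ) (b : Fin 2)
    (h : (Fin (t + 2) → X) × (Fin (t + 2) → X) → ℝ)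
    (p : (Fin (t + 1) → X) × (Fin (t + 1) → X)) : ℝ :=
  g t (p.1 (Fin.last t)) * g t (p.2 (Fin.last t)) *
    ∫ q, h (snocPair p q) ∂(biKernel (M (t + 1)) b (p.1 (Fin.last t), p.2 (Fin.last t)))

/-- The potentials at the ends of two paths, times the sum of the conditional means of `r`. -/
def endMean (M : ℕ → Kernel X X) (g : ℕ → X → ℝ) (t : ℕ) (r : X → ℝ)
    (p : (Fin (t + 1) → X) × (Fin (t + 1) → X)) : ℝ :=
  g t (p.1 (Fin.last t)) * g t (p.2 (Fin.last t)) *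
    (∫ z, r z ∂(M (t + 1) (p.1 (Fin.last t))) + ∫ z, r z ∂(M (t + 1) (p.2 (Fin.last t))))

variable {ν : Measure X} {M : ℕ → Kernel X X} {m : ℕ → X → X → ℝ} {g : ℕ → X → ℝ} {G σ : ℝ}
  {t : ℕ}

lemma RegularModel.measurable_density_right (H : RegularModel ν M m g G σ) (t : ℕ) (u : X) :
    Measurable fun z => m (t + 1) u z :=
  (H.measurable_density t).comp (f := fun z => (u, z)) (by fun_prop)

lemma RegularModel.sigma_pos (H : RegularModel ν M m g G σ) : 0 < σ :=
  zero_lt_one.trans_le H.one_le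

lemma RegularModel.potential_le_mul (H : RegularModel ν M m g G σ) (t : ℕ) (u : X) :
    g t u ≤ G * σ :=
  (H.potential_le t u).trans (le_mul_of_one_le_right H.bound_pos.le H.one_le)

lemma RegularModel.measurable_mixtureDensity_right (H : RegularModel ν M m g G σ) (t : ℕ)
    (x : ℕ → Fin N → X) : Measurable (mixtureDensity g m t x) :=
  (measurable_mixtureDensity H.measurable_potential H.measurable_density t).comp
    measurable_prodMk_left

lemma RegularModel.mixtureDensity_pos (H : RegularModel ν M m g G σ) (hN : 0 < N)
    (x : ℕ → Fin N → X) (z : X) : 0 < mixtureDensity g m t x z :=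
  Finset.sum_pos (fun _ _ => mul_pos (div_pos (H.potential_pos _ _)
    (totalWeight_pos H.potential_pos hN x t)) (H.density_pos _ _ _)) ⟨⟨0, hN⟩, Finset.mem_univ _⟩

lemma RegularModel.mixture_eq (H : RegularModel ν M m g G σ) (x : ℕ → Fin N → X) :
    mixture M g t x = ν.withDensity fun z => ENNReal.ofReal (mixtureDensity g m t x z) := by
  ext B hB
  rw [mixture_apply, withDensity_apply _ hB]
  have e : ∀ z, ENNReal.ofReal (mixtureDensity g m t x z) =
      ∑ j, ENNReal.ofReal (normWeight g x t j) * ENNReal.ofReal (m (t + 1) (x t j) z) := fun z => by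
    rw [mixtureDensity, ENNReal.ofReal_sum_of_nonneg fun j _ =>
      mul_nonneg (normWeight_nonneg H.potential_pos x t j) (H.density_pos _ _ _).le]
    exact Finset.sum_congr rfl fun j _ =>
      ENNReal.ofReal_mul (normWeight_nonneg H.potential_pos x t j)
  have hm : ∀ j, Measurable fun z => ENNReal.ofReal (m (t + 1) (x t j) z) := fun j =>
    (H.measurable_density_right t _).ennreal_ofReal
  simp_rw [e]
  rw [lintegral_finsetSum _ fun j _ => (hm j).const_mul _]
  refine Finset.sum_congr rfl fun j _ => ?_
  rw [lintegral_const_mul _ (hm j), H.kernel_eq, withDensity_apply _ hB]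

lemma RegularModel.integral_kernel (H : RegularModel ν M m g G σ) (u : X) (f : X → ℝ) :
    ∫ z, f z ∂(M (t + 1) u) = ∫ z, m (t + 1) u z * f z ∂ν := by
  rw [H.kernel_eq, integral_withDensity_eq_integral_toReal_smul
    (H.measurable_density_right t u).ennreal_ofReal (by simp)]
  simp [ENNReal.toReal_ofReal (H.density_pos _ _ _).le]

/-- Change of measure: the mixture density in the denominator of the tilt cancels the density of the
mixture with respect to ν. -/
lemma RegularModel.integral_tilt_mul (H : RegularModel ν M m g G σ) (hN : 0 < N)
    (x : ℕ → Fin N → X) (u : X) (f : X → ℝ) :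
    ∫ z, tilt g m t x u z * f z ∂(mixture M g t x) = g t u * ∫ z, f z ∂(M (t + 1) u) := by
  rw [H.mixture_eq, integral_withDensity_eq_integral_toReal_smul
    (H.measurable_mixtureDensity_right t x).ennreal_ofReal (by simp), H.integral_kernel,
    ← integral_const_mul]
  refine integral_congr_ae (Eventually.of_forall fun z => ?_)
  have hp := H.mixtureDensity_pos (t := t) hN x z
  simp only [ENNReal.toReal_ofReal hp.le, smul_eq_mul, tilt]
  field_simp

lemma RegularModel.integral_tilt [∀ t, IsMarkovKernel (M t)] (H : RegularModel ν M m g G σ)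
    (hN : 0 < N) (x : ℕ → Fin N → X) (u : X) :
    ∫ z, tilt g m t x u z ∂(mixture M g t x) = g t u := by
  simpa using H.integral_tilt_mul (t := t) hN x u fun _ => 1

lemma RegularModel.tilt_nonneg (H : RegularModel ν M m g G σ) (hN : 0 < N) (x : ℕ → Fin N → X)
    (u z : X) : 0 ≤ tilt g m t x u z :=
  div_nonneg (mul_nonneg (H.potential_pos _ _).le (H.density_pos _ _ _).le)
    (H.mixtureDensity_pos hN x z).le

lemma RegularModel.cappedInv_nonneg (H : RegularModel ν M m g G σ) (hN : 0 < N)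
    (x : ℕ → Fin N → X) (z : X) : 0 ≤ cappedInv g m t x z :=
  le_min zero_le_one (inv_nonneg.2
    (mul_nonneg (Nat.cast_nonneg _) (H.mixtureDensity_pos hN x z).le))

omit [MeasurableSpace X] in
lemma cappedInv_le_one (x : ℕ → Fin N → X) (z : X) : cappedInv g m t x z ≤ 1 := min_le_left _ _

lemma RegularModel.measurable_cappedInv (H : RegularModel ν M m g G σ) (t : ℕ) :
    Measurable fun q : (ℕ → Fin N → X) × X => cappedInv g m t q.1 q.2 :=
  measurable_const.min
    ((measurable_mixtureDensity H.measurable_potential H.measurable_density t).const_mul _).inv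

/-- Two bounds are combined. Since u is one of the particles, its own term in the mixture density
gives tilt ≤ Ω_t ≤ N G; bounding the numerator instead gives tilt ≤ G σ / p. With 1 ≤ σ, both fit
under N G σ times the capped inverse. -/
lemma RegularModel.tilt_le (H : RegularModel ν M m g G σ) (hN : 0 < N) (x : ℕ → Fin N → X)
    (i : Fin N) (z : X) : tilt g m t x (x t i) z ≤ N * (G * σ) * cappedInv g m t x z := by
  have hp := H.mixtureDensity_pos (t := t) hN x z
  have hN' : (0 : ℝ) < N := by exact_mod_cast hN
  have hΩ := totalWeight_pos H.potential_pos hN x t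
  have hg := H.potential_pos t (x t i)
  have hm := H.density_pos t (x t i) z
  have hG := H.bound_pos
  have hσ := H.sigma_pos
  rw [cappedInv, mul_min_of_nonneg _ _ (by positivity)]
  refine le_min ?_ ?_
  · have hge : normWeight g x t i * m (t + 1) (x t i) z ≤ mixtureDensity g m t x z :=
      Finset.single_le_sum (f := fun j => normWeight g x t j * m (t + 1) (x t j) z)
        (fun j _ => mul_nonneg (normWeight_nonneg H.potential_pos x t j) (H.density_pos _ _ _).le)
        (Finset.mem_univ i)
    have h1 : g t (x t i) * m (t + 1) (x t i) z =
        totalWeight g x t * (normWeight g x t i * m (t + 1) (x t i) z) := by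
      rw [normWeight]; field_simp
    rw [tilt, div_le_iff₀ hp, h1, mul_one]
    refine mul_le_mul ?_ hge (mul_nonneg (normWeight_nonneg H.potential_pos x t i) hm.le)
      (by positivity)
    exact (totalWeight_le H.potential_le x t).trans
      (mul_le_mul_of_nonneg_left (le_mul_of_one_le_right hG.le H.one_le) hN'.le)
  · have : N * (G * σ) * (N * mixtureDensity g m t x z)⁻¹ =
        G * σ / mixtureDensity g m t x z := by
      field_simp
    rw [this, tilt]
    gcongr
    · exact H.potential_le _ _
    · exact H.density_le _ _ _

omit [MeasurableSpace X] in
lemma truncate_update (x : ℕ → Fin N → X) (y : Fin N → X) :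
    truncate t (Function.update x (t + 1) y) = truncate t x := by
  funext s
  rw [truncate, truncate, Function.update_of_ne (by omega)]

omit [MeasurableSpace X] in
lemma estWeight_update (b : Fin (t + 1) → Fin 2) (x : ℕ → Fin N → X) (y : Fin N → X)
    (k : (Fin (t + 1) → Fin N) × (Fin (t + 1) → Fin N)) :
    estWeight g m t b (Function.update x (t + 1) y) k = estWeight g m t b x k := by
  rw [← estWeight_truncate, truncate_update, estWeight_truncate]

omit [MeasurableSpace X] in
lemma pathPair_update (x : ℕ → Fin N → X) (y : Fin N → X)
    (k : (Fin (t + 1) → Fin N) × (Fin (t + 1) → Fin N)) :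
    pathPair (Function.update x (t + 1) y) k = pathPair x k := by
  rw [← pathPair_truncate, truncate_update, pathPair_truncate]

omit [MeasurableSpace X] in
lemma tilt_update (x : ℕ → Fin N → X) (y : Fin N → X) (u z : X) :
    tilt g m t (Function.update x (t + 1) y) u z = tilt g m t x u z := by
  rw [← tilt_truncate, truncate_update, tilt_truncate]

omit [MeasurableSpace X] in
-- The estimator at time t + 1 depends only on the frozen past and the new row, which is the form in
-- which the one-step law can be applied to it.
lemma bsEstimator_update_truncate (b : Fin (t + 2) → Fin 2)
    (h : (Fin (t + 2) → X) × (Fin (t + 2) → X) → ℝ) (x : ℕ → Fin N → X) :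
    bsEstimator g m (t + 1) b h (Function.update (truncate t x) (t + 1) (x (t + 1))) =
      bsEstimator g m (t + 1) b h x := by
  rw [← bsEstimator_truncate (t := t + 1), ← bsEstimator_truncate (t := t + 1) b h x]
  congr 1
  funext s
  by_cases hs : s ≤ t
  · rw [truncate_of_le (by omega), truncate_of_le (by omega), Function.update_of_ne (by omega),
      truncate_of_le hs]
  · have : min s (t + 1) = t + 1 := by omega
    simp [truncate, this]

lemma biKernel_zero (K : Kernel X X) [IsSFiniteKernel K] (p : X × X) :
    biKernel K 0 p = (K p.1).prod (K p.2) := by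
  simp [biKernel, Kernel.parallelComp_apply]

lemma integral_biKernel_one (K : Kernel X X) (p : X × X) {f : X × X → ℝ} (hf : Measurable f) :
    ∫ q, f q ∂(biKernel K 1 p) = ∫ z, f (z, z) ∂(K p.1) := by
  have hd : Measurable fun z : X => (z, z) := by fun_prop
  simp only [biKernel, Fin.isValue, one_ne_zero, if_false]
  rw [Kernel.map_apply _ hd, integral_map hd.aemeasurable hf.aestronglyMeasurable,
    Kernel.comap_apply]

lemma RegularModel.integral_tilt_mul_tilt [∀ t, IsMarkovKernel (M t)]
    (H : RegularModel ν M m g G σ) (hN : 0 < N) (x : ℕ → Fin N → X) (i j : Fin N)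
    {f : X × X → ℝ} {c : ℝ} (hf : Measurable f) (hc : ∀ q, |f q| ≤ c) :
    ∫ q, tilt g m t x (x t i) q.1 * tilt g m t x (x t j) q.2 * f q
        ∂((mixture M g t x).prod (mixture M g t x)) =
      g t (x t i) * g t (x t j) *
        ∫ q, f q ∂((M (t + 1) (x t i)).prod (M (t + 1) (x t j))) := by
  have := isProbabilityMeasure_mixture (M := M) (t := t) H.potential_pos hN x
  have hτm : ∀ u, Measurable (tilt g m t x u) := fun u =>
    (measurable_tilt H.measurable_potential H.measurable_density t).comp
      (f := fun z => (x, u, z)) (by fun_prop)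
  have hG := H.bound_pos
  have hσ := H.sigma_pos
  have hτ : ∀ i z, |tilt g m t x (x t i) z| ≤ N * (G * σ) := fun i z => by
    rw [abs_of_nonneg (H.tilt_nonneg hN x _ z)]
    exact (H.tilt_le hN x i z).trans (mul_le_of_le_one_right (by positivity)
      (cappedInv_le_one x z))
  have hc0 : 0 ≤ c := (abs_nonneg _).trans (hc (x t i, x t i))
  have hi : Integrable (fun q : X × X => tilt g m t x (x t i) q.1 * tilt g m t x (x t j) q.2 * f q)
      ((mixture M g t x).prod (mixture M g t x)) := by
    refine integrable_of_abs_le (c := N * (G * σ) * (N * (G * σ)) * c) (Measurable.mul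
      (Measurable.mul ((hτm _).comp measurable_fst) ((hτm _).comp measurable_snd)) hf) fun q => ?_
    rw [abs_mul, abs_mul]
    exact mul_le_mul (mul_le_mul (hτ _ _) (hτ _ _) (abs_nonneg _) (by positivity)) (hc q)
      (abs_nonneg _) (by positivity)
  rw [integral_prod _ hi, integral_prod _ (integrable_of_abs_le hf hc)]
  have e : ∀ z, ∫ z', tilt g m t x (x t i) z * tilt g m t x (x t j) z' * f (z, z')
      ∂(mixture M g t x) = g t (x t j) *
        (tilt g m t x (x t i) z * ∫ z', f (z, z') ∂(M (t + 1) (x t j))) := fun z => by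
    simp only [mul_assoc]
    rw [integral_const_mul, H.integral_tilt_mul hN x (x t j) fun z' => f (z, z')]
    ring
  simp only [e]
  rw [integral_const_mul, H.integral_tilt_mul hN]
  ring

/-- Given the particles up to time `t`, the mean of the estimator at time `t + 1` is the estimator
at time `t` of `stepTarget`, with an explicit bound on the variance. -/
theorem RegularModel.integral_sq_step_le [∀ t, IsMarkovKernel (M t)]
    (H : RegularModel ν M m g G σ) (hN : 2 ≤ N) (b : Fin (t + 2) → Fin 2)
    {h : (Fin (t + 2) → X) × (Fin (t + 2) → X) → ℝ} {c : ℝ} (hh : Measurable h)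
    (hc : ∀ p, |h p| ≤ c) (x : ℕ → Fin N → X) :
    ∫ y, (bsEstimator g m (t + 1) b h (Function.update x (t + 1) y) -
        bsEstimator g m t (fun s => b s.castSucc) (stepTarget M g t (b (Fin.last _)) h) x) ^ 2
        ∂(Measure.pi fun _ => mixture M g t x) ≤
      102 * (c ^ 2 * (G * σ) ^ 2) *
        (bsEstimator g m t (fun s => b s.castSucc) (fun _ => 1) x *
          bsEstimator g m t (fun s => b s.castSucc) (endMean M g t (cappedInv g m t x)) x) := by
  have hN0 : 0 < N := by omega
  have hN' : (0 : ℝ) < N := by exact_mod_cast hN0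
  have := isProbabilityMeasure_mixture (M := M) (t := t) H.potential_pos hN0 x
  have hG := H.bound_pos
  have hσ := H.sigma_pos
  -- Some pair of paths is needed to evaluate the bound on h; any particle supplies one.
  have hc0 : 0 ≤ c := (abs_nonneg _).trans
    (hc (pathPair x (fun _ => ⟨0, hN0⟩, fun _ => ⟨0, hN0⟩)))
  set w := estWeight g m t (fun s => b s.castSucc) x with hwdef
  have hw : ∀ k, 0 ≤ w k := estWeight_nonneg H.potential_pos H.density_pos hN0 _ x
  set r := cappedInv g m t x with hr
  have hrm : Measurable r := (H.measurable_cappedInv t).comp measurable_prodMk_left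
  have hr0 : ∀ z, 0 ≤ r z := H.cappedInv_nonneg hN0 x
  have hr1 : ∀ z, r z ≤ 1 := cappedInv_le_one x
  have hτm : ∀ u, Measurable (tilt g m t x u) := fun u =>
    (measurable_tilt H.measurable_potential H.measurable_density t).comp
      (f := fun z => (x, u, z)) (by fun_prop)
  have hτ0 : ∀ u z, 0 ≤ tilt g m t x u z := H.tilt_nonneg hN0 x
  have hτ := H.tilt_le (t := t) hN0 x
  have hfm : ∀ k : (Fin (t + 1) → Fin N) × (Fin (t + 1) → Fin N),
      Measurable fun q => h (snocPair (pathPair x k) q) := fun k =>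
    hh.comp (measurable_snocPair.comp measurable_prodMk_left)
  have hend : bsEstimator g m t (fun s => b s.castSucc) (endMean M g t r) x = ∑ k, w k *
      (g t (x t (k.2 (Fin.last t))) * (g t (x t (k.1 (Fin.last t))) *
          ∫ z, r z ∂(M (t + 1) (x t (k.1 (Fin.last t))))) +
        g t (x t (k.1 (Fin.last t))) * (g t (x t (k.2 (Fin.last t))) *
          ∫ z, r z ∂(M (t + 1) (x t (k.2 (Fin.last t)))))) := by
    rw [bsEstimator_eq_sum]
    refine Finset.sum_congr rfl fun k _ => ?_
    simp only [endMean, pathPair, Fin.val_last]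
    ring
  have hone : bsEstimator g m t (fun s => b s.castSucc) (fun _ => 1) x = ∑ k, w k := by
    simp [bsEstimator_eq_sum, hwdef]
  rw [hone, hend]
  obtain hb | hb : b (Fin.last _) = 0 ∨ b (Fin.last _) = 1 := by omega
  -- Each tilt turns the mixture into g(u) M(u, ·), so the mean of the U-statistic kernel is the
  -- estimator at time t of the one-step conditional mean.
  · have hmean : bsEstimator g m t (fun s => b s.castSucc) (stepTarget M g t (b (Fin.last _)) h) x =
        ∫ q, ∑ k, w k * (tilt g m t x (x t (k.1 (Fin.last t))) q.1 *
          tilt g m t x (x t (k.2 (Fin.last t))) q.2 * h (snocPair (pathPair x k) q))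
          ∂((mixture M g t x).prod (mixture M g t x)) := by
      have hτb : ∀ i z, |tilt g m t x (x t i) z| ≤ N * (G * σ) := fun i z => by
        rw [abs_of_nonneg (hτ0 _ z)]
        exact (hτ i z).trans (mul_le_of_le_one_right (by positivity) (hr1 z))
      rw [integral_finsetSum]
      · rw [bsEstimator_eq_sum]
        refine Finset.sum_congr rfl fun k _ => ?_
        rw [integral_const_mul, H.integral_tilt_mul_tilt hN0 x _ _ (hfm k) fun q => hc _]
        simp only [stepTarget, pathPair, Fin.val_last, hb, biKernel_zero, hwdef]
      · refine fun k _ => Integrable.const_mul (integrable_of_abs_le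
          (c := N * (G * σ) * (N * (G * σ)) * c) (Measurable.mul (Measurable.mul
            ((hτm _).comp measurable_fst) ((hτm _).comp measurable_snd)) (hfm k)) fun q => ?_) _
        simp only [Pi.mul_apply, Function.comp_apply, abs_mul]
        exact mul_le_mul (mul_le_mul (hτb _ _) (hτb _ _) (abs_nonneg _) (by positivity)) (hc _)
          (abs_nonneg _) (by positivity)
    have key := integral_sq_weighted_uStatistic_sub_le (ι := Fin N) (μ := mixture M g t x)
      (J := (Fin (t + 1) → Fin N) × (Fin (t + 1) → Fin N)) (w := w)
      (τ := fun k => tilt g m t x (x t (k.1 (Fin.last t))))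
      (τ' := fun k => tilt g m t x (x t (k.2 (Fin.last t)))) (r := r) (K := G * σ) (c := c)
      (f := fun k q => h (snocPair (pathPair x k) q)) (by simpa using hN) hw
      (fun k => hτm _) (fun k => hτ0 _) (fun k => hτm _) (fun k => hτ0 _) (by positivity) hc0
      (fun k z => by simpa using hτ _ z) (fun k z => by simpa using hτ _ z) hrm hr0 hr1
      (fun k => by rw [H.integral_tilt hN0]; exact H.potential_le_mul t _)
      (fun k => by rw [H.integral_tilt hN0]; exact H.potential_le_mul t _) hfm (fun k q => hc _)
    simp only [H.integral_tilt hN0, H.integral_tilt_mul hN0, Fintype.card_fin] at key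
    simp only [bsEstimator_succ_of_eq_zero H.potential_pos hN0 hb, hmean, estWeight_update,
      pathPair_update, tilt_update, Function.update_self,
      Function.update_of_ne (Nat.succ_ne_self t).symm]
    exact key
  · set φ : X → ℝ := fun z => ∑ k, w k * (tilt g m t x (x t (k.1 (Fin.last t))) z *
      (g t (x t (k.2 (Fin.last t))) * h (snocPair (pathPair x k) (z, z)))) with hφ
    have hφm : ∀ k : (Fin (t + 1) → Fin N) × (Fin (t + 1) → Fin N),
        Measurable fun z => tilt g m t x (x t (k.1 (Fin.last t))) z *
          (g t (x t (k.2 (Fin.last t))) * h (snocPair (pathPair x k) (z, z))) := fun k =>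
      (hτm _).mul (((hfm k).comp (f := fun z => (z, z)) (by fun_prop)).const_mul _)
    have hφb : ∀ (k : (Fin (t + 1) → Fin N) × (Fin (t + 1) → Fin N)) z,
        |tilt g m t x (x t (k.1 (Fin.last t))) z *
          (g t (x t (k.2 (Fin.last t))) * h (snocPair (pathPair x k) (z, z)))| ≤
        N * (G * σ) * (G * c) := fun k z => by
      rw [abs_mul, abs_mul, abs_of_nonneg (hτ0 _ z), abs_of_pos (H.potential_pos _ _)]
      exact mul_le_mul ((hτ _ z).trans (mul_le_of_le_one_right (by positivity) (hr1 z)))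
        (mul_le_mul (H.potential_le _ _) (hc _) (abs_nonneg _) hG.le)
        (mul_nonneg (H.potential_pos _ _).le (abs_nonneg _)) (by positivity)
    have hmean : bsEstimator g m t (fun s => b s.castSucc) (stepTarget M g t (b (Fin.last _)) h) x =
        ∫ z, φ z ∂(mixture M g t x) := by
      simp only [hφ]
      rw [integral_finsetSum _ fun k _ =>
        (integrable_of_abs_le (hφm k) (hφb k)).const_mul (w k), bsEstimator_eq_sum]
      refine Finset.sum_congr rfl fun k _ => ?_
      rw [integral_const_mul, H.integral_tilt_mul hN0, integral_const_mul]
      simp only [stepTarget, pathPair, Fin.val_last, hb, hwdef]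
      have e := integral_biKernel_one (M (t + 1))
        (x t (k.1 (Fin.last t)), x t (k.2 (Fin.last t))) (hfm k)
      simp only [pathPair] at e
      rw [e]
      ring
    have : Nonempty (Fin N) := ⟨⟨0, hN0⟩⟩
    have key := integral_sq_empirical_sub_le (ι := Fin N) (mixture M g t x)
      (φ := φ) (c := ∑ k, w k * (N * (G * σ) * (G * c)))
      (Finset.measurable_sum _ fun k _ => (hφm k).const_mul (w k))
      (fun z => sum_mul_abs_le hw fun k => hφb k z)
    -- When the paths coalesce only the first one carries a tilt; the potential of the second plays
    -- the role of the mass s.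
    have key2 := integral_sq_weighted_le (μ := mixture M g t x)
      (J := (Fin (t + 1) → Fin N) × (Fin (t + 1) → Fin N)) (w := w)
      (τ := fun k => tilt g m t x (x t (k.1 (Fin.last t)))) (r := r) (K := G * σ) (c := c)
      (n := N) (f := fun k z => g t (x t (k.2 (Fin.last t))) * h (snocPair (pathPair x k) (z, z)))
      (s := fun k => g t (x t (k.2 (Fin.last t)))) hw
      (fun k => hτm _) (fun k => hτ0 _) hN'.le (by positivity) hc0
      (fun k z => hτ _ z) hrm hr0 hr1 (fun k => (H.potential_pos _ _).le)
      (fun k => H.potential_le_mul t _) (fun k z => by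
        rw [abs_mul, abs_of_pos (H.potential_pos _ _)]
        exact mul_le_mul_of_nonneg_left (hc _) (H.potential_pos _ _).le)
    simp only [H.integral_tilt_mul hN0] at key2
    simp only [bsEstimator_succ_of_eq_one H.potential_pos hN0 hb, hmean, estWeight_update,
      pathPair_update, tilt_update, Function.update_self,
      Function.update_of_ne (Nat.succ_ne_self t).symm]
    rw [Fintype.card_fin] at key
    refine key.trans (((div_le_iff₀' hN').2 key2).trans ?_)
    simp only [mul_add, Finset.sum_add_distrib]
    have hD : 0 ≤ ∑ k, w k := Finset.sum_nonneg fun k _ => hw k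
    have hS1 : 0 ≤ ∑ k, w k * (g t (x t (k.2 (Fin.last t))) * (g t (x t (k.1 (Fin.last t))) *
          ∫ z, r z ∂(M (t + 1) (x t (k.1 (Fin.last t)))))) := Finset.sum_nonneg fun k _ =>
      mul_nonneg (hw k) (mul_nonneg (H.potential_pos _ _).le (mul_nonneg (H.potential_pos _ _).le
        (integral_nonneg hr0)))
    have hS2 : 0 ≤ ∑ k, w k * (g t (x t (k.1 (Fin.last t))) * (g t (x t (k.2 (Fin.last t))) *
          ∫ z, r z ∂(M (t + 1) (x t (k.2 (Fin.last t)))))) := Finset.sum_nonneg fun k _ =>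
      mul_nonneg (hw k) (mul_nonneg (H.potential_pos _ _).le (mul_nonneg (H.potential_pos _ _).le
        (integral_nonneg hr0)))
    -- This case produces only the first of the two sums, with constant 1; nonnegativity allows it
    -- to be enlarged to the bound shared with the other case.
    have q1 := mul_nonneg (mul_nonneg (by positivity : 0 ≤ c ^ 2 * (G * σ) ^ 2) hD) hS1
    have q2 := mul_nonneg (mul_nonneg (by positivity : 0 ≤ c ^ 2 * (G * σ) ^ 2) hD) hS2
    nlinarith [q1, q2]

end ConditionalVariance

/-! ### Elementary bounds on the estimator, and its one-step mean square increment -/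

section EstimatorStep

variable {X : Type*} {N : ℕ} {m : ℕ → X → X → ℝ} {g : ℕ → X → ℝ} {G : ℝ} {t : ℕ}

lemma normWeight_le_one (hg : ∀ t x, 0 < g t x) (x : ℕ → Fin N → X) (s : ℕ) (i : Fin N) :
    normWeight g x s i ≤ 1 :=
  div_le_one_of_le₀ (Finset.single_le_sum (f := fun i => g s (x s i)) (fun _ _ => (hg _ _).le)
    (Finset.mem_univ i)) (totalWeight_nonneg hg x s)

lemma backwardWeight_le_one (hg : ∀ t x, 0 < g t x) (hm : ∀ t x x', 0 < m (t + 1) x x')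
    (x : ℕ → Fin N → X) (s : ℕ) (k l : Fin N) : backwardWeight g m x s k l ≤ 1 :=
  div_le_one_of_le₀ (Finset.single_le_sum
    (f := fun j => g s (x s j) * m (s + 1) (x s j) (x (s + 1) k))
    (fun _ _ => mul_nonneg (hg _ _).le (hm _ _ _).le) (Finset.mem_univ l))
    (Finset.sum_nonneg fun _ _ => mul_nonneg (hg _ _).le (hm _ _ _).le)

/-- A crude bound that may grow with N. It serves only to make integrands bounded for fixed N. -/
lemma estWeight_le (hG0 : 0 < G) (hg : ∀ t x, 0 < g t x) (hG : ∀ t x, g t x ≤ G)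
    (hm : ∀ t x x', 0 < m (t + 1) x x') (hN : 0 < N) (b : Fin (t + 1) → Fin 2) (x : ℕ → Fin N → X)
    (k : (Fin (t + 1) → Fin N) × (Fin (t + 1) → Fin N)) :
    estWeight g m t b x k ≤
      (∏ s, if b s = 1 then (N : ℝ) else (N : ℝ) / ((N : ℝ) - 1)) * (G ^ t) ^ 2 := by
  have hN1 : (1 : ℝ) ≤ N := by exact_mod_cast hN
  have hinv : (N : ℝ)⁻¹ ≤ 1 := inv_le_one_of_one_le₀ hN1
  have hinv0 : (0 : ℝ) ≤ (N : ℝ)⁻¹ := by positivity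
  have hβ := backwardWeight_nonneg (N := N) hg hm x
  have hβ1 := backwardWeight_le_one (N := N) hg hm x
  have hW := normWeight_nonneg (N := N) hg x
  have hW1 := normWeight_le_one (N := N) hg x
  have h1 : 0 ≤ pathLaw₁ g m x t k.1 := mul_nonneg hinv0 (Finset.prod_nonneg fun s _ => hβ _ _ _)
  have h1' : pathLaw₁ g m x t k.1 ≤ 1 := mul_le_one₀ hinv (Finset.prod_nonneg fun s _ => hβ _ _ _)
    (Finset.prod_le_one (fun s _ => hβ _ _ _) fun s _ => hβ1 _ _ _)
  have h2 : 0 ≤ pathLaw₂ g m x t k.1 k.2 := mul_nonneg hinv0 (Finset.prod_nonneg fun s _ => by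
    split_ifs
    exacts [hW _ _, hβ _ _ _])
  have h2' : pathLaw₂ g m x t k.1 k.2 ≤ 1 := mul_le_one₀ hinv (Finset.prod_nonneg fun s _ => by
    split_ifs
    exacts [hW _ _, hβ _ _ _]) (Finset.prod_le_one (fun s _ => by
      split_ifs
      exacts [hW _ _, hβ _ _ _]) fun s _ => by
      split_ifs
      exacts [hW1 _ _, hβ1 _ _ _])
  have h3 : 0 ≤ coalescence b k.1 k.2 := Finset.prod_nonneg fun s _ =>
    add_nonneg (by split_ifs <;> norm_num) (by split_ifs <;> norm_num)
  have h3' : coalescence b k.1 k.2 ≤ 1 := Finset.prod_le_one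
    (fun s _ => add_nonneg (by split_ifs <;> norm_num) (by split_ifs <;> norm_num)) fun s _ => by
      by_cases h : k.1 s = k.2 s <;> by_cases hb : b s = 1 <;> simp [h, hb] <;> split_ifs <;>
        norm_num
  have hF : 0 ≤ ∏ s, if b s = 1 then (N : ℝ) else (N : ℝ) / ((N : ℝ) - 1) :=
    Finset.prod_nonneg fun s _ => by
      split_ifs
      exacts [by positivity, div_nonneg (by positivity) (by linarith)]
  have hγ := pow_le_pow_left₀ (gammaOne_nonneg hg x t) (gammaOne_le hG0 hg hG x t) 2
  exact (mul_le_of_le_one_right (mul_nonneg hF (sq_nonneg _))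
    (mul_le_one₀ (mul_le_one₀ h1' h2 h2') h3 h3')).trans (mul_le_mul_of_nonneg_left hγ hF)

lemma exists_abs_bsEstimator_le (hG0 : 0 < G) (hg : ∀ t x, 0 < g t x) (hG : ∀ t x, g t x ≤ G)
    (hm : ∀ t x x', 0 < m (t + 1) x x') (hN : 0 < N) (b : Fin (t + 1) → Fin 2)
    {h : (Fin (t + 1) → X) × (Fin (t + 1) → X) → ℝ} {c : ℝ} (hc : ∀ p, |h p| ≤ c) :
    ∃ C, ∀ x : ℕ → Fin N → X, |bsEstimator g m t b h x| ≤ C := by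
  refine ⟨∑ _k : (Fin (t + 1) → Fin N) × (Fin (t + 1) → Fin N),
    ((∏ s, if b s = 1 then (N : ℝ) else (N : ℝ) / ((N : ℝ) - 1)) * (G ^ t) ^ 2) * c, fun x => ?_⟩
  rw [bsEstimator_eq_sum]
  refine (sum_mul_abs_le (estWeight_nonneg hg hm hN b x) fun k => hc _).trans
    (Finset.sum_le_sum fun k _ => mul_le_mul_of_nonneg_right (estWeight_le hG0 hg hG hm hN b x k)
      ((abs_nonneg _).trans (hc (pathPair x k))))

lemma bsEstimator_mono (hg : ∀ t x, 0 < g t x) (hm : ∀ t x x', 0 < m (t + 1) x x') (hN : 0 < N)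
    (b : Fin (t + 1) → Fin 2) {h h' : (Fin (t + 1) → X) × (Fin (t + 1) → X) → ℝ}
    (hle : ∀ p, h p ≤ h' p) (x : ℕ → Fin N → X) :
    bsEstimator g m t b h x ≤ bsEstimator g m t b h' x := by
  rw [bsEstimator_eq_sum, bsEstimator_eq_sum]
  exact Finset.sum_le_sum fun k _ =>
    mul_le_mul_of_nonneg_left (hle _) (estWeight_nonneg hg hm hN b x k)

lemma bsEstimator_nonneg (hg : ∀ t x, 0 < g t x) (hm : ∀ t x x', 0 < m (t + 1) x x') (hN : 0 < N)
    (b : Fin (t + 1) → Fin 2) {h : (Fin (t + 1) → X) × (Fin (t + 1) → X) → ℝ}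
    (hh : ∀ p, 0 ≤ h p) (x : ℕ → Fin N → X) : 0 ≤ bsEstimator g m t b h x := by
  rw [bsEstimator_eq_sum]
  exact Finset.sum_nonneg fun k _ => mul_nonneg (estWeight_nonneg hg hm hN b x k) (hh _)

lemma bsEstimator_const_mul (b : Fin (t + 1) → Fin 2)
    (h : (Fin (t + 1) → X) × (Fin (t + 1) → X) → ℝ) (c : ℝ) (x : ℕ → Fin N → X) :
    bsEstimator g m t b (fun p => c * h p) x = c * bsEstimator g m t b h x := by
  simp only [bsEstimator_eq_sum, Finset.mul_sum, mul_left_comm]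

lemma bsEstimator_add (b : Fin (t + 1) → Fin 2)
    (h h' : (Fin (t + 1) → X) × (Fin (t + 1) → X) → ℝ) (x : ℕ → Fin N → X) :
    bsEstimator g m t b (fun p => h p + h' p) x =
      bsEstimator g m t b h x + bsEstimator g m t b h' x := by
  simp only [bsEstimator_eq_sum, mul_add, Finset.sum_add_distrib]

variable [MeasurableSpace X] {ν M₀ : Measure X} {M : ℕ → Kernel X X} {σ : ℝ}

instance (K : Kernel X X) [IsMarkovKernel K] (b : Fin 2) : IsMarkovKernel (biKernel K b) := by
  unfold biKernel
  split_ifs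
  · infer_instance
  · exact Kernel.IsMarkovKernel.map _ (by fun_prop)

lemma RegularModel.measurable_stepTarget [∀ t, IsMarkovKernel (M t)]
    (H : RegularModel ν M m g G σ) (b : Fin 2)
    {h : (Fin (t + 2) → X) × (Fin (t + 2) → X) → ℝ} (hh : Measurable h) :
    Measurable (stepTarget M g t b h) := by
  have hgm := H.measurable_potential t
  let κ := (biKernel (M (t + 1)) b).comap
    (fun p : (Fin (t + 1) → X) × (Fin (t + 1) → X) => (p.1 (Fin.last t), p.2 (Fin.last t)))
    (by fun_prop)
  have hi : Measurable fun p : (Fin (t + 1) → X) × (Fin (t + 1) → X) =>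
      ∫ q, h (snocPair p q) ∂(κ p) :=
    (StronglyMeasurable.integral_kernel_prod_right (κ := κ)
      (f := fun p q => h (snocPair p q))
      (hh.comp measurable_snocPair).stronglyMeasurable).measurable
  exact Measurable.mul (by fun_prop) hi

lemma RegularModel.abs_stepTarget_le [∀ t, IsMarkovKernel (M t)]
    (H : RegularModel ν M m g G σ) (b : Fin 2)
    {h : (Fin (t + 2) → X) × (Fin (t + 2) → X) → ℝ} {c : ℝ} (hc : ∀ p, |h p| ≤ c)
    (p : (Fin (t + 1) → X) × (Fin (t + 1) → X)) :
    |stepTarget M g t b h p| ≤ G ^ 2 * c := by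
  have hG := H.bound_pos
  have h1 := H.potential_pos t (p.1 (Fin.last t))
  have h2 := H.potential_pos t (p.2 (Fin.last t))
  rw [stepTarget, abs_mul, abs_of_pos (mul_pos h1 h2), sq]
  exact mul_le_mul (mul_le_mul (H.potential_le _ _) (H.potential_le _ _) h2.le hG.le)
    (abs_integral_le_of_abs_le fun q => hc _) (abs_nonneg _) (by positivity)

lemma RegularModel.measurable_endMean [∀ t, IsMarkovKernel (M t)]
    (H : RegularModel ν M m g G σ) {r : X → ℝ} (hr : Measurable r) :
    Measurable (endMean M g t r) := by
  have hgm := H.measurable_potential t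
  have hi : Measurable fun u => ∫ z, r z ∂(M (t + 1) u) :=
    (hr.stronglyMeasurable.integral_kernel (κ := M (t + 1))).measurable
  exact Measurable.mul (by fun_prop) ((hi.comp (f := fun p : (Fin (t + 1) → X) × (Fin (t + 1) → X) =>
    p.1 (Fin.last t)) (by fun_prop)).add (hi.comp (f := fun p : (Fin (t + 1) → X) ×
      (Fin (t + 1) → X) => p.2 (Fin.last t)) (by fun_prop)))

lemma RegularModel.endMean_nonneg (H : RegularModel ν M m g G σ) {r : X → ℝ} (hr : ∀ z, 0 ≤ r z)
    (p : (Fin (t + 1) → X) × (Fin (t + 1) → X)) : 0 ≤ endMean M g t r p :=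
  mul_nonneg (mul_nonneg (H.potential_pos _ _).le (H.potential_pos _ _).le)
    (add_nonneg (integral_nonneg hr) (integral_nonneg hr))

lemma RegularModel.endMean_le [∀ t, IsMarkovKernel (M t)] (H : RegularModel ν M m g G σ)
    {r : X → ℝ} {c : ℝ} (hr : ∀ z, 0 ≤ r z) (hc : ∀ z, r z ≤ c)
    (p : (Fin (t + 1) → X) × (Fin (t + 1) → X)) : endMean M g t r p ≤ G ^ 2 * (2 * c) := by
  have hG := H.bound_pos
  have hi : ∀ u, ∫ z, r z ∂(M (t + 1) u) ≤ c := fun u => (le_abs_self _).trans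
    (abs_integral_le_of_abs_le fun z => by rw [abs_of_nonneg (hr z)]; exact hc z)
  rw [endMean, sq]
  refine mul_le_mul (mul_le_mul (H.potential_le _ _) (H.potential_le _ _)
    (H.potential_pos _ _).le hG.le) ?_ (add_nonneg (integral_nonneg hr) (integral_nonneg hr))
    (by positivity)
  linarith [hi (p.1 (Fin.last t)), hi (p.2 (Fin.last t))]

variable {Ω : Type*} [MeasurableSpace Ω] {P : Measure Ω} [IsProbabilityMeasure P]
  {ξ : ℕ → Fin N → Ω → X} {A : ℕ → Fin N → Ω → Fin N}

lemma measurable_update_next (t : ℕ) : Measurable fun q : (ℕ → Fin N → X) × (Fin N → X) =>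
    Function.update q.1 (t + 1) q.2 := by
  refine measurable_pi_lambda _ fun s => ?_
  by_cases h : s = t + 1
  · subst h; simpa using measurable_snd
  · simp only [Function.update_of_ne h]; fun_prop

omit [MeasurableSpace X] in
lemma cappedInv_truncate (x : ℕ → Fin N → X) :
    cappedInv g m t (truncate t x) = cappedInv g m t x := by
  funext z; simp [cappedInv, mixtureDensity_truncate]

/-- The mean square of one martingale increment of the estimator. -/
theorem IsParticleFilter.lintegral_sq_step_le [∀ t, IsMarkovKernel (M t)]
    (hPF : IsParticleFilter P M₀ M g ξ A) (H : RegularModel ν M m g G σ) (hN : 2 ≤ N)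
    (b : Fin (t + 2) → Fin 2) {h : (Fin (t + 2) → X) × (Fin (t + 2) → X) → ℝ} {c : ℝ}
    (hh : Measurable h) (hc : ∀ p, |h p| ≤ c) :
    ∫⁻ ω, ENNReal.ofReal ((bsEstimator g m (t + 1) b h (fun s i => ξ s i ω) -
        bsEstimator g m t (fun s => b s.castSucc) (stepTarget M g t (b (Fin.last _)) h)
          (fun s i => ξ s i ω)) ^ 2) ∂P ≤
      ENNReal.ofReal (102 * (c ^ 2 * (G * σ) ^ 2)) *
        ∫⁻ ω, ENNReal.ofReal (bsEstimator g m t (fun s => b s.castSucc) (fun _ => 1)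
            (fun s i => ξ s i ω) *
          bsEstimator g m t (fun s => b s.castSucc)
            (endMean M g t (cappedInv g m t fun s i => ξ s i ω)) (fun s i => ξ s i ω)) ∂P := by
  have hN0 : 0 < N := by omega
  have hgm := H.measurable_potential
  have hmm := H.measurable_density
  set b' : Fin (t + 1) → Fin 2 := fun s => b s.castSucc
  set h' := stepTarget M g t (b (Fin.last _)) h
  have hh' : Measurable h' := H.measurable_stepTarget _ hh
  set F : (ℕ → Fin N → X) → (Fin N → X) → ℝ := fun x y =>
    bsEstimator g m (t + 1) b h (Function.update x (t + 1) y) - bsEstimator g m t b' h' x with hF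
  have hFm : Measurable (Function.uncurry F) :=
    ((measurable_bsEstimator hgm hmm b hh).comp (measurable_update_next t)).sub
      ((measurable_bsEstimator hgm hmm b' hh').comp measurable_fst)
  -- The increment becomes a function of the frozen past and the new row, as
  -- `IsParticleFilter.lintegral_step` requires.
  have e : ∀ ω, bsEstimator g m (t + 1) b h (fun s i => ξ s i ω) -
      bsEstimator g m t b' h' (fun s i => ξ s i ω) =
      F (truncate t fun s i => ξ s i ω) (fun i => ξ (t + 1) i ω) := fun ω => by
    simp only [hF]
    rw [bsEstimator_truncate]
    congr 1
    exact (bsEstimator_update_truncate b h fun s i => ξ s i ω).symm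
  simp only [e]
  rw [hPF.lintegral_step H.potential_pos hgm hN0 t (F := fun x y => ENNReal.ofReal (F x y ^ 2))
    (hFm.pow_const 2).ennreal_ofReal]
  have hfin : ENNReal.ofReal (102 * (c ^ 2 * (G * σ) ^ 2)) ≠ ∞ := ENNReal.ofReal_ne_top
  rw [← lintegral_const_mul' _ _ hfin]
  refine lintegral_mono fun ω => ?_
  obtain ⟨C₁, hC₁⟩ := exists_abs_bsEstimator_le (t := t + 1) H.bound_pos H.potential_pos
    H.potential_le H.density_pos hN0 b hc
  obtain ⟨C₂, hC₂⟩ := exists_abs_bsEstimator_le (t := t) H.bound_pos H.potential_pos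
    H.potential_le H.density_pos hN0 b' (h := h') (H.abs_stepTarget_le _ hc)
  have := isProbabilityMeasure_mixture (M := M) (t := t) H.potential_pos hN0 fun s i => ξ s i ω
  rw [← ENNReal.ofReal_mul (by positivity), ← ofReal_integral_eq_lintegral_ofReal]
  · refine ENNReal.ofReal_le_ofReal ?_
    have key := H.integral_sq_step_le hN b hh hc (truncate t fun s i => ξ s i ω)
    rwa [mixture_truncate, bsEstimator_truncate _ (fun _ => (1 : ℝ)), cappedInv_truncate,
      bsEstimator_truncate _ (endMean M g t _)] at key
  · refine integrable_of_abs_le (c := (C₁ + C₂) ^ 2)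
      ((hFm.comp measurable_prodMk_left).pow_const 2) fun y => ?_
    rw [abs_pow]
    exact pow_le_pow_left₀ (abs_nonneg _) ((abs_sub _ _).trans (add_le_add (hC₁ _) (hC₂ _))) 2
  · exact Eventually.of_forall fun y => sq_nonneg _

end EstimatorStep

/-! ### Convergence of the unnormalized particle measures -/

section ForwardMeasure

variable {X : Type*} [MeasurableSpace X] {N : ℕ}

/-- The unnormalized prediction measure at time `t`. -/
def forwardMeasure (M₀ : Measure X) (M : ℕ → Kernel X X) (g : ℕ → X → ℝ) : ℕ → Measure X
  | 0 => M₀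
  | t + 1 => ((forwardMeasure M₀ M g t).withDensity fun x => ENNReal.ofReal (g t x)).bind
      (M (t + 1))

/-- The unnormalized particle approximation of `forwardMeasure`. -/
def gammaParticle (g : ℕ → X → ℝ) (t : ℕ) (f : X → ℝ) (x : ℕ → Fin N → X) : ℝ :=
  gammaOne g x t * ((N : ℝ)⁻¹ * ∑ i, f (x t i))

variable {ν M₀ : Measure X} {M : ℕ → Kernel X X} {m : ℕ → X → X → ℝ} {g : ℕ → X → ℝ} {G σ : ℝ}
  {t : ℕ}

lemma RegularModel.isFiniteMeasure_withDensity (H : RegularModel ν M m g G σ) (μ : Measure X)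
    [IsFiniteMeasure μ] : IsFiniteMeasure (μ.withDensity fun x => ENNReal.ofReal (g t x)) :=
  MeasureTheory.isFiniteMeasure_withDensity
    (((lintegral_mono fun x => ENNReal.ofReal_le_ofReal (H.potential_le t x)).trans_lt
      (by simpa using ENNReal.mul_lt_top ENNReal.ofReal_lt_top (measure_lt_top μ _))).ne)

lemma RegularModel.isFiniteMeasure_forwardMeasure [IsFiniteMeasure M₀]
    [∀ t, IsMarkovKernel (M t)] (H : RegularModel ν M m g G σ) (t : ℕ) :
    IsFiniteMeasure (forwardMeasure M₀ M g t) := by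
  induction t with
  | zero => assumption
  | succ t ih =>
    have := H.isFiniteMeasure_withDensity (t := t) (forwardMeasure M₀ M g t)
    rw [forwardMeasure]
    infer_instance

lemma RegularModel.integral_withDensity_potential (H : RegularModel ν M m g G σ) (μ : Measure X)
    (f : X → ℝ) : ∫ x, f x ∂(μ.withDensity fun x => ENNReal.ofReal (g t x)) =
      ∫ x, g t x * f x ∂μ := by
  rw [integral_withDensity_eq_integral_toReal_smul
    (H.measurable_potential t).ennreal_ofReal (by simp)]
  simp [ENNReal.toReal_ofReal (H.potential_pos _ _).le]

lemma RegularModel.integral_forwardMeasure_succ [IsFiniteMeasure M₀]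
    [∀ t, IsMarkovKernel (M t)] (H : RegularModel ν M m g G σ) {f : X → ℝ} {c : ℝ}
    (hf : Measurable f) (hc : ∀ x, |f x| ≤ c) :
    ∫ x, f x ∂(forwardMeasure M₀ M g (t + 1)) =
      ∫ x, g t x * ∫ z, f z ∂(M (t + 1) x) ∂(forwardMeasure M₀ M g t) := by
  have := H.isFiniteMeasure_forwardMeasure (M₀ := M₀) t
  have := H.isFiniteMeasure_withDensity (t := t) (forwardMeasure M₀ M g t)
  rw [forwardMeasure, ← Measure.snd_compProd, Measure.snd,
    integral_map measurable_snd.aemeasurable hf.aestronglyMeasurable,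
    Measure.integral_compProd (f := fun p => f p.2)
      (integrable_of_abs_le (hf.comp measurable_snd) fun p => hc p.2),
    H.integral_withDensity_potential]

lemma integral_mixture [∀ t, IsMarkovKernel (M t)] (hg : ∀ t x, 0 < g t x) (x : ℕ → Fin N → X)
    {f : X → ℝ} {c : ℝ} (hf : Measurable f) (hc : ∀ x, |f x| ≤ c) :
    ∫ z, f z ∂(mixture M g t x) = ∑ j, normWeight g x t j * ∫ z, f z ∂(M (t + 1) (x t j)) := by
  have hi : ∀ j, Integrable f (M (t + 1) (x t j)) := fun j => integrable_of_abs_le hf hc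
  rw [mixture, integral_finsetSum_measure fun j _ => (hi j).smul_measure ENNReal.ofReal_ne_top]
  refine Finset.sum_congr rfl fun j _ => ?_
  rw [integral_smul_measure, ENNReal.toReal_ofReal (normWeight_nonneg hg x t j), smul_eq_mul]

omit [MeasurableSpace X] in
lemma gammaParticle_truncate (f : X → ℝ) (x : ℕ → Fin N → X) :
    gammaParticle g t f (truncate t x) = gammaParticle g t f x := by
  simp [gammaParticle, gammaOne_truncate, truncate_of_le le_rfl]

lemma measurable_gammaParticle (hg : ∀ t, Measurable (g t)) {f : X → ℝ} (hf : Measurable f) :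
    Measurable fun x : ℕ → Fin N → X => gammaParticle g t f x :=
  (measurable_gammaOne hg t).mul
    ((Finset.measurable_sum _ fun i _ => hf.comp (by fun_prop)).const_mul _)

/-- The Ω_t in the normalized weights cancels the last factor of the normalizing constant. The right
side is the conditional mean of the particle measure at t + 1, so these measures obey the same
recursion as `forwardMeasure`. -/
lemma gammaParticle_step [∀ t, IsMarkovKernel (M t)] (hg : ∀ t x, 0 < g t x) (hN : 0 < N)
    (x : ℕ → Fin N → X) {f : X → ℝ} {c : ℝ} (hf : Measurable f) (hc : ∀ x, |f x| ≤ c) :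
    gammaParticle g t (fun u => g t u * ∫ z, f z ∂(M (t + 1) u)) x =
      gammaOne g x (t + 1) * ∫ z, f z ∂(mixture M g t x) := by
  have hΩ := (totalWeight_pos hg hN x t).ne'
  rw [integral_mixture hg x hf hc, gammaParticle]
  simp only [gammaOne, Finset.prod_range_succ, normWeight, Finset.mul_sum]
  refine Finset.sum_congr rfl fun j _ => ?_
  field_simp

variable {Ω : Type*} [MeasurableSpace Ω] {P : Measure Ω} [IsProbabilityMeasure P]
  {ξ : ℕ → Fin N → Ω → X} {A : ℕ → Fin N → Ω → Fin N}

lemma lintegral_sq_empirical_sub_le (μ : Measure X) [IsProbabilityMeasure μ] (hN : 0 < N)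
    {f : X → ℝ} {c : ℝ} (hf : Measurable f) (hc : ∀ x, |f x| ≤ c) :
    ∫⁻ y, ENNReal.ofReal (((N : ℝ)⁻¹ * ∑ i, f (y i) - ∫ z, f z ∂μ) ^ 2)
      ∂(Measure.pi fun _ : Fin N => μ) ≤ ENNReal.ofReal (c ^ 2 / N) := by
  have : Nonempty (Fin N) := ⟨⟨0, hN⟩⟩
  have hN' : (0 : ℝ) < N := by exact_mod_cast hN
  rw [← ofReal_integral_eq_lintegral_ofReal]
  · refine ENNReal.ofReal_le_ofReal ?_
    have key := integral_sq_empirical_sub_le (ι := Fin N) μ hf hc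
    rw [Fintype.card_fin] at key
    refine key.trans (div_le_div_of_nonneg_right ((le_abs_self _).trans
      (abs_integral_le_of_abs_le fun z => ?_)) hN'.le)
    rw [abs_pow]
    exact pow_le_pow_left₀ (abs_nonneg _) (hc z) 2
  · refine integrable_of_abs_le (c := ((N : ℝ)⁻¹ * (N * c) + c) ^ 2)
      (by fun_prop) fun y => ?_
    rw [abs_pow]
    refine pow_le_pow_left₀ (abs_nonneg _) ((abs_sub _ _).trans (add_le_add ?_
      (abs_integral_le_of_abs_le hc))) 2
    rw [abs_mul, abs_of_nonneg (by positivity : (0 : ℝ) ≤ (N : ℝ)⁻¹)]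
    refine mul_le_mul_of_nonneg_left ((Finset.abs_sum_le_sum_abs _ _).trans ?_) (by positivity)
    simpa using Finset.sum_le_card_nsmul Finset.univ (fun i => |f (y i)|) c fun i _ => hc _
  · exact Eventually.of_forall fun y => sq_nonneg _

/-- The unnormalized particle measures converge in mean square at the rate `1 / N`, uniformly over
functions with a given bound. -/
theorem RegularModel.exists_lintegral_sq_gammaParticle_le [IsProbabilityMeasure M₀]
    [∀ t, IsMarkovKernel (M t)] (H : RegularModel ν M m g G σ) (t : ℕ) :
    ∃ C : ℝ, 0 ≤ C ∧ ∀ {N : ℕ} {Ω : Type*} [MeasurableSpace Ω] (P : Measure Ω)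
      [IsProbabilityMeasure P] (ξ : ℕ → Fin N → Ω → X) (A : ℕ → Fin N → Ω → Fin N),
      IsParticleFilter P M₀ M g ξ A → 0 < N → ∀ {f : X → ℝ} {c : ℝ}, Measurable f →
      (∀ x, |f x| ≤ c) →
      ∫⁻ ω, ENNReal.ofReal ((gammaParticle g t f (fun s i => ξ s i ω) -
        ∫ x, f x ∂(forwardMeasure M₀ M g t)) ^ 2) ∂P ≤ ENNReal.ofReal (C * c ^ 2 / N) := by
  have hG := H.bound_pos
  induction t with
  | zero =>
    refine ⟨1, zero_le_one, fun {N Ω} _ P _ ξ A hPF hN f c hf hc => ?_⟩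
    have key := lintegral_sq_empirical_sub_le M₀ hN hf hc
    rw [← hPF.init, lintegral_map (by fun_prop)
      (measurable_pi_lambda _ fun i => hPF.measurable_particle 0 i)] at key
    simpa [gammaParticle, gammaOne, forwardMeasure] using key
  | succ t ih =>
    obtain ⟨C, hC0, hC⟩ := ih
    -- The first part is the sampling variance of one step, with the normalizing constant bounded by
    -- G^(t+1); the second is the induction hypothesis for f', which is bounded by G c. The constant
    -- depends on neither f nor N.
    refine ⟨2 * (G ^ (t + 1)) ^ 2 + 2 * (C * G ^ 2), by positivity,
      fun {N Ω} _ P _ ξ A hPF hN f c hf hc => ?_⟩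
    have hN' : (0 : ℝ) < N := by exact_mod_cast hN
    have hgm := H.measurable_potential
    set f' : X → ℝ := fun u => g t u * ∫ z, f z ∂(M (t + 1) u) with hf'
    have hf'm : Measurable f' :=
      (hgm t).mul (hf.stronglyMeasurable.integral_kernel (κ := M (t + 1))).measurable
    have hf'c : ∀ u, |f' u| ≤ G * c := fun u => by
      rw [hf', abs_mul, abs_of_pos (H.potential_pos t u)]
      exact mul_le_mul (H.potential_le t u) (abs_integral_le_of_abs_le hc) (abs_nonneg _) hG.le
    have h1 := hC P ξ A hPF hN hf'm hf'c
    rw [H.integral_forwardMeasure_succ hf hc]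
    set F : (ℕ → Fin N → X) → (Fin N → X) → ℝ := fun x y =>
      gammaOne g x (t + 1) * ((N : ℝ)⁻¹ * ∑ i, f (y i)) - gammaParticle g t f' x with hF
    have hFm : Measurable (Function.uncurry F) := by
      have hs : Measurable fun q : (ℕ → Fin N → X) × (Fin N → X) => (N : ℝ)⁻¹ * ∑ i, f (q.2 i) := by
        fun_prop
      exact (((measurable_gammaOne hgm (t + 1)).comp measurable_fst).mul hs).sub
        ((measurable_gammaParticle hgm hf'm).comp measurable_fst)
    have h2 : ∫⁻ ω, ENNReal.ofReal (F (truncate t fun s i => ξ s i ω)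
        (fun i => ξ (t + 1) i ω) ^ 2) ∂P ≤ ENNReal.ofReal ((G ^ (t + 1)) ^ 2 * (c ^ 2 / N)) := by
      rw [hPF.lintegral_step H.potential_pos hgm hN t
        (F := fun x y => ENNReal.ofReal (F x y ^ 2)) (hFm.pow_const 2).ennreal_ofReal]
      refine (lintegral_mono (g := fun _ => ENNReal.ofReal ((G ^ (t + 1)) ^ 2 * (c ^ 2 / N)))
        fun ω => ?_).trans (by simp)
      have := isProbabilityMeasure_mixture (M := M) (t := t) H.potential_pos hN
        fun s i => ξ s i ω
      have e : ∀ y, F (truncate t fun s i => ξ s i ω) y ^ 2 =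
          gammaOne g (fun s i => ξ s i ω) (t + 1) ^ 2 * ((N : ℝ)⁻¹ * ∑ i, f (y i) -
            ∫ z, f z ∂(mixture M g t fun s i => ξ s i ω)) ^ 2 := fun y => by
        simp only [hF]
        rw [gammaOne_succ_truncate, gammaParticle_truncate, hf',
          gammaParticle_step H.potential_pos hN _ hf hc]
        ring
      simp only [e, ENNReal.ofReal_mul (sq_nonneg (gammaOne g (fun s i => ξ s i ω) (t + 1)))]
      rw [lintegral_const_mul' _ _ ENNReal.ofReal_ne_top, ENNReal.ofReal_mul (by positivity)]
      exact mul_le_mul' (ENNReal.ofReal_le_ofReal (pow_le_pow_left₀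
        (gammaOne_nonneg H.potential_pos _ _)
        (gammaOne_le hG H.potential_pos H.potential_le _ _) 2))
        (lintegral_sq_empirical_sub_le _ hN hf hc)
    have e2 : ∀ ω, ENNReal.ofReal ((gammaParticle g (t + 1) f (fun s i => ξ s i ω) -
        ∫ x, f' x ∂(forwardMeasure M₀ M g t)) ^ 2) ≤
        2 * ENNReal.ofReal (F (truncate t fun s i => ξ s i ω) (fun i => ξ (t + 1) i ω) ^ 2) +
        2 * ENNReal.ofReal ((gammaParticle g t f' (fun s i => ξ s i ω) -
          ∫ x, f' x ∂(forwardMeasure M₀ M g t)) ^ 2) := fun ω => by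
      have e3 : F (truncate t fun s i => ξ s i ω) (fun i => ξ (t + 1) i ω) =
          gammaParticle g (t + 1) f (fun s i => ξ s i ω) -
            gammaParticle g t f' (fun s i => ξ s i ω) := by
        simp only [hF]
        rw [gammaOne_succ_truncate, gammaParticle_truncate]
        rfl
      rw [e3, show (2 : ℝ≥0∞) = ENNReal.ofReal 2 by simp, ← ENNReal.ofReal_mul zero_le_two,
        ← ENNReal.ofReal_mul zero_le_two, ← ENNReal.ofReal_add (by positivity) (by positivity)]
      refine ENNReal.ofReal_le_ofReal ?_
      generalize gammaParticle g (t + 1) f (fun s i => ξ s i ω) = u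
      generalize gammaParticle g t f' (fun s i => ξ s i ω) = v
      generalize ∫ x, f' x ∂(forwardMeasure M₀ M g t) = w
      nlinarith [sq_nonneg ((u - v) - (v - w))]
    refine (lintegral_mono e2).trans ?_
    rw [lintegral_add_right', lintegral_const_mul' _ _ (by simp), lintegral_const_mul' _ _ (by simp)]
    · refine (add_le_add (mul_le_mul_right h2 2) (mul_le_mul_right h1 2)).trans (le_of_eq ?_)
      rw [show (2 : ℝ≥0∞) = ENNReal.ofReal 2 by simp, ← ENNReal.ofReal_mul zero_le_two,
        ← ENNReal.ofReal_mul zero_le_two, ← ENNReal.ofReal_add (by positivity) (by positivity)]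
      congr 1
      ring
    · exact (((((measurable_gammaParticle hgm hf'm).comp hPF.measurable_array).sub_const
        _).pow_const 2).ennreal_ofReal.const_mul 2).aemeasurable

end ForwardMeasure

/-! ### The increments vanish without a lower bound on the densities -/

section Increments

variable {X : Type*} [MeasurableSpace X] {N : ℕ}
  {ν M₀ : Measure X} {M : ℕ → Kernel X X} {m : ℕ → X → X → ℝ} {g : ℕ → X → ℝ} {G σ : ℝ}
  {t : ℕ}

/-- A single transition law has an everywhere positive finite density with respect to ν, so ν has a
finite density with respect to that probability measure. This makes Fubini's theorem available for
ν. -/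
lemma RegularModel.sigmaFinite [Nonempty X] [∀ t, IsMarkovKernel (M t)]
    (H : RegularModel ν M m g G σ) : SigmaFinite ν := by
  obtain ⟨u⟩ := ‹Nonempty X›
  have hm : Measurable fun z => ENNReal.ofReal (m (0 + 1) u z) :=
    (H.measurable_density_right 0 u).ennreal_ofReal
  have h0 : ∀ z, ENNReal.ofReal (m (0 + 1) u z) ≠ 0 := fun z => by
    simpa using H.density_pos 0 u z
  have h := withDensity_inv_same (μ := ν) hm (Eventually.of_forall h0)
    (Eventually.of_forall fun z => ENNReal.ofReal_ne_top)
  rw [← H.kernel_eq 0 u] at h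
  rw [← h]
  exact SigmaFinite.withDensity_of_ne_top
    (Eventually.of_forall fun z => ENNReal.inv_ne_top.2 (h0 z))

/-- The limit of the unnormalized particle density of the next particle. -/
def forwardDensity (M₀ : Measure X) (M : ℕ → Kernel X X) (m : ℕ → X → X → ℝ) (g : ℕ → X → ℝ)
    (t : ℕ) (z : X) : ℝ :=
  ∫ u, g t u * m (t + 1) u z ∂(forwardMeasure M₀ M g t)

lemma RegularModel.measurable_potential_mul_density (H : RegularModel ν M m g G σ) (t : ℕ) :
    Measurable fun q : X × X => g t q.1 * m (t + 1) q.1 q.2 :=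
  ((H.measurable_potential t).comp measurable_fst).mul (H.measurable_density t)

lemma RegularModel.abs_potential_mul_density_le (H : RegularModel ν M m g G σ) (t : ℕ) (u z : X) :
    |g t u * m (t + 1) u z| ≤ G * σ := by
  rw [abs_of_pos (mul_pos (H.potential_pos t u) (H.density_pos t u z))]
  exact mul_le_mul (H.potential_le t u) (H.density_le t u z) (H.density_pos t u z).le
    H.bound_pos.le

lemma RegularModel.forwardMeasure_ne_zero [IsProbabilityMeasure M₀] [∀ t, IsMarkovKernel (M t)]
    (H : RegularModel ν M m g G σ) (t : ℕ) : forwardMeasure M₀ M g t ≠ 0 := by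
  induction t with
  | zero => exact IsProbabilityMeasure.ne_zero M₀
  | succ t ih =>
    intro h0
    have h1 := congrArg (fun μ => μ Set.univ) h0
    simp only [forwardMeasure, Measure.coe_zero, Pi.zero_apply] at h1
    rw [Measure.bind_apply MeasurableSet.univ (M (t + 1)).aemeasurable] at h1
    simp only [measure_univ, lintegral_one, withDensity_apply _ MeasurableSet.univ,
      Measure.restrict_univ] at h1
    rw [lintegral_eq_zero_iff (H.measurable_potential t).ennreal_ofReal] at h1
    refine ih (Measure.measure_univ_eq_zero.1 ?_)
    refine measure_mono_null (fun x _ => ?_) h1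
    simpa using H.potential_pos t x

lemma RegularModel.measurable_forwardDensity [IsProbabilityMeasure M₀]
    [∀ t, IsMarkovKernel (M t)] (H : RegularModel ν M m g G σ) (t : ℕ) :
    Measurable (forwardDensity M₀ M m g t) := by
  have := H.isFiniteMeasure_forwardMeasure (M₀ := M₀) t
  exact ((H.measurable_potential_mul_density t).stronglyMeasurable.integral_prod_left').measurable

lemma RegularModel.forwardDensity_pos [IsProbabilityMeasure M₀] [∀ t, IsMarkovKernel (M t)]
    (H : RegularModel ν M m g G σ) (t : ℕ) (z : X) : 0 < forwardDensity M₀ M m g t z := by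
  have := H.isFiniteMeasure_forwardMeasure (M₀ := M₀) t
  have hpos : ∀ u, 0 < g t u * m (t + 1) u z := fun u =>
    mul_pos (H.potential_pos t u) (H.density_pos t u z)
  rw [forwardDensity, integral_pos_iff_support_of_nonneg (fun u => (hpos u).le)
    (integrable_of_abs_le ((H.measurable_potential_mul_density t).comp measurable_prodMk_right)
      fun u => H.abs_potential_mul_density_le t u z)]
  have : Function.support (fun u => g t u * m (t + 1) u z) = Set.univ := by
    ext u; simpa using ⟨(H.potential_pos t u).ne', (H.density_pos t u z).ne'⟩
  rw [this, pos_iff_ne_zero, Ne, Measure.measure_univ_eq_zero]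
  exact H.forwardMeasure_ne_zero t

/-- Markov's inequality: the ν-integral of the limiting density is at most G times the finite mass
of the forward measure, since each m(u, ·) integrates to one. -/
lemma RegularModel.measure_forwardDensity_ge_lt_top [Nonempty X] [IsProbabilityMeasure M₀]
    [∀ t, IsMarkovKernel (M t)] (H : RegularModel ν M m g G σ) (t : ℕ) {ε : ℝ} (hε : 0 < ε) :
    ν {z | ε ≤ forwardDensity M₀ M m g t z} < ∞ := by
  have := H.sigmaFinite
  have := H.isFiniteMeasure_forwardMeasure (M₀ := M₀) t
  have h1 : ∫⁻ z, ENNReal.ofReal (forwardDensity M₀ M m g t z) ∂ν < ∞ := by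
    have e : ∀ z, ENNReal.ofReal (forwardDensity M₀ M m g t z) =
        ∫⁻ u, ENNReal.ofReal (g t u * m (t + 1) u z) ∂(forwardMeasure M₀ M g t) := fun z =>
      ofReal_integral_eq_lintegral_ofReal
        (integrable_of_abs_le ((H.measurable_potential_mul_density t).comp measurable_prodMk_right)
          fun u => H.abs_potential_mul_density_le t u z)
        (Eventually.of_forall fun u => (mul_pos (H.potential_pos t u) (H.density_pos t u z)).le)
    simp only [e]
    rw [lintegral_lintegral_swap ((H.measurable_potential_mul_density t).comp
      measurable_swap).ennreal_ofReal.aemeasurable]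
    calc ∫⁻ u, ∫⁻ z, ENNReal.ofReal (g t u * m (t + 1) u z) ∂ν ∂(forwardMeasure M₀ M g t)
        ≤ ∫⁻ _, ENNReal.ofReal G ∂(forwardMeasure M₀ M g t) := by
          refine lintegral_mono fun u => ?_
          simp only [ENNReal.ofReal_mul (H.potential_pos t u).le]
          rw [lintegral_const_mul' _ _ ENNReal.ofReal_ne_top]
          have h2 : ∫⁻ z, ENNReal.ofReal (m (t + 1) u z) ∂ν = 1 := by
            have := measure_univ (μ := M (t + 1) u)
            rwa [H.kernel_eq, withDensity_apply _ MeasurableSet.univ,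
              Measure.restrict_univ] at this
          rw [h2, mul_one]
          exact ENNReal.ofReal_le_ofReal (H.potential_le t u)
      _ < ∞ := by simpa using ENNReal.mul_lt_top ENNReal.ofReal_lt_top (measure_lt_top _ _)
  have h2 := mul_meas_ge_le_lintegral (μ := ν)
    (H.measurable_forwardDensity (M₀ := M₀) t).ennreal_ofReal (ENNReal.ofReal ε)
  have e : {z | ENNReal.ofReal ε ≤ ENNReal.ofReal (forwardDensity M₀ M m g t z)} =
      {z | ε ≤ forwardDensity M₀ M m g t z} := by
    ext z
    exact ENNReal.ofReal_le_ofReal_iff (H.forwardDensity_pos t z).le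
  rw [e] at h2
  by_contra hcon
  rw [not_lt_top_iff.1 hcon, ENNReal.mul_top (by simpa using hε)] at h2
  exact absurd h1 (not_lt.2 h2)

/-- The particle density q_N is the mixture density times γ_{t+1}^N(1) ≤ G^(t+1). If q_N ≥ ε, the
mixture density is at least ε / G^(t+1), which gives the first term. Otherwise q_N is more than ε
below q, and the second term exceeds the cap 1. -/
lemma RegularModel.cappedInv_le (H : RegularModel ν M m g G σ) (hN : 0 < N) (x : ℕ → Fin N → X)
    {ε q : ℝ} (hε : 0 < ε) (hq : 2 * ε ≤ q) (z : X) :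
    cappedInv g m t x z ≤ G ^ (t + 1) / ε / N +
      (gammaParticle g t (fun u => g t u * m (t + 1) u z) x - q) ^ 2 / ε ^ 2 := by
  set qN := gammaParticle g t (fun u => g t u * m (t + 1) u z) x with hqN
  have hN' : (0 : ℝ) < N := by exact_mod_cast hN
  have hG := H.bound_pos
  have hp := H.mixtureDensity_pos (t := t) hN x z
  have hγ : 0 ≤ gammaOne g x (t + 1) := gammaOne_nonneg H.potential_pos x _
  have hγG := gammaOne_le hG H.potential_pos H.potential_le x (t + 1)
  have hrel : gammaOne g x (t + 1) * mixtureDensity g m t x z = qN := by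
    have hΩ := (totalWeight_pos H.potential_pos hN x t).ne'
    rw [hqN, gammaParticle]
    simp only [gammaOne, Finset.prod_range_succ, mixtureDensity, normWeight, Finset.mul_sum]
    refine Finset.sum_congr rfl fun j _ => ?_
    field_simp
  by_cases h : ε ≤ qN
  · have hle : cappedInv g m t x z ≤ G ^ (t + 1) / ε / N := by
      refine (min_le_right _ _).trans ?_
      rw [mul_inv, div_eq_mul_inv _ (N : ℝ), mul_comm]
      refine mul_le_mul_of_nonneg_right ?_ (by positivity)
      rw [inv_eq_one_div, div_le_div_iff₀ hp hε, one_mul]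
      calc ε ≤ qN := h
        _ = gammaOne g x (t + 1) * mixtureDensity g m t x z := hrel.symm
        _ ≤ _ := mul_le_mul_of_nonneg_right hγG hp.le
    have : 0 ≤ (qN - q) ^ 2 / ε ^ 2 := by positivity
    linarith
  · have h1 : 1 ≤ (qN - q) ^ 2 / ε ^ 2 := by
      rw [one_le_div (by positivity)]
      nlinarith
    have h2 := cappedInv_le_one (g := g) (m := m) (t := t) x z
    have : 0 ≤ G ^ (t + 1) / ε / N := by positivity
    linarith

end Increments

/-! ### Splitting the increment where the limiting density is small -/

section IncrementBound

variable {X : Type*} [MeasurableSpace X] {N : ℕ}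
  {ν M₀ : Measure X} {M : ℕ → Kernel X X} {m : ℕ → X → X → ℝ} {g : ℕ → X → ℝ} {G σ : ℝ}
  {t : ℕ}

/-- Every transition law is dominated by σ ν. The resulting bound is free of the paths, so its
estimator is a multiple of that of the constant 1. -/
lemma RegularModel.endMean_indicator_le (H : RegularModel ν M m g G σ) {B : Set X}
    (hB : MeasurableSet B) (hνB : ν B ≠ ∞) {r : X → ℝ} {c : ℝ} (hr : Measurable r)
    (hr0 : ∀ z, 0 ≤ r z) (hc : ∀ z, r z ≤ c) (p : (Fin (t + 1) → X) × (Fin (t + 1) → X)) :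
    endMean M g t (B.indicator r) p ≤ 2 * G ^ 2 * σ * ∫ z in B, r z ∂ν := by
  have hG := H.bound_pos
  have : IsFiniteMeasure (ν.restrict B) := isFiniteMeasure_restrict.2 hνB
  have hi : Integrable r (ν.restrict B) :=
    integrable_of_abs_le hr fun z => by rw [abs_of_nonneg (hr0 z)]; exact hc z
  have h1 : ∀ u, ∫ z, B.indicator r z ∂(M (t + 1) u) ≤ σ * ∫ z in B, r z ∂ν := fun u => by
    rw [H.integral_kernel]
    have e : (fun z => m (t + 1) u z * B.indicator r z) =
        B.indicator fun z => m (t + 1) u z * r z := by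
      funext z
      by_cases hz : z ∈ B <;> simp [hz]
    rw [e, integral_indicator hB, ← integral_const_mul]
    refine integral_mono_of_nonneg (Eventually.of_forall fun z =>
      mul_nonneg (H.density_pos _ _ _).le (hr0 z)) (hi.const_mul σ)
      (Eventually.of_forall fun z => mul_le_mul_of_nonneg_right (H.density_le _ _ _) (hr0 z))
  have h0 : ∀ u, 0 ≤ ∫ z, B.indicator r z ∂(M (t + 1) u) := fun u =>
    integral_nonneg fun z => Set.indicator_nonneg (fun z _ => hr0 z) z
  rw [endMean]
  calc _ ≤ G * G * (σ * ∫ z in B, r z ∂ν + σ * ∫ z in B, r z ∂ν) :=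
        mul_le_mul (mul_le_mul (H.potential_le _ _) (H.potential_le _ _)
          (H.potential_pos _ _).le hG.le) (add_le_add (h1 _) (h1 _))
          (add_nonneg (h0 _) (h0 _)) (by positivity)
    _ = _ := by ring

lemma RegularModel.endMean_eq_add [∀ t, IsMarkovKernel (M t)] {B : Set X}
    (hB : MeasurableSet B) {r : X → ℝ} {c : ℝ} (hr : Measurable r) (hr0 : ∀ z, 0 ≤ r z)
    (hc : ∀ z, r z ≤ c) (p : (Fin (t + 1) → X) × (Fin (t + 1) → X)) :
    endMean M g t r p = endMean M g t (Bᶜ.indicator r) p + endMean M g t (B.indicator r) p := by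
  have hi : ∀ u, Integrable r (M (t + 1) u) := fun u =>
    integrable_of_abs_le hr fun z => by rw [abs_of_nonneg (hr0 z)]; exact hc z
  have e : ∀ u, ∫ z, r z ∂(M (t + 1) u) =
      ∫ z, Bᶜ.indicator r z ∂(M (t + 1) u) + ∫ z, B.indicator r z ∂(M (t + 1) u) := fun u => by
    rw [← integral_add ((hi u).indicator hB.compl) ((hi u).indicator hB)]
    congr 1
    funext z
    by_cases hz : z ∈ B <;> simp [hz]
  simp only [endMean, e]
  ring

lemma RegularModel.endMean_mono [∀ t, IsMarkovKernel (M t)] (H : RegularModel ν M m g G σ)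
    {r r' : X → ℝ} {c : ℝ} (hr' : Measurable r') (hr0 : ∀ z, 0 ≤ r z) (hle : ∀ z, r z ≤ r' z)
    (hc : ∀ z, r' z ≤ c) (p : (Fin (t + 1) → X) × (Fin (t + 1) → X)) :
    endMean M g t r p ≤ endMean M g t r' p := by
  have hi : ∀ u, Integrable r' (M (t + 1) u) := fun u =>
    integrable_of_abs_le hr' fun z => by
      rw [abs_of_nonneg ((hr0 z).trans (hle z))]; exact hc z
  have h : ∀ u, ∫ z, r z ∂(M (t + 1) u) ≤ ∫ z, r' z ∂(M (t + 1) u) := fun u =>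
    integral_mono_of_nonneg (Eventually.of_forall hr0) (hi u) (Eventually.of_forall hle)
  exact mul_le_mul_of_nonneg_left (add_le_add (h _) (h _))
    (mul_nonneg (H.potential_pos _ _).le (H.potential_pos _ _).le)

/-- Young's inequality with weight η, followed by recentring u at d and v at y. It replaces the mean
of a product by second moments, the only quantities controlled by the induction. -/
lemma mul_le_of_weighted_sq {η u v : ℝ} (hη : 0 < η) (hu : 0 ≤ u) (hv : 0 ≤ v) (d y : ℝ) :
    u * v ≤ 2 * η * d ^ 2 + 2 * η⁻¹ * y ^ 2 + 2 * η⁻¹ * (v - y) ^ 2 + 2 * η * (u - d) ^ 2 := by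
  have h1 : u * v ≤ η * u ^ 2 + η⁻¹ * v ^ 2 := by
    have h2 : 0 ≤ η⁻¹ * (η * u - v) ^ 2 := by positivity
    have h3 : η⁻¹ * (η * u - v) ^ 2 = η * u ^ 2 - 2 * (u * v) + η⁻¹ * v ^ 2 := by
      field_simp
      ring
    linarith [mul_nonneg hu hv]
  have h4 : η * u ^ 2 ≤ η * (2 * d ^ 2 + 2 * (u - d) ^ 2) :=
    mul_le_mul_of_nonneg_left (by nlinarith [sq_nonneg (u - 2 * d)]) hη.le
  have h5 : η⁻¹ * v ^ 2 ≤ η⁻¹ * (2 * y ^ 2 + 2 * (v - y) ^ 2) :=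
    mul_le_mul_of_nonneg_left (by nlinarith [sq_nonneg (v - 2 * y)]) (by positivity)
  linarith

variable {Ω : Type*} [MeasurableSpace Ω] {P : Measure Ω} [IsProbabilityMeasure P]
  {ξ : ℕ → Fin N → Ω → X} {A : ℕ → Fin N → Ω → Fin N}

set_option maxHeartbeats 1000000 in
/-- A bound on the mean square increment which does not involve a lower bound on the densities:
the first two terms are small when `η` and then `ε` are small, and the others vanish as `N → ∞`. -/
theorem RegularModel.lintegral_increment_le [IsProbabilityMeasure M₀] [∀ t, IsMarkovKernel (M t)]
    (H : RegularModel ν M m g G σ) (hPF : IsParticleFilter P M₀ M g ξ A) (hN : 0 < N)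
    (b : Fin (t + 1) → Fin 2) {C : ℝ} (hC0 : 0 ≤ C)
    (hC : ∀ z, ∫⁻ ω, ENNReal.ofReal ((gammaParticle g t (fun u => g t u * m (t + 1) u z)
      (fun s i => ξ s i ω) - forwardDensity M₀ M m g t z) ^ 2) ∂P ≤ ENNReal.ofReal (C / N))
    {ε η : ℝ} (hε : 0 < ε) (hη : 0 < η) (d y : ℝ) :
    ∫⁻ ω, ENNReal.ofReal (bsEstimator g m t b (fun _ => 1) (fun s i => ξ s i ω) *
        bsEstimator g m t b (endMean M g t (cappedInv g m t fun s i => ξ s i ω))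
          (fun s i => ξ s i ω)) ∂P ≤
      ENNReal.ofReal (2 * η * d ^ 2) + ENNReal.ofReal (2 * η⁻¹ * y ^ 2) +
      ENNReal.ofReal (2 * η⁻¹) * ∫⁻ ω, ENNReal.ofReal ((bsEstimator g m t b (endMean M g t
        ({z | 2 * ε ≤ forwardDensity M₀ M m g t z}ᶜ.indicator fun _ => 1))
          (fun s i => ξ s i ω) - y) ^ 2) ∂P +
      ENNReal.ofReal (2 * η + 4 * G ^ 2 * σ *
          (ν {z | 2 * ε ≤ forwardDensity M₀ M m g t z}).toReal) *
        ∫⁻ ω, ENNReal.ofReal ((bsEstimator g m t b (fun _ => 1) (fun s i => ξ s i ω) - d) ^ 2) ∂P +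
      ENNReal.ofReal (4 * G ^ 2 * σ * (ν {z | 2 * ε ≤ forwardDensity M₀ M m g t z}).toReal *
        d ^ 2 * (G ^ (t + 1) / ε + C / ε ^ 2) / N) := by
  have : Nonempty X := nonempty_of_isProbabilityMeasure M₀
  have hG := H.bound_pos
  have hσ := H.sigma_pos
  have hN' : (0 : ℝ) < N := by exact_mod_cast hN
  have hgm := H.measurable_potential
  have hmm := H.measurable_density
  set q := forwardDensity M₀ M m g t
  have hqm : Measurable q := H.measurable_forwardDensity t
  set B : Set X := {z | 2 * ε ≤ q z} with hBdef
  have hB : MeasurableSet B := measurableSet_le measurable_const hqm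
  have hνB : ν B ≠ ∞ := (H.measure_forwardDensity_ge_lt_top t (by positivity)).ne
  have hfinB : IsFiniteMeasure (ν.restrict B) := isFiniteMeasure_restrict.2 hνB
  set V := (ν B).toReal
  set x : Ω → ℕ → Fin N → X := fun ω s i => ξ s i ω with hx
  have hxm : Measurable x := hPF.measurable_array
  set D : Ω → ℝ := fun ω => bsEstimator g m t b (fun _ => 1) (x ω) with hD
  have hDm : Measurable D := (measurable_bsEstimator hgm hmm b measurable_const).comp hxm
  have hD0 : ∀ ω, 0 ≤ D ω := fun ω =>
    bsEstimator_nonneg H.potential_pos H.density_pos hN b (fun _ => zero_le_one) _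
  have h1m : Measurable (Bᶜ.indicator fun _ : X => (1 : ℝ)) :=
    measurable_const.indicator hB.compl
  set Y : Ω → ℝ := fun ω =>
    bsEstimator g m t b (endMean M g t (Bᶜ.indicator fun _ => 1)) (x ω) with hY
  have hYm : Measurable Y :=
    (measurable_bsEstimator hgm hmm b (H.measurable_endMean h1m)).comp hxm
  set r : Ω → X → ℝ := fun ω => cappedInv g m t (x ω) with hr
  have hrm : ∀ ω, Measurable (r ω) := fun ω =>
    (H.measurable_cappedInv t).comp measurable_prodMk_left
  have hr0 : ∀ ω z, 0 ≤ r ω z := fun ω => H.cappedInv_nonneg hN _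
  have hr1 : ∀ ω z, r ω z ≤ 1 := fun ω => cappedInv_le_one _
  set qN : Ω → X → ℝ := fun ω z =>
    gammaParticle g t (fun u => g t u * m (t + 1) u z) (x ω) with hqN
  have hqNm : Measurable fun p : Ω × X => qN p.1 p.2 := by
    refine ((measurable_gammaOne hgm t).comp (hxm.comp measurable_fst)).mul
      ((Finset.measurable_sum _ fun i _ => ?_).const_mul _)
    exact (H.measurable_potential_mul_density t).comp
      (f := fun p : Ω × X => (ξ t i p.1, p.2))
      (((hPF.measurable_particle t i).comp measurable_fst).prodMk measurable_snd)
  -- A majorant of D² r on B. D² is split as 2 d² + 2 (D - d)²: the constant part meets the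
  -- quantitative bound on r, while the fluctuation only meets r ≤ 1, which avoids any fourth
  -- moment.
  set E : Ω → X → ℝ := fun ω z => 2 * d ^ 2 * (G ^ (t + 1) / ε / N) +
    2 * d ^ 2 / ε ^ 2 * (qN ω z - q z) ^ 2 + 2 * (D ω - d) ^ 2 with hE
  have hEm : Measurable fun p : Ω × X => E p.1 p.2 := by
    have h1 : Measurable fun p : Ω × X => D p.1 := hDm.comp measurable_fst
    have h2 : Measurable fun p : Ω × X => q p.2 := hqm.comp measurable_snd
    exact ((((hqNm.sub h2).pow_const 2).const_mul _).const_add _).add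
      (((h1.sub_const d).pow_const 2).const_mul 2)
  have hE0 : ∀ ω z, 0 ≤ E ω z := fun ω z => by positivity
  -- the pointwise bound
  have hpt : ∀ ω, ENNReal.ofReal (D ω * bsEstimator g m t b (endMean M g t (r ω)) (x ω)) ≤
      (ENNReal.ofReal (2 * η * d ^ 2) + ENNReal.ofReal (2 * η⁻¹ * y ^ 2) +
      ENNReal.ofReal (2 * η⁻¹) * ENNReal.ofReal ((Y ω - y) ^ 2) +
      ENNReal.ofReal (2 * η) * ENNReal.ofReal ((D ω - d) ^ 2)) +
      ENNReal.ofReal (2 * G ^ 2 * σ) * ∫⁻ z in B, ENNReal.ofReal (E ω z) ∂ν := fun ω => by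
    -- Off B the random function r is replaced by 1, so that Y is the estimator of a deterministic
    -- function.
    have hsplit : bsEstimator g m t b (endMean M g t (r ω)) (x ω) ≤
        Y ω + 2 * G ^ 2 * σ * (∫ z in B, r ω z ∂ν) * D ω := by
      have e : bsEstimator g m t b (endMean M g t (r ω)) (x ω) ≤
          bsEstimator g m t b (fun p => endMean M g t (Bᶜ.indicator fun _ => 1) p +
            (2 * G ^ 2 * σ * ∫ z in B, r ω z ∂ν) * 1) (x ω) := by
        refine bsEstimator_mono H.potential_pos H.density_pos hN b (fun p => ?_) _
        rw [RegularModel.endMean_eq_add hB (hrm ω) (hr0 ω) (hr1 ω), mul_one]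
        refine add_le_add (H.endMean_mono (c := 1) h1m
          (fun z => Set.indicator_nonneg (fun z _ => hr0 ω z) z)
          (fun z => Set.indicator_le_indicator (hr1 ω z)) (fun z => ?_) p)
          (H.endMean_indicator_le hB hνB (hrm ω) (hr0 ω) (hr1 ω) p)
        exact Set.indicator_le_self' (fun _ _ => zero_le_one) z
      rwa [bsEstimator_add, bsEstimator_const_mul] at e
    have hI0 : 0 ≤ ∫ z in B, r ω z ∂ν := integral_nonneg (hr0 ω)
    have hY0 : 0 ≤ Y ω := bsEstimator_nonneg H.potential_pos H.density_pos hN b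
      (fun p => H.endMean_nonneg (fun z => Set.indicator_nonneg (fun _ _ => zero_le_one) z) p) _
    have hDY : D ω * Y ω ≤ 2 * η * d ^ 2 + 2 * η⁻¹ * y ^ 2 + 2 * η⁻¹ * (Y ω - y) ^ 2 +
        2 * η * (D ω - d) ^ 2 := mul_le_of_weighted_sq hη (hD0 ω) hY0 d y
    have hI : ENNReal.ofReal (D ω ^ 2 * ∫ z in B, r ω z ∂ν) ≤
        ∫⁻ z in B, ENNReal.ofReal (E ω z) ∂ν := by
      have hi : Integrable (r ω) (ν.restrict B) := integrable_of_abs_le (hrm ω) fun z => by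
        rw [abs_of_nonneg (hr0 ω z)]; exact hr1 ω z
      rw [← integral_const_mul, ofReal_integral_eq_lintegral_ofReal (hi.const_mul _)
        (Eventually.of_forall fun z => mul_nonneg (sq_nonneg _) (hr0 ω z))]
      refine setLIntegral_mono' hB fun z hz => ENNReal.ofReal_le_ofReal ?_
      have h1 := H.cappedInv_le (t := t) hN (x ω) hε hz z
      have h2 : D ω ^ 2 ≤ 2 * d ^ 2 + 2 * (D ω - d) ^ 2 := by
        nlinarith [sq_nonneg (D ω - 2 * d)]
      calc D ω ^ 2 * r ω z ≤ (2 * d ^ 2 + 2 * (D ω - d) ^ 2) * r ω z :=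
            mul_le_mul_of_nonneg_right h2 (hr0 ω z)
        _ = 2 * d ^ 2 * r ω z + 2 * (D ω - d) ^ 2 * r ω z := by ring
        _ ≤ 2 * d ^ 2 * (G ^ (t + 1) / ε / N + (qN ω z - q z) ^ 2 / ε ^ 2) +
            2 * (D ω - d) ^ 2 * 1 :=
          add_le_add (mul_le_mul_of_nonneg_left h1 (by positivity))
            (mul_le_mul_of_nonneg_left (hr1 ω z) (by positivity))
        _ = E ω z := by simp only [hE]; ring
    calc ENNReal.ofReal (D ω * bsEstimator g m t b (endMean M g t (r ω)) (x ω))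
        ≤ ENNReal.ofReal ((2 * η * d ^ 2 + 2 * η⁻¹ * y ^ 2 + 2 * η⁻¹ * (Y ω - y) ^ 2 +
            2 * η * (D ω - d) ^ 2) + 2 * G ^ 2 * σ * (D ω ^ 2 * ∫ z in B, r ω z ∂ν)) := by
          refine ENNReal.ofReal_le_ofReal ?_
          have h1 := mul_le_mul_of_nonneg_left hsplit (hD0 ω)
          have h2 : D ω * (Y ω + 2 * G ^ 2 * σ * (∫ z in B, r ω z ∂ν) * D ω) =
              D ω * Y ω + 2 * G ^ 2 * σ * (D ω ^ 2 * ∫ z in B, r ω z ∂ν) := by ring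
          linarith
      _ = (ENNReal.ofReal (2 * η * d ^ 2) + ENNReal.ofReal (2 * η⁻¹ * y ^ 2) +
          ENNReal.ofReal (2 * η⁻¹) * ENNReal.ofReal ((Y ω - y) ^ 2) +
          ENNReal.ofReal (2 * η) * ENNReal.ofReal ((D ω - d) ^ 2)) +
          ENNReal.ofReal (2 * G ^ 2 * σ) * ENNReal.ofReal (D ω ^ 2 * ∫ z in B, r ω z ∂ν) := by
          rw [ENNReal.ofReal_add (by positivity) (by positivity),
            ENNReal.ofReal_add (by positivity) (by positivity),
            ENNReal.ofReal_add (by positivity) (by positivity),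
            ENNReal.ofReal_add (by positivity) (by positivity),
            ENNReal.ofReal_mul (p := 2 * η⁻¹) (q := (Y ω - y) ^ 2) (by positivity),
            ENNReal.ofReal_mul (p := 2 * η) (q := (D ω - d) ^ 2) (by positivity),
            ENNReal.ofReal_mul (p := 2 * G ^ 2 * σ) (by positivity)]
      _ ≤ _ := by gcongr
  -- the integral of `E`
  have hEint : ∫⁻ ω, ∫⁻ z in B, ENNReal.ofReal (E ω z) ∂ν ∂P ≤
      ENNReal.ofReal (V * (2 * d ^ 2 * (G ^ (t + 1) / ε + C / ε ^ 2) / N)) +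
        ENNReal.ofReal (2 * V) * ∫⁻ ω, ENNReal.ofReal ((D ω - d) ^ 2) ∂P := by
    rw [lintegral_lintegral_swap hEm.ennreal_ofReal.aemeasurable]
    have hz : ∀ z, ∫⁻ ω, ENNReal.ofReal (E ω z) ∂P ≤
        ENNReal.ofReal (2 * d ^ 2 * (G ^ (t + 1) / ε + C / ε ^ 2) / N) +
          ENNReal.ofReal 2 * ∫⁻ ω, ENNReal.ofReal ((D ω - d) ^ 2) ∂P := fun z => by
      have e : ∀ ω, ENNReal.ofReal (E ω z) = ENNReal.ofReal (2 * d ^ 2 * (G ^ (t + 1) / ε / N)) +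
          ENNReal.ofReal (2 * d ^ 2 / ε ^ 2) * ENNReal.ofReal ((qN ω z - q z) ^ 2) +
          ENNReal.ofReal 2 * ENNReal.ofReal ((D ω - d) ^ 2) := fun ω => by
        simp only [hE]
        rw [ENNReal.ofReal_add (by positivity) (by positivity),
          ENNReal.ofReal_add (by positivity) (by positivity),
          ENNReal.ofReal_mul (p := 2 * d ^ 2 / ε ^ 2) (by positivity),
          ENNReal.ofReal_mul (p := 2) (by positivity)]
      simp only [e]
      have hm1 : Measurable fun ω => ENNReal.ofReal ((D ω - d) ^ 2) :=
        ((hDm.sub_const d).pow_const 2).ennreal_ofReal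
      rw [lintegral_add_right _ (hm1.const_mul _), lintegral_add_left measurable_const,
        lintegral_const_mul' _ _ ENNReal.ofReal_ne_top,
        lintegral_const_mul' _ _ ENNReal.ofReal_ne_top, lintegral_const, measure_univ, mul_one]
      refine add_le_add ((add_le_add le_rfl (mul_le_mul_right (hC z) _)).trans (le_of_eq ?_)) le_rfl
      rw [← ENNReal.ofReal_mul (by positivity), ← ENNReal.ofReal_add (by positivity)
        (by positivity)]
      congr 1
      ring
    -- The bound is uniform in z, so integrating over B costs only the finite factor ν(B).
    refine (lintegral_mono hz).trans (le_of_eq ?_)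
    rw [lintegral_const, Measure.restrict_apply MeasurableSet.univ, Set.univ_inter,
      ← ENNReal.ofReal_toReal hνB, add_mul, ← ENNReal.ofReal_mul (by positivity)]
    congr 1
    · rw [mul_comm]
    · rw [mul_right_comm, ← ENNReal.ofReal_mul zero_le_two]
  refine (lintegral_mono hpt).trans ?_
  have hm1 : Measurable fun ω => ENNReal.ofReal ((D ω - d) ^ 2) :=
    ((hDm.sub_const d).pow_const 2).ennreal_ofReal
  have hm2 : Measurable fun ω => ENNReal.ofReal ((Y ω - y) ^ 2) :=
    ((hYm.sub_const y).pow_const 2).ennreal_ofReal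
  rw [lintegral_add_left]
  swap
  · exact (measurable_const.add (hm2.const_mul _)).add (hm1.const_mul _)
  rw [lintegral_add_right _ (hm1.const_mul _), lintegral_add_right _ (hm2.const_mul _),
    lintegral_const_mul' _ _ ENNReal.ofReal_ne_top, lintegral_const_mul' _ _ ENNReal.ofReal_ne_top,
    lintegral_const_mul' _ _ ENNReal.ofReal_ne_top, lintegral_const, measure_univ, mul_one]
  refine (add_le_add le_rfl (mul_le_mul_right hEint _)).trans (le_of_eq ?_)
  have hV : 0 ≤ V := ENNReal.toReal_nonneg
  have c1 : ENNReal.ofReal (2 * G ^ 2 * σ) *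
      ENNReal.ofReal (V * (2 * d ^ 2 * (G ^ (t + 1) / ε + C / ε ^ 2) / N)) =
      ENNReal.ofReal (4 * G ^ 2 * σ * V * d ^ 2 * (G ^ (t + 1) / ε + C / ε ^ 2) / N) := by
    rw [← ENNReal.ofReal_mul (by positivity)]
    congr 1
    ring
  have c2 : ENNReal.ofReal (2 * G ^ 2 * σ) * ENNReal.ofReal (2 * V) =
      ENNReal.ofReal (4 * G ^ 2 * σ * V) := by
    rw [← ENNReal.ofReal_mul (by positivity)]
    congr 1
    ring
  rw [mul_add, c1, ← mul_assoc (ENNReal.ofReal (2 * G ^ 2 * σ)), c2,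
    ENNReal.ofReal_add (p := 2 * η) (by positivity) (by positivity), add_mul]
  ring

end IncrementBound

/-! ### The target measure and the initial step -/

section Target

variable {X : Type*} [MeasurableSpace X] {N : ℕ}
  {ν M₀ : Measure X} {M : ℕ → Kernel X X} {m : ℕ → X → X → ℝ} {g : ℕ → X → ℝ} {G σ : ℝ}
  {t : ℕ}

instance [IsProbabilityMeasure M₀] (b : Fin 2) : IsProbabilityMeasure (biInit M₀ b) := by
  unfold biInit
  split_ifs
  · infer_instance
  · exact Measure.isProbabilityMeasure_map (by fun_prop)

lemma RegularModel.isFiniteMeasure_withDensity_pair (H : RegularModel ν M m g G σ)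
    (μ : Measure ((Fin (t + 1) → X) × (Fin (t + 1) → X))) [IsFiniteMeasure μ] :
    IsFiniteMeasure (μ.withDensity fun p =>
      ENNReal.ofReal (g t (p.1 (Fin.last t)) * g t (p.2 (Fin.last t)))) :=
  MeasureTheory.isFiniteMeasure_withDensity
    (((lintegral_mono fun p => ENNReal.ofReal_le_ofReal (mul_le_mul (H.potential_le t _)
      (H.potential_le t _) (H.potential_pos t _).le H.bound_pos.le)).trans_lt
      (by simpa using ENNReal.mul_lt_top ENNReal.ofReal_lt_top (measure_lt_top μ _))).ne)

lemma RegularModel.isFiniteMeasure_pathMeasure [IsProbabilityMeasure M₀]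
    [∀ t, IsMarkovKernel (M t)] (H : RegularModel ν M m g G σ) (t : ℕ) (b : Fin (t + 1) → Fin 2) :
    IsFiniteMeasure (pathMeasure M₀ M g t b) := by
  induction t with
  | zero => rw [pathMeasure]; infer_instance
  | succ t ih =>
    have := ih fun s => b s.castSucc
    have := H.isFiniteMeasure_withDensity_pair (pathMeasure M₀ M g t fun s => b s.castSucc)
    rw [pathMeasure]
    infer_instance

/-- The target obeys exactly the recursion satisfied by the conditional means of the estimator, so
the error at t + 1 passes to an error at t. -/
lemma RegularModel.integral_pathMeasure_succ [IsProbabilityMeasure M₀]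
    [∀ t, IsMarkovKernel (M t)] (H : RegularModel ν M m g G σ) (b : Fin (t + 2) → Fin 2)
    {h : (Fin (t + 2) → X) × (Fin (t + 2) → X) → ℝ} {c : ℝ} (hh : Measurable h)
    (hc : ∀ p, |h p| ≤ c) :
    ∫ p, h p ∂(pathMeasure M₀ M g (t + 1) b) =
      ∫ p, stepTarget M g t (b (Fin.last _)) h p
        ∂(pathMeasure M₀ M g t fun s => b s.castSucc) := by
  have := H.isFiniteMeasure_pathMeasure (M₀ := M₀) t fun s => b s.castSucc
  have := H.isFiniteMeasure_withDensity_pair (pathMeasure M₀ M g t fun s => b s.castSucc)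
  have hgm := H.measurable_potential t
  have hs := measurable_snocPair (X := X) (t := t)
  rw [pathMeasure]
  refine (integral_map hs.aemeasurable hh.aestronglyMeasurable).trans ?_
  rw [Measure.integral_compProd (f := fun q => h (snocPair q.1 q.2))
    (integrable_of_abs_le (hh.comp hs) fun q => hc _),
    integral_withDensity_eq_integral_toReal_smul (by fun_prop) (by simp)]
  refine integral_congr_ae (Eventually.of_forall fun p => ?_)
  simp only [Kernel.comap_apply, smul_eq_mul, stepTarget]
  rw [ENNReal.toReal_ofReal (mul_nonneg (H.potential_pos t _).le (H.potential_pos t _).le)]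

/-- The limiting density is positive everywhere, so each point eventually leaves the sets where it
is small. Dominated convergence is applied first to each transition law and then to μ. -/
lemma tendsto_integral_endMean_forwardDensity [IsProbabilityMeasure M₀]
    [∀ t, IsMarkovKernel (M t)] (H : RegularModel ν M m g G σ)
    (μ : Measure ((Fin (t + 1) → X) × (Fin (t + 1) → X))) [IsFiniteMeasure μ] :
    Tendsto (fun n : ℕ => ∫ p, endMean M g t
      ({z | 2 * (1 / ((n : ℝ) + 1)) ≤ forwardDensity M₀ M m g t z}ᶜ.indicator fun _ => 1) p ∂μ)
      atTop (𝓝 0) := by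
  set q := forwardDensity M₀ M m g t
  have hqm : Measurable q := H.measurable_forwardDensity t
  set r : ℕ → X → ℝ := fun n => {z | 2 * (1 / ((n : ℝ) + 1)) ≤ q z}ᶜ.indicator fun _ => 1 with hr
  have hrm : ∀ n, Measurable (r n) := fun n =>
    measurable_const.indicator (measurableSet_le measurable_const hqm).compl
  have hr0 : ∀ n z, 0 ≤ r n z := fun n z => Set.indicator_nonneg (fun _ _ => zero_le_one) z
  have hr1 : ∀ n z, r n z ≤ 1 := fun n z => Set.indicator_le_self' (fun _ _ => zero_le_one) z
  have hrlim : ∀ z, Tendsto (fun n => r n z) atTop (𝓝 0) := fun z => by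
    have h1 : Tendsto (fun n : ℕ => 2 * (1 / ((n : ℝ) + 1))) atTop (𝓝 0) := by
      simpa using tendsto_one_div_add_atTop_nhds_zero_nat.const_mul (2 : ℝ)
    refine tendsto_const_nhds.congr' ?_
    filter_upwards [h1.eventually (ge_mem_nhds (H.forwardDensity_pos (M₀ := M₀) t z))] with n hn
    simp only [hr]
    rw [Set.indicator_of_notMem]
    simpa using hn
  have hin : ∀ u, Tendsto (fun n => ∫ z, r n z ∂(M (t + 1) u)) atTop (𝓝 0) := fun u => by
    have := tendsto_integral_of_dominated_convergence (μ := M (t + 1) u) (F := r) (f := fun _ => 0)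
      (fun _ => 1) (fun n => (hrm n).aestronglyMeasurable) (integrable_const _)
      (fun n => Eventually.of_forall fun z => by
        rw [Real.norm_of_nonneg (hr0 n z)]; exact hr1 n z)
      (Eventually.of_forall hrlim)
    simpa using this
  have := tendsto_integral_of_dominated_convergence (μ := μ) (F := fun n => endMean M g t (r n))
    (f := fun _ => 0) (fun _ => G ^ 2 * (2 * 1))
    (fun n => (H.measurable_endMean (hrm n)).aestronglyMeasurable) (integrable_const _)
    (fun n => Eventually.of_forall fun p => by
      rw [Real.norm_of_nonneg (H.endMean_nonneg (hr0 n) p)]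
      exact H.endMean_le (hr0 n) (hr1 n) p)
    (Eventually.of_forall fun p => by
      simpa [endMean] using ((hin (p.1 (Fin.last t))).add (hin (p.2 (Fin.last t)))).const_mul
        (g t (p.1 (Fin.last t)) * g t (p.2 (Fin.last t))))
  rwa [integral_zero] at this

omit [MeasurableSpace X] in
lemma bsEstimator_zero (b : Fin 1 → Fin 2) (h : (Fin 1 → X) × (Fin 1 → X) → ℝ)
    (x : ℕ → Fin N → X) :
    bsEstimator g m 0 b h x = ∑ a : Fin N × Fin N,
      (if b 0 = 1 then (N : ℝ) else (N : ℝ) / ((N : ℝ) - 1)) * ((N : ℝ)⁻¹ * (N : ℝ)⁻¹ *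
        ((if a.1 = a.2 ∧ b 0 = 1 then 1 else 0) + (if a.1 ≠ a.2 ∧ b 0 = 0 then 1 else 0))) *
        h (fun _ => x 0 a.1, fun _ => x 0 a.2) := by
  rw [bsEstimator_eq_sum]
  refine (Fintype.sum_equiv ((Equiv.funUnique (Fin 1) (Fin N)).symm.prodCongr
    (Equiv.funUnique (Fin 1) (Fin N)).symm) _ _ fun a => ?_).symm
  have e : pathPair x (((Equiv.funUnique (Fin 1) (Fin N)).symm.prodCongr
      (Equiv.funUnique (Fin 1) (Fin N)).symm) a) = (fun _ => x 0 a.1, fun _ => x 0 a.2) := by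
    refine Prod.ext ?_ ?_ <;> funext s <;> obtain rfl : s = 0 := Fin.eq_zero s <;>
      simp [pathPair]
  rw [e]
  simp [estWeight, gammaOne, pathLaw₁, pathLaw₂, coalescence]

omit [MeasurableSpace X] in
lemma bsEstimator_zero_of_eq_one (hN : 0 < N) {b : Fin 1 → Fin 2} (hb : b 0 = 1)
    (h : (Fin 1 → X) × (Fin 1 → X) → ℝ) (x : ℕ → Fin N → X) :
    bsEstimator g m 0 b h x =
      (N : ℝ)⁻¹ * ∑ i, h (fun _ => x 0 i, fun _ => x 0 i) := by
  have hN' : (N : ℝ) ≠ 0 := by exact_mod_cast hN.ne'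
  rw [bsEstimator_zero, Fintype.sum_prod_type, Finset.mul_sum]
  refine Finset.sum_congr rfl fun i _ => ?_
  rw [Finset.sum_eq_single i]
  · simp [hb, hN']
  · intro j _ hj
    simp [hb, hj.symm]
  · simp

omit [MeasurableSpace X] in
lemma bsEstimator_zero_of_eq_zero (hN : 0 < N) {b : Fin 1 → Fin 2} (hb : b 0 = 0)
    (h : (Fin 1 → X) × (Fin 1 → X) → ℝ) (x : ℕ → Fin N → X) :
    bsEstimator g m 0 b h x = ((N : ℝ) * (N - 1))⁻¹ *
      ∑ a ∈ (Finset.univ : Finset (Fin N)).offDiag,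
        h (fun _ => x 0 a.1, fun _ => x 0 a.2) := by
  have hN' : (N : ℝ) ≠ 0 := by exact_mod_cast hN.ne'
  have ho : (Finset.univ : Finset (Fin N)).offDiag =
      Finset.univ.filter fun a : Fin N × Fin N => a.1 ≠ a.2 := by ext; simp
  rw [bsEstimator_zero, ho, Finset.sum_filter, Finset.mul_sum]
  refine Finset.sum_congr rfl fun a _ => ?_
  by_cases ha : a.1 = a.2
  · simp [hb, ha]
  · simp only [hb, ha, Fin.isValue, zero_ne_one, if_false, ne_eq, not_false_eq_true,
      and_self, if_true]
    field_simp
    ring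

variable {Ω : Type*} [MeasurableSpace Ω] {P : Measure Ω}
  {ξ : ℕ → Fin N → Ω → X} {A : ℕ → Fin N → Ω → Fin N}

/-- Each of the three terms of Hoeffding's bound is at most c²/N, and 153 = 3 · 51. -/
lemma lintegral_sq_uStatistic_sub_le (μ : Measure X) [IsProbabilityMeasure μ] (hN : 2 ≤ N)
    {Φ : X × X → ℝ} {c : ℝ} (hΦ : Measurable Φ) (hc : ∀ p, |Φ p| ≤ c) :
    ∫⁻ y, ENNReal.ofReal ((((N : ℝ) * (N - 1))⁻¹ *
        ∑ a ∈ (Finset.univ : Finset (Fin N)).offDiag, Φ (y a.1, y a.2) -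
          ∫ p, Φ p ∂(μ.prod μ)) ^ 2) ∂(Measure.pi fun _ : Fin N => μ) ≤
      ENNReal.ofReal (153 * c ^ 2 / N) := by
  have hN' : (2 : ℝ) ≤ N := by exact_mod_cast hN
  have hsq : ∀ {u : ℝ}, |u| ≤ c → u ^ 2 ≤ c ^ 2 := fun hu => by
    rw [← sq_abs]; exact pow_le_pow_left₀ (abs_nonneg _) hu 2
  have hint : ∀ {Y : Type _} [MeasurableSpace Y] (ρ : Measure Y) [IsProbabilityMeasure ρ]
      (f : Y → ℝ), (∀ y, |f y| ≤ c) → ∫ y, f y ^ 2 ∂ρ ≤ c ^ 2 := fun ρ _ f hf =>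
    (le_abs_self _).trans (abs_integral_le_of_abs_le fun y => by
      rw [abs_of_nonneg (sq_nonneg _)]; exact hsq (hf y))
  rw [← ofReal_integral_eq_lintegral_ofReal]
  · refine ENNReal.ofReal_le_ofReal ?_
    have key := integral_sq_uStatistic_sub_le (ι := Fin N) μ hΦ hc (by simpa using hN)
    rw [Fintype.card_fin] at key
    refine key.trans ?_
    have h1 : (∫ z, (∫ z', Φ (z, z') ∂μ) ^ 2 ∂μ) / N ≤ c ^ 2 / N :=
      div_le_div_of_nonneg_right (hint μ _ fun z => abs_integral_le_of_abs_le fun _ => hc _)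
        (by positivity)
    have h2 : (∫ z', (∫ z, Φ (z, z') ∂μ) ^ 2 ∂μ) / N ≤ c ^ 2 / N :=
      div_le_div_of_nonneg_right (hint μ _ fun z => abs_integral_le_of_abs_le fun _ => hc _)
        (by positivity)
    have h3 : (∫ p, Φ p ^ 2 ∂(μ.prod μ)) / (N : ℝ) ^ 2 ≤ c ^ 2 / N :=
      div_le_div₀ (sq_nonneg c) (hint _ _ hc) (by linarith) (by nlinarith)
    calc _ ≤ 51 * (c ^ 2 / N + c ^ 2 / N + c ^ 2 / N) := by gcongr
      _ = _ := by ring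
  · refine integrable_of_abs_le (c := (|((N : ℝ) * (N - 1))⁻¹| *
        ((Finset.univ : Finset (Fin N)).offDiag.card * c) + c) ^ 2) ?_ fun y => ?_
    · have : Measurable fun y : Fin N → X =>
          ∑ a ∈ (Finset.univ : Finset (Fin N)).offDiag, Φ (y a.1, y a.2) :=
        Finset.measurable_sum _ fun a _ => by fun_prop
      fun_prop
    · rw [abs_pow]
      refine pow_le_pow_left₀ (abs_nonneg _) ((abs_sub _ _).trans (add_le_add ?_
        (abs_integral_le_of_abs_le hc))) 2
      rw [abs_mul]
      refine mul_le_mul_of_nonneg_left ((Finset.abs_sum_le_sum_abs _ _).trans ?_) (abs_nonneg _)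
      simpa using Finset.sum_le_card_nsmul (Finset.univ : Finset (Fin N)).offDiag
        (fun a => |Φ (y a.1, y a.2)|) c fun a _ => hc _
  · exact Eventually.of_forall fun y => sq_nonneg _

/-- The mean square error of the estimator at time `0`. -/
theorem IsParticleFilter.lintegral_sq_zero_le [IsProbabilityMeasure M₀]
    (hPF : IsParticleFilter P M₀ M g ξ A) (hN : 2 ≤ N)
    (b : Fin 1 → Fin 2) {h : (Fin 1 → X) × (Fin 1 → X) → ℝ} {c : ℝ}
    (hh : Measurable h) (hc : ∀ p, |h p| ≤ c) :
    ∫⁻ ω, ENNReal.ofReal ((bsEstimator g m 0 b h (fun s i => ξ s i ω) -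
      ∫ p, h p ∂(pathMeasure M₀ M g 0 b)) ^ 2) ∂P ≤ ENNReal.ofReal (153 * c ^ 2 / N) := by
  have hN0 : 0 < N := by omega
  have hξ : Measurable fun ω i => ξ 0 i ω :=
    measurable_pi_lambda _ fun i => hPF.measurable_particle 0 i
  have hp : Measurable fun z : X × X => ((fun _ => z.1, fun _ => z.2) : (Fin 1 → X) × (Fin 1 → X)) :=
    by fun_prop
  set Φ : X × X → ℝ := fun z => h (fun _ => z.1, fun _ => z.2) with hΦdef
  have hΦ : Measurable Φ := hh.comp hp
  have hint : ∫ p, h p ∂(pathMeasure M₀ M g 0 b) = ∫ z, Φ z ∂(biInit M₀ (b 0)) := by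
    rw [pathMeasure, integral_map hp.aemeasurable hh.aestronglyMeasurable]
  rw [hint]
  obtain hb | hb : b 0 = 0 ∨ b 0 = 1 := by omega
  · have key := lintegral_sq_uStatistic_sub_le M₀ hN hΦ fun p => hc _
    rw [← hPF.init, lintegral_map _ hξ] at key
    · simpa only [bsEstimator_zero_of_eq_zero hN0 hb, hb, biInit, if_true] using key
    · have : Measurable fun y : Fin N → X =>
          ∑ a ∈ (Finset.univ : Finset (Fin N)).offDiag, Φ (y a.1, y a.2) :=
        Finset.measurable_sum _ fun a _ => by fun_prop
      fun_prop
  · have hd : Measurable fun z : X => (z, z) := by fun_prop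
    have key := lintegral_sq_empirical_sub_le M₀ hN0 (hΦ.comp hd) fun p => hc _
    rw [← hPF.init, lintegral_map (by fun_prop) hξ] at key
    have e : ∫ z, Φ z ∂(biInit M₀ (b 0)) = ∫ z, (Φ ∘ fun z => (z, z)) z ∂M₀ := by
      rw [biInit, hb, if_neg (by simp), integral_map hd.aemeasurable hΦ.aestronglyMeasurable]
      rfl
    simp only [bsEstimator_zero_of_eq_one hN0 hb, e]
    refine le_trans key (ENNReal.ofReal_le_ofReal ?_)
    gcongr
    nlinarith [sq_nonneg c]

end Target

/-! ### Mean square convergence -/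

section Convergence

/-- The second moment of `f`. -/
def meanSq {Ω : Type*} [MeasurableSpace Ω] (P : Measure Ω) (f : Ω → ℝ) : ℝ≥0∞ :=
  ∫⁻ ω, ENNReal.ofReal (f ω ^ 2) ∂P

lemma eLpNorm_two_eq_meanSq_rpow {Ω : Type*} [MeasurableSpace Ω] (P : Measure Ω) (f : Ω → ℝ) :
    eLpNorm f 2 P = meanSq P f ^ (1 / 2 : ℝ) := by
  rw [eLpNorm_eq_lintegral_rpow_enorm_toReal two_ne_zero ENNReal.ofNat_ne_top]
  simp only [ENNReal.toReal_ofNat, meanSq]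
  congr 1
  refine lintegral_congr fun ω => ?_
  rw [Real.enorm_eq_ofReal_abs, ENNReal.ofReal_rpow_of_nonneg (abs_nonneg _) zero_le_two,
    Real.rpow_two, sq_abs]

variable {X : Type*} [MeasurableSpace X] {ν M₀ : Measure X} [IsProbabilityMeasure M₀]
  {M : ℕ → Kernel X X} [∀ t, IsMarkovKernel (M t)] {m : ℕ → X → X → ℝ} {g : ℕ → X → ℝ} {G σ : ℝ}
  {t : ℕ}

section FixedSize

variable {N : ℕ} {Ω : Type*} [MeasurableSpace Ω] {P : Measure Ω} [IsProbabilityMeasure P]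
  {ξ : ℕ → Fin N → Ω → X} {A : ℕ → Fin N → Ω → Fin N}

/-- The error is the one-step increment plus the error at time t for `stepTarget`; the square of a
sum is at most twice the sum of the squares. -/
lemma IsParticleFilter.meanSq_succ_le (hPF : IsParticleFilter P M₀ M g ξ A)
    (H : RegularModel ν M m g G σ) (hN : 2 ≤ N) (b : Fin (t + 2) → Fin 2)
    {h : (Fin (t + 2) → X) × (Fin (t + 2) → X) → ℝ} {c : ℝ} (hh : Measurable h)
    (hc : ∀ p, |h p| ≤ c) :
    meanSq P (fun ω => bsEstimator g m (t + 1) b h (fun s i => ξ s i ω) -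
        ∫ p, h p ∂(pathMeasure M₀ M g (t + 1) b)) ≤
      2 * (ENNReal.ofReal (102 * (c ^ 2 * (G * σ) ^ 2)) *
        ∫⁻ ω, ENNReal.ofReal (bsEstimator g m t (fun s => b s.castSucc) (fun _ => 1)
            (fun s i => ξ s i ω) *
          bsEstimator g m t (fun s => b s.castSucc)
            (endMean M g t (cappedInv g m t fun s i => ξ s i ω)) (fun s i => ξ s i ω)) ∂P) +
      2 * meanSq P (fun ω => bsEstimator g m t (fun s => b s.castSucc)
        (stepTarget M g t (b (Fin.last _)) h) (fun s i => ξ s i ω) -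
        ∫ p, stepTarget M g t (b (Fin.last _)) h p
          ∂(pathMeasure M₀ M g t fun s => b s.castSucc)) := by
  rw [H.integral_pathMeasure_succ b hh hc]
  refine le_trans ?_ (add_le_add (mul_le_mul_right (hPF.lintegral_sq_step_le H hN b hh hc) 2)
    le_rfl)
  have hm : Measurable fun ω => ENNReal.ofReal ((bsEstimator g m t (fun s => b s.castSucc)
        (stepTarget M g t (b (Fin.last _)) h) (fun s i => ξ s i ω) -
        ∫ p, stepTarget M g t (b (Fin.last _)) h p
          ∂(pathMeasure M₀ M g t fun s => b s.castSucc)) ^ 2) :=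
    ((((measurable_bsEstimator H.measurable_potential H.measurable_density _
      (H.measurable_stepTarget _ hh)).comp hPF.measurable_array).sub_const
      _).pow_const 2).ennreal_ofReal
  rw [meanSq, meanSq, ← lintegral_const_mul' _ _ ENNReal.ofNat_ne_top,
    ← lintegral_const_mul' _ _ ENNReal.ofNat_ne_top, ← lintegral_add_right _ (hm.const_mul _)]
  refine lintegral_mono fun ω => ?_
  rw [show (2 : ℝ≥0∞) = ENNReal.ofReal 2 by simp, ← ENNReal.ofReal_mul zero_le_two,
    ← ENNReal.ofReal_mul zero_le_two, ← ENNReal.ofReal_add (by positivity) (by positivity)]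
  refine ENNReal.ofReal_le_ofReal ?_
  generalize bsEstimator g m (t + 1) b h (fun s i => ξ s i ω) = u
  generalize bsEstimator g m t (fun s => b s.castSucc)
    (stepTarget M g t (b (Fin.last _)) h) (fun s i => ξ s i ω) = v
  generalize ∫ p, stepTarget M g t (b (Fin.last _)) h p
    ∂(pathMeasure M₀ M g t fun s => b s.castSucc) = w
  nlinarith [sq_nonneg ((u - v) - (v - w))]

/-- With a lower bound on the densities, the increments are of order `1 / N`. -/
lemma RegularModel.lintegral_increment_le_of_bddBelow
    (H : RegularModel ν M m g G σ) {ρ : ℝ} (hρ : 0 < ρ) (hm : ∀ t x x', ρ ≤ m (t + 1) x x')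
    (hN : 0 < N) (b : Fin (t + 1) → Fin 2) (d : ℝ) :
    ∫⁻ ω, ENNReal.ofReal (bsEstimator g m t b (fun _ => 1) (fun s i => ξ s i ω) *
        bsEstimator g m t b (endMean M g t (cappedInv g m t fun s i => ξ s i ω))
          (fun s i => ξ s i ω)) ∂P ≤
      ENNReal.ofReal (2 * G ^ 2 / (N * ρ)) * (ENNReal.ofReal (2 * d ^ 2) +
        2 * meanSq P (fun ω => bsEstimator g m t b (fun _ => 1) (fun s i => ξ s i ω) - d)) := by
  have hG := H.bound_pos
  have hN' : (0 : ℝ) < N := by exact_mod_cast hN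
  rw [meanSq, ← lintegral_const_mul' _ _ ENNReal.ofNat_ne_top]
  have hc : ENNReal.ofReal (2 * d ^ 2) = ∫⁻ _, ENNReal.ofReal (2 * d ^ 2) ∂P := by simp
  rw [hc, ← lintegral_add_left measurable_const,
    ← lintegral_const_mul' _ _ ENNReal.ofReal_ne_top]
  refine lintegral_mono fun ω => ?_
  rw [show (2 : ℝ≥0∞) = ENNReal.ofReal 2 by simp, ← ENNReal.ofReal_mul zero_le_two,
    ← ENNReal.ofReal_add (by positivity) (by positivity), ← ENNReal.ofReal_mul (by positivity)]
  refine ENNReal.ofReal_le_ofReal ?_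
  set x : ℕ → Fin N → X := fun s i => ξ s i ω
  set D := bsEstimator g m t b (fun _ => 1) x
  have hD0 : 0 ≤ D := bsEstimator_nonneg H.potential_pos H.density_pos hN b
    (fun _ => zero_le_one) _
  -- The mixture density is a convex combination of transition densities and inherits their lower
  -- bound.
  have hr : ∀ z, cappedInv g m t x z ≤ (N * ρ)⁻¹ := fun z => by
    refine (min_le_right _ _).trans (inv_anti₀ (by positivity)
      (mul_le_mul_of_nonneg_left ?_ hN'.le))
    calc ρ = ∑ j, normWeight g x t j * ρ := by
          rw [← Finset.sum_mul, sum_normWeight H.potential_pos hN, one_mul]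
      _ ≤ _ := Finset.sum_le_sum fun j _ =>
          mul_le_mul_of_nonneg_left (hm t _ z) (normWeight_nonneg H.potential_pos x t j)
  have h1 : bsEstimator g m t b (endMean M g t (cappedInv g m t x)) x ≤
      G ^ 2 * (2 * (N * ρ)⁻¹) * D := by
    rw [← bsEstimator_const_mul]
    refine bsEstimator_mono H.potential_pos H.density_pos hN b (fun p => ?_) _
    rw [mul_one]
    exact H.endMean_le (H.cappedInv_nonneg hN x) hr p
  calc D * bsEstimator g m t b (endMean M g t (cappedInv g m t x)) x
      ≤ D * (G ^ 2 * (2 * (N * ρ)⁻¹) * D) := mul_le_mul_of_nonneg_left h1 hD0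
    _ = 2 * G ^ 2 / (N * ρ) * D ^ 2 := by rw [div_eq_mul_inv]; ring
    _ ≤ _ := mul_le_mul_of_nonneg_left (by nlinarith [sq_nonneg (D - 2 * d)]) (by positivity)

end FixedSize

variable {Ω : ℕ → Type*} [∀ N, MeasurableSpace (Ω N)] {P : (N : ℕ) → Measure (Ω N)}
  [∀ N, IsProbabilityMeasure (P N)] {ξ : (N : ℕ) → ℕ → Fin N → Ω N → X}
  {A : (N : ℕ) → ℕ → Fin N → Ω N → Fin N}

/-- If the estimators at time `t` converge in mean square, the next increments vanish. -/
lemma RegularModel.tendsto_lintegral_increment (H : RegularModel ν M m g G σ)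
    (hPF : ∀ N, IsParticleFilter (P N) M₀ M g (ξ N) (A N)) (b : Fin (t + 1) → Fin 2)
    (ih : ∀ (h : (Fin (t + 1) → X) × (Fin (t + 1) → X) → ℝ) (c : ℝ), Measurable h →
      (∀ p, |h p| ≤ c) → Tendsto (fun N => meanSq (P N) fun ω =>
        bsEstimator g m t b h (fun s i => ξ N s i ω) - ∫ p, h p ∂(pathMeasure M₀ M g t b))
        atTop (𝓝 0)) :
    Tendsto (fun N => ∫⁻ ω, ENNReal.ofReal (bsEstimator g m t b (fun _ => 1)
        (fun s i => ξ N s i ω) *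
      bsEstimator g m t b (endMean M g t (cappedInv g m t fun s i => ξ N s i ω))
        (fun s i => ξ N s i ω)) ∂(P N)) atTop (𝓝 0) := by
  have := H.isFiniteMeasure_pathMeasure (M₀ := M₀) t b
  obtain ⟨C, hC0, hC⟩ := H.exists_lintegral_sq_gammaParticle_le (M₀ := M₀) t
  set d := ∫ _, (1 : ℝ) ∂(pathMeasure M₀ M g t b) with hd
  refine ENNReal.tendsto_nhds_zero.2 fun δ hδ => ?_
  -- The tolerance may be infinite; a finite smaller one allows real arithmetic.
  obtain ⟨δ', hδ'0, hδ'⟩ := ENNReal.lt_iff_exists_nnreal_btwn.1 hδ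
  have hδ'0' : (0 : ℝ) < δ' := by exact_mod_cast hδ'0
  -- The parameters are chosen in the order η, ε, N. Here 2 η d² ≤ δ'/4; the 1 added to d² covers d
  -- = 0.
  set η : ℝ := δ' / (8 * (d ^ 2 + 1)) with hηdef
  have hη : 0 < η := by positivity
  have hηd : 2 * η * d ^ 2 ≤ δ' / 4 := by
    have h1 : 8 * (η * (d ^ 2 + 1)) = δ' := by rw [hηdef]; field_simp
    nlinarith
  have hyt := tendsto_integral_endMean_forwardDensity (M₀ := M₀) H (pathMeasure M₀ M g t b)
  have hyt2 := (hyt.pow 2).const_mul (2 * η⁻¹)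
  rw [zero_pow two_ne_zero, mul_zero] at hyt2
  -- With η fixed, ε = 1/(n + 1) is taken so small that the limiting contribution off B, multiplied
  -- by 2 η⁻¹, is below δ'/4.
  obtain ⟨n, hn⟩ := (hyt2.eventually (gt_mem_nhds (by positivity : (0 : ℝ) < δ' / 4))).exists
  set ε : ℝ := 1 / ((n : ℝ) + 1)
  have hε : 0 < ε := by positivity
  set f : (Fin (t + 1) → X) × (Fin (t + 1) → X) → ℝ := endMean M g t
    ({z | 2 * ε ≤ forwardDensity M₀ M m g t z}ᶜ.indicator fun _ => 1) with hf
  have hBm : MeasurableSet {z | 2 * ε ≤ forwardDensity M₀ M m g t z} :=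
    measurableSet_le measurable_const (H.measurable_forwardDensity t)
  have hfm : Measurable f := H.measurable_endMean (measurable_const.indicator hBm.compl)
  have hfc : ∀ p, |f p| ≤ G ^ 2 * (2 * 1) := fun p => by
    have h0 : ∀ z, 0 ≤ ({z | 2 * ε ≤ forwardDensity M₀ M m g t z}ᶜ.indicator fun _ => (1 : ℝ)) z :=
      fun z => Set.indicator_nonneg (fun _ _ => zero_le_one) z
    rw [hf, abs_of_nonneg (H.endMean_nonneg h0 p)]
    exact H.endMean_le h0 (fun z => Set.indicator_le_self' (fun _ _ => zero_le_one) z) p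
  have hY := ih f _ hfm hfc
  have hD := ih (fun _ => 1) 1 measurable_const (by simp)
  set K₁ := 2 * η + 4 * G ^ 2 * σ * (ν {z | 2 * ε ≤ forwardDensity M₀ M m g t z}).toReal
  set K₂ := 4 * G ^ 2 * σ * (ν {z | 2 * ε ≤ forwardDensity M₀ M m g t z}).toReal *
    d ^ 2 * (G ^ (t + 1) / ε + C * (G * σ) ^ 2 / ε ^ 2)
  have hNlim : Tendsto (fun N : ℕ => ENNReal.ofReal (K₂ / N)) atTop (𝓝 0) := by
    simpa using ENNReal.tendsto_ofReal (tendsto_const_div_atTop_nhds_zero_nat K₂)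
  -- With η and ε fixed, K₁ and K₂ do not depend on N, so all the remaining terms vanish as N grows.
  have hrest := ((ENNReal.Tendsto.const_mul hY (Or.inr (ENNReal.ofReal_ne_top
    (r := 2 * η⁻¹)))).add (ENNReal.Tendsto.const_mul hD (Or.inr (ENNReal.ofReal_ne_top
    (r := K₁))))).add hNlim
  simp only [mul_zero, add_zero] at hrest
  have hpos : 0 < ENNReal.ofReal (δ' / 4) := by simpa using hδ'0'
  filter_upwards [ENNReal.tendsto_nhds_zero.1 hrest _ hpos, eventually_gt_atTop 0] with N hN hN0
  refine (H.lintegral_increment_le (hPF N) hN0 b (C := C * (G * σ) ^ 2) (by positivity)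
    (fun z => hC (P N) (ξ N) (A N) (hPF N) hN0
      ((H.measurable_potential_mul_density t).comp measurable_prodMk_right)
      fun u => H.abs_potential_mul_density_le t u z) hε hη d
    (∫ p, f p ∂(pathMeasure M₀ M g t b))).trans ?_
  calc _ ≤ ENNReal.ofReal (δ' / 4) + ENNReal.ofReal (δ' / 4) + ENNReal.ofReal (δ' / 4) := by
        rw [add_assoc, add_assoc, ← add_assoc (ENNReal.ofReal (2 * η⁻¹) * _)]
        exact add_le_add (add_le_add (ENNReal.ofReal_le_ofReal hηd)
          (ENNReal.ofReal_le_ofReal hn.le)) hN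
    _ = ENNReal.ofReal (3 * (δ' / 4)) := by
        rw [← ENNReal.ofReal_add (by positivity) (by positivity),
          ← ENNReal.ofReal_add (by positivity) (by positivity)]
        congr 1
        ring
    _ ≤ ENNReal.ofReal δ' := ENNReal.ofReal_le_ofReal (by linarith)
    _ = δ' := ENNReal.ofReal_coe_nnreal
    _ ≤ δ := hδ'.le.trans (le_refl δ)

/-- The estimators converge in mean square. -/
theorem RegularModel.tendsto_meanSq (H : RegularModel ν M m g G σ)
    (hPF : ∀ N, IsParticleFilter (P N) M₀ M g (ξ N) (A N)) (t : ℕ) (b : Fin (t + 1) → Fin 2)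
    (h : (Fin (t + 1) → X) × (Fin (t + 1) → X) → ℝ) (c : ℝ) (hh : Measurable h)
    (hc : ∀ p, |h p| ≤ c) :
    Tendsto (fun N => meanSq (P N) fun ω =>
      bsEstimator g m t b h (fun s i => ξ N s i ω) - ∫ p, h p ∂(pathMeasure M₀ M g t b))
      atTop (𝓝 0) := by
  -- The hypothesis is needed for every bounded function at time t: besides `stepTarget`, the
  -- increment uses the constant 1 and the conditional mass of the set of small density.
  induction t generalizing c with
  | zero =>
    have hlim : Tendsto (fun N : ℕ => ENNReal.ofReal (153 * c ^ 2 / N)) atTop (𝓝 0) := by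
      simpa using ENNReal.tendsto_ofReal (tendsto_const_div_atTop_nhds_zero_nat (153 * c ^ 2))
    refine tendsto_of_tendsto_of_tendsto_of_le_of_le' tendsto_const_nhds hlim
      (Eventually.of_forall fun _ => zero_le) ?_
    filter_upwards [eventually_ge_atTop 2] with N hN
    exact (hPF N).lintegral_sq_zero_le hN b hh hc
  | succ t ih =>
    have hJ := H.tendsto_lintegral_increment hPF (fun s => b s.castSucc)
      fun h c hh hc => ih _ h c hh hc
    have hI := ih (fun s => b s.castSucc) (stepTarget M g t (b (Fin.last _)) h) _
      (H.measurable_stepTarget _ hh) (H.abs_stepTarget_le _ hc)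
    have hlim := (ENNReal.Tendsto.const_mul (a := 2) (ENNReal.Tendsto.const_mul hJ
      (Or.inr (ENNReal.ofReal_ne_top (r := 102 * (c ^ 2 * (G * σ) ^ 2)))))
      (Or.inr ENNReal.ofNat_ne_top)).add
      (ENNReal.Tendsto.const_mul (a := 2) hI (Or.inr ENNReal.ofNat_ne_top))
    simp only [mul_zero, add_zero] at hlim
    refine tendsto_of_tendsto_of_tendsto_of_le_of_le' tendsto_const_nhds hlim
      (Eventually.of_forall fun _ => zero_le) ?_
    filter_upwards [eventually_ge_atTop 2] with N hN
    exact (hPF N).meanSq_succ_le H hN b hh hc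

/-- With a lower bound on the densities, the mean square error is of order `1 / N`. -/
theorem RegularModel.exists_meanSq_le (H : RegularModel ν M m g G σ) {ρ : ℝ} (hρ : 0 < ρ)
    (hm : ∀ t x x', ρ ≤ m (t + 1) x x')
    (hPF : ∀ N, IsParticleFilter (P N) M₀ M g (ξ N) (A N)) (t : ℕ) (b : Fin (t + 1) → Fin 2)
    (h : (Fin (t + 1) → X) × (Fin (t + 1) → X) → ℝ) (c : ℝ) (hh : Measurable h)
    (hc : ∀ p, |h p| ≤ c) :
    ∃ C : ℝ, 0 ≤ C ∧ ∀ N : ℕ, 2 ≤ N → meanSq (P N) (fun ω =>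
      bsEstimator g m t b h (fun s i => ξ N s i ω) - ∫ p, h p ∂(pathMeasure M₀ M g t b)) ≤
      ENNReal.ofReal (C / N) := by
  induction t generalizing c with
  | zero => exact ⟨153 * c ^ 2, by positivity, fun N hN => (hPF N).lintegral_sq_zero_le hN b hh hc⟩
  | succ t ih =>
    have hG := H.bound_pos
    have hσ := H.sigma_pos
    obtain ⟨C₁, hC₁0, hC₁⟩ := ih (fun s => b s.castSucc) (fun _ => 1) 1 measurable_const (by simp)
    obtain ⟨C₂, hC₂0, hC₂⟩ := ih (fun s => b s.castSucc) (stepTarget M g t (b (Fin.last _)) h) _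
      (H.measurable_stepTarget _ hh) (H.abs_stepTarget_le _ hc)
    set d := ∫ _, (1 : ℝ) ∂(pathMeasure M₀ M g t fun s => b s.castSucc)
    refine ⟨2 * (102 * (c ^ 2 * (G * σ) ^ 2) * (2 * G ^ 2 / ρ * (2 * d ^ 2 + 2 * C₁))) + 2 * C₂,
      by positivity, fun N hN => ?_⟩
    have hN1 : (1 : ℝ) ≤ N := by exact_mod_cast (by omega : 1 ≤ N)
    have hN' : (0 : ℝ) < N := by linarith
    refine ((hPF N).meanSq_succ_le H hN b hh hc).trans ?_
    -- Boundedness of this term is enough, since the increment bound already carries a factor 1/N.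
    have h1 : meanSq (P N) (fun ω => bsEstimator g m t (fun s => b s.castSucc) (fun _ => 1)
        (fun s i => ξ N s i ω) - d) ≤ ENNReal.ofReal C₁ :=
      (hC₁ N hN).trans (ENNReal.ofReal_le_ofReal (div_le_self hC₁0 hN1))
    have h2 := H.lintegral_increment_le_of_bddBelow (P := P N) (ξ := ξ N) hρ hm (by omega)
      (fun s => b s.castSucc) d
    calc _ ≤ 2 * (ENNReal.ofReal (102 * (c ^ 2 * (G * σ) ^ 2)) *
          (ENNReal.ofReal (2 * G ^ 2 / (N * ρ)) * (ENNReal.ofReal (2 * d ^ 2) +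
            2 * ENNReal.ofReal C₁))) + 2 * ENNReal.ofReal (C₂ / N) := by
          refine add_le_add (mul_le_mul_right (mul_le_mul_right (h2.trans ?_) _) _)
            (mul_le_mul_right (hC₂ N hN) _)
          exact mul_le_mul_right (add_le_add le_rfl (mul_le_mul_right h1 _)) _
      _ = _ := by
          rw [show (2 : ℝ≥0∞) = ENNReal.ofReal 2 by simp, ← ENNReal.ofReal_mul zero_le_two,
            ← ENNReal.ofReal_add (by positivity) (by positivity),
            ← ENNReal.ofReal_mul (by positivity), ← ENNReal.ofReal_mul (by positivity),
            ← ENNReal.ofReal_mul zero_le_two, ← ENNReal.ofReal_mul zero_le_two,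
            ← ENNReal.ofReal_add (by positivity) (by positivity)]
          congr 1
          field_simp

end Convergence

end

end BackwardSampling

/-! ### From second moments to L² norms -/

theorem mainTheorem1 {X : Type*} [MeasurableSpace X]
    (ν M₀ : Measure X) [IsProbabilityMeasure M₀]
    (M : ℕ → Kernel X X) [∀ t, IsMarkovKernel (M t)]
    (m₀ : X → ℝ) (m : ℕ → X → X → ℝ) (g : ℕ → X → ℝ)
    (hdens : HasDensities ν M₀ M m₀ m)
    (hg : PotentialsBounded g)
    (hpos : DensitiesPositive m)
    (hup : DensitiesBoundedAbove m)
    {Ω : ℕ → Type*} [∀ N, MeasurableSpace (Ω N)]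
    (P : (N : ℕ) → Measure (Ω N)) [∀ N, IsProbabilityMeasure (P N)]
    (ξ : (N : ℕ) → ℕ → Fin N → Ω N → X) (A : (N : ℕ) → ℕ → Fin N → Ω N → Fin N)
    (hPF : ∀ N, IsParticleFilter (P N) M₀ M g (ξ N) (A N))
    (t : ℕ) (b : Fin (t + 1) → Fin 2)
    (h : (Fin (t + 1) → X) × (Fin (t + 1) → X) → ℝ)
    (hmeas : Measurable h) (hbdd : ∃ c : ℝ, ∀ p, |h p| ≤ c) :
    Tendsto (fun N : ℕ =>
        eLpNorm (fun ω => bsEstimator g m t b h (fun s i => ξ N s i ω) -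
          ∫ p, h p ∂(pathMeasure M₀ M g t b)) 2 (P N)) atTop (𝓝 0) ∧
      (DensitiesBoundedBelow m →
        ∃ C : ℝ, ∀ N : ℕ, 2 ≤ N →
          eLpNorm (fun ω => bsEstimator g m t b h (fun s i => ξ N s i ω) -
            ∫ p, h p ∂(pathMeasure M₀ M g t b)) 2 (P N) ≤
              ENNReal.ofReal (C / Real.sqrt N)) := by
  obtain ⟨hgm, G, hG0, hG⟩ := hg
  obtain ⟨σ, _, hσ⟩ := hup
  obtain ⟨c, hc⟩ := hbdd
  -- Raising σ to at least 1 makes G σ dominate the potentials as well as the products of potentials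
  -- and densities.
  have H : RegularModel ν M m g G (max 1 σ) :=
    { measurable_potential := hgm
      potential_pos := fun t x => (hG t x).1
      potential_le := fun t x => (hG t x).2
      bound_pos := hG0
      measurable_density := hdens.measurable
      density_pos := hpos
      density_le := fun t x x' => (hσ t x x').trans (le_max_right _ _)
      one_le := le_max_left _ _
      kernel_eq := hdens.eq }
  simp only [eLpNorm_two_eq_meanSq_rpow]
  constructor
  · have h1 := ((ENNReal.continuous_rpow_const (y := (1 / 2 : ℝ))).tendsto 0).comp
      (H.tendsto_meanSq hPF t b h c hmeas hc)
    rwa [ENNReal.zero_rpow_of_pos (by norm_num)] at h1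
  · rintro ⟨ρ, hρ, hm⟩
    obtain ⟨C, hC0, hC⟩ := H.exists_meanSq_le hρ hm hPF t b h c hmeas hc
    -- The mean square error is at most C/N, and the square root of this is √C / √N.
    refine ⟨Real.sqrt C, fun N hN => ?_⟩
    refine (ENNReal.rpow_le_rpow (hC N hN) (by norm_num)).trans (le_of_eq ?_)
    rw [ENNReal.ofReal_rpow_of_nonneg (by positivity) (by norm_num), ← Real.sqrt_eq_rpow,
      Real.sqrt_div hC0]
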